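/- A symmetric CW-complex is a Hausdorff space $X$ with a partition into locally closed cells such that for each cell $C$ there are $p \ge 0$, a finite subgroup $G \subset O(p)$ and a continuous map $B^p/G \to X$ ($B^p$ the closed unit ball of $\mathbb{R}^p$) that maps $(B^p)^\circ/G$ homeomorphically onto $C$ and maps $\partial B^p/G$ into the union of finitely many cells of dimension less than $p$; moreover, a subset of $X$ is closed if and only if its intersection with the closure of each cell is closed. Its $p$-skeleton $X^{(p)}$ is the union of the cells of dimension at most $p$ (so $X^{(p)} = \emptyset$ for $p<0$). **Theorem.** Let $X$ be a finite-dimensional symmetric CW-complex whose $p$-cells are $\{C_i \cong (B^p)^\circ/G_i : i \in I^p\}$ for finite subgroups $G_i \subset O(p)$, and let $A$ be an abelian group. Let $E$ be the spectral sequence of the filtration of the singular chain complex $C(X;A)$ by the subcomplexes $F_p = C(X^{(p)};A)$, that is, $$E_r^{p,q} = Z_r^{p}/(Z_{r-1}^{p-1} + \partial Z_{r-1}^{p+r-1}), \qquad Z_r^p = \{c \in F_p : \partial c \in F_{p-r}\},$$ in degree $p+q$ (more precisely, $Z_r^p$ and $Z_{r-1}^{p-1}$ are taken in degree $p+q$ and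 $Z_{r-1}^{p+r-1}$ in degree $p+q+1$), with the differentials $d_r\colon E_r^{p,q} \to E_r^{p-r,q+r-1}$ induced by $\partial$, for $r \ge 1$ and $p,q \in \mathbb{Z}$. Then $$E_1^{0,q} \cong H_q(X^{(0)};A), \qquad E_1^{p,q} \cong \bigoplus_{i \in I^p} \widetilde H_{p+q-1}(S^{p-1}/G_i;A) \quad (p \ge 1), \qquad E_1^{p,q} = 0 \quad (p<0),$$ and $E$ converges to the associated graded of the skeletal filtration on $H_*(X;A)$: for all sufficiently large $r$ (uniformly in $p,q$) the differentials $d_r$ vanish and $$E_r^{p,q} \cong E_\infty^{p,q} \cong \frac{\operatorname{im}\bigl(H_{p+q}(X^{(p)};A) \to H_{p+q}(X;A)\bigr)}{\operatorname{im}\bigl(H_{p+q}(X^{(p-1)};A) \to H_{p+q}(X;A)\bigr)}.$$ Here homology is singular homology, zero in negative degrees, and $\widetilde H$ is reduced homology. -/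

import Mathlib

open CategoryTheory

universe u

noncomputable section

namespace SymmCW

/-! ### Quotients of balls and spheres by subgroups of the orthogonal group -/

/-- The orthogonal group `O(p)`, as the group of linear isometries of Euclidean `ℝ^p`. -/
abbrev O (p : ℕ) : Type :=
  EuclideanSpace ℝ (Fin p) ≃ₗᵢ[ℝ] EuclideanSpace ℝ (Fin p)

/-- The closed unit ball `B^p` of Euclidean `ℝ^p`. -/
abbrev Ball (p : ℕ) : Type := Metric.closedBall (0 : EuclideanSpace ℝ (Fin p)) 1

/-- The unit sphere `S^(p-1)` of Euclidean `ℝ^p` (empty for `p = 0`). -/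
abbrev Sphere (p : ℕ) : Type := Metric.sphere (0 : EuclideanSpace ℝ (Fin p)) 1

/-- The relation of lying in one orbit of `G ≤ O(p)`, on a subset `s` of `ℝ^p`. -/
def orbitSetoid {p : ℕ} (G : Subgroup (O p)) (s : Set (EuclideanSpace ℝ (Fin p))) :
    Setoid s where
  r x y := ∃ g ∈ G, g x.1 = y.1
  iseqv :=
    { refl := fun _ => ⟨1, G.one_mem, rfl⟩
      symm := by
        rintro x y ⟨g, hg, h⟩
        exact ⟨g⁻¹, G.inv_mem hg, by rw [← h]; exact g.symm_apply_apply x.1⟩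
      trans := by
        rintro x y z ⟨g, hg, h⟩ ⟨k, hk, h'⟩
        exact ⟨k * g, G.mul_mem hk hg, by rw [← h', ← h]; rfl⟩ }

/-- `B^p / G`, with the quotient topology. -/
abbrev BallQuotient {p : ℕ} (G : Subgroup (O p)) : Type :=
  Quotient (orbitSetoid G (Metric.closedBall 0 1))

/-- `S^(p-1) / G`, with the quotient topology. -/
abbrev SphereQuotient {p : ℕ} (G : Subgroup (O p)) : Type :=
  Quotient (orbitSetoid G (Metric.sphere 0 1))

/-- `(B^p)° / G`, as a subset of `B^p / G`. -/
def ballInterior {p : ℕ} (G : Subgroup (O p)) : Set (BallQuotient G) :=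
  Quotient.mk _ '' {x : Ball p | ‖x.1‖ < 1}

/-- `∂B^p / G`, as a subset of `B^p / G`. -/
def ballBoundary {p : ℕ} (G : Subgroup (O p)) : Set (BallQuotient G) :=
  Quotient.mk _ '' {x : Ball p | ‖x.1‖ = 1}

/-! ### Symmetric CW-complexes -/

/-- The structure of a symmetric CW-complex on a topological space `X`, with chosen groups and
characteristic maps for its cells. -/
structure SymmetricCWComplex (X : Type u) [TopologicalSpace X] where
  /-- `X` is Hausdorff. -/
  t2 : T2Space X
  /-- The index set of the `p`-cells. -/
  cell (p : ℕ) : Type u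
  /-- The subgroup of `O(p)` that belongs to a `p`-cell. -/
  group {p : ℕ} (i : cell p) : Subgroup (O p)
  finite_group {p : ℕ} (i : cell p) : Finite (group i)
  /-- The characteristic map `B^p / G_i → X`. -/
  map {p : ℕ} (i : cell p) : BallQuotient (group i) → X
  continuous_map {p : ℕ} (i : cell p) : Continuous (map i)
  /-- `(B^p)° / G_i` is mapped homeomorphically onto its image, which is the cell `C_i`. -/
  isEmbedding_map {p : ℕ} (i : cell p) :
    Topology.IsEmbedding ((ballInterior (group i)).domRestrict (map i))
  /-- Cells are locally closed. -/
  isLocallyClosed {p : ℕ} (i : cell p) : IsLocallyClosed (map i '' ballInterior (group i))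
  /-- Distinct cells are disjoint. -/
  pairwise_disjoint :
    Pairwise fun c c' : Σ p, cell p =>
      Disjoint (map c.2 '' ballInterior (group c.2)) (map c'.2 '' ballInterior (group c'.2))
  /-- The cells cover `X`. -/
  iUnion_eq : ⋃ c : Σ p, cell p, map c.2 '' ballInterior (group c.2) = Set.univ
  /-- Apart from the cell itself, the image of `B^p / G_i` meets only finitely many cells, each of
  dimension less than `p`. -/
  closure_finite {p : ℕ} (i : cell p) :
    ∃ S : Finset (Σ m, cell m), (∀ c ∈ S, c.1 < p) ∧
      map i '' ballBoundary (group i) ⊆ ⋃ c ∈ S, map c.2 '' ballInterior (group c.2)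
  /-- A subset is closed if and only if its intersection with the closure of each cell is. -/
  isClosed_iff (T : Set X) :
    IsClosed T ↔ ∀ c : Σ p, cell p, IsClosed (T ∩ closure (map c.2 '' ballInterior (group c.2)))

namespace SymmetricCWComplex

variable {X : Type u} [TopologicalSpace X] (𝒳 : SymmetricCWComplex X)

/-- The cell `C_i` as a subset of `X`. -/
def openCell {p : ℕ} (i : 𝒳.cell p) : Set X := 𝒳.map i '' ballInterior (𝒳.group i)

/-- There is a bound on the dimensions of the cells. -/
def FiniteDimensional : Prop := ∃ N : ℕ, ∀ p, N < p → IsEmpty (𝒳.cell p)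

/-- The skeleton `X^(p)`: the union of the cells of dimension at most `p` (empty for `p < 0`). -/
def skeleton (p : ℤ) : Set X :=
  {x | ∃ (m : ℕ) (i : 𝒳.cell m), (m : ℤ) ≤ p ∧ x ∈ 𝒳.openCell i}

end SymmetricCWComplex

/-! ### Singular homology with coefficients in an abelian group -/

/-- The singular chain complex `C(Y; A)`, functorially in `Y`. -/
abbrev chains (A : Type u) [AddCommGroup A] : TopCat.{u} ⥤ ChainComplex AddCommGrpCat.{u} ℕ :=
  (AlgebraicTopology.singularChainComplexFunctor AddCommGrpCat.{u}).obj (AddCommGrpCat.of A)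

/-- Singular homology `H_n(Y; A)`, functorially in `Y`, for `n : ℤ` (zero for `n < 0`). -/
def homologyFunctor (A : Type u) [AddCommGroup A] : ℤ → (TopCat.{u} ⥤ AddCommGrpCat.{u})
  | .ofNat n =>
    (AlgebraicTopology.singularHomologyFunctor AddCommGrpCat.{u} n).obj (AddCommGrpCat.of A)
  | .negSucc _ => (Functor.const _).obj (AddCommGrpCat.of PUnit)

/-- `H_n(Y; A)`. -/
abbrev H (A : Type u) [AddCommGroup A] (n : ℤ) (Y : Type u) [TopologicalSpace Y] :
    AddCommGrpCat.{u} :=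
  (homologyFunctor A n).obj (TopCat.of Y)

/-- The map `Y → pt`. -/
def toPoint (Y : Type u) [TopologicalSpace Y] : TopCat.of Y ⟶ TopCat.of PUnit.{u + 1} :=
  TopCat.ofHom ⟨fun _ => PUnit.unit, continuous_const⟩

/-- Reduced singular homology `H̃_n(Y; A)`: for `n ≥ 0` the kernel of `H_n(Y; A) → H_n(pt; A)`,
and in degree `-1` the cokernel of `H_0(Y; A) → H_0(pt; A)` (which is `A` if `Y` is empty, and
zero otherwise). -/
def reducedH (A : Type u) [AddCommGroup A] (n : ℤ) (Y : Type u) [TopologicalSpace Y] :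
    AddCommGrpCat.{u} :=
  match n with
  | .ofNat n => Limits.kernel ((homologyFunctor A n).map (toPoint Y))
  | .negSucc 0 => Limits.cokernel ((homologyFunctor A 0).map (toPoint Y))
  | .negSucc (_ + 1) => AddCommGrpCat.of PUnit

/-- The inclusion of a subspace. -/
def incl {X : Type u} [TopologicalSpace X] (Y : Set X) : TopCat.of Y ⟶ TopCat.of X :=
  TopCat.ofHom ⟨Subtype.val, continuous_subtype_val⟩

/-! ### The spectral sequence of a filtered chain complex -/

/-- Spectral sequences of abelian groups starting at `E_1`, with differentials
`d_r : E_r^{p,q} → E_r^{p-r,q+r-1}`. -/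
abbrev HomologicalSpectralSequence : Type (u + 1) :=
  SpectralSequence AddCommGrpCat.{u} (fun r : ℤ => ComplexShape.up' ((-r, r - 1) : ℤ × ℤ)) 1

variable {K : ChainComplex AddCommGrpCat.{u} ℕ}

/-- For subgroups `F p n` of `K_n`: the group `Z_r^p` of the elements of `F_p K_n` whose boundary
lies in `F_{p-r} K_{n-1}`. -/
def approxCycles (F : ℤ → (n : ℕ) → AddSubgroup (K.X n)) (r p : ℤ) (n : ℕ) :
    AddSubgroup (K.X n) :=
  F p n ⊓ ⨅ m : ℕ, (F (p - r) m).comap (K.d n m).hom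

/-- Data that exhibit `E` as the spectral sequence of the filtered complex `(K, F)`: the terms are
`E_r^{p,q} = Z_r^p / (Z_{r-1}^{p-1} + ∂ Z_{r-1}^{p+r-1})` in degree `n = p + q`, the differential
`d_r` takes the class of `z` to the class of `∂z`, and `H(E_r) ≅ E_{r+1}` takes the class of a
`d_r`-cycle represented by `z ∈ Z_{r+1}^p` to the class of `z`. -/
structure IsSpectralSequenceOf (F : ℤ → (n : ℕ) → AddSubgroup (K.X n))
    (E : HomologicalSpectralSequence.{u}) where
  /-- The map that takes an element of `Z_r^p` to its class in `E_r^{p,n-p}`. -/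
  cls (r : ℤ) (hr : 1 ≤ r) (p : ℤ) (n : ℕ) :
    approxCycles F r p n →+ (E.page r hr).X (p, (n : ℤ) - p)
  cls_surjective (r : ℤ) (hr : 1 ≤ r) (p : ℤ) (n : ℕ) : Function.Surjective (cls r hr p n)
  cls_eq_zero_iff (r : ℤ) (hr : 1 ≤ r) (p : ℤ) (n : ℕ) (z : approxCycles F r p n) :
    cls r hr p n z = 0 ↔
      ∃ y ∈ approxCycles F (r - 1) (p - 1) n, ∃ b ∈ approxCycles F (r - 1) (p + r - 1) (n + 1),
        (z : K.X n) = y + (K.d (n + 1) n).hom b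
  d_cls (r : ℤ) (hr : 1 ≤ r) (p : ℤ) (n : ℕ) (z : approxCycles F r p (n + 1))
    (w : approxCycles F r (p - r) n) (hw : (w : K.X n) = (K.d (n + 1) n).hom z) :
    ((E.page r hr).d (p, ((n + 1 : ℕ) : ℤ) - p) (p - r, (n : ℤ) - (p - r))).hom
      (cls r hr p (n + 1) z) = cls r hr (p - r) n w
  iso_cls (r : ℤ) (hr : 1 ≤ r) (p : ℤ) (n : ℕ) (z : approxCycles F r p n)
    (z' : approxCycles F (r + 1) p n) (hz : (z : K.X n) = z')
    (x : (E.page r hr).cycles (p, (n : ℤ) - p))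
    (hx : ((E.page r hr).iCycles (p, (n : ℤ) - p)).hom x = cls r hr p n z) :
    (E.iso r (r + 1) (p, (n : ℤ) - p) rfl hr).hom.hom
      (((E.page r hr).homologyπ (p, (n : ℤ) - p)).hom x) = cls (r + 1) (by lia) p n z'
  /-- There is nothing in negative total degree. -/
  isZero (r : ℤ) (hr : 1 ≤ r) (p q : ℤ) (hpq : p + q < 0) :
    Limits.IsZero ((E.page r hr).X (p, q))

namespace SymmetricCWComplex

variable {X : Type u} [TopologicalSpace X] (𝒳 : SymmetricCWComplex X)
  (A : Type u) [AddCommGroup A]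

/-- The filtration of `C(X; A)` by the chains that lie in the skeleta of `X`. -/
def skeletalFiltration (p : ℤ) (n : ℕ) : AddSubgroup (((chains A).obj (TopCat.of X)).X n) :=
  (((chains A).map (incl (𝒳.skeleton p))).f n).hom.range

/-- The subgroup `im (H_n(X^(p); A) → H_n(X; A))` of `H_n(X; A)`. -/
def homologyFiltration (p n : ℤ) : AddSubgroup (H A n X) :=
  ((homologyFunctor A n).map (incl (𝒳.skeleton p))).hom.range

/-- The associated graded group
`im (H_n(X^(p); A) → H_n(X; A)) / im (H_n(X^(p-1); A) → H_n(X; A))`. -/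
abbrev gradedHomology (p n : ℤ) : Type u :=
  𝒳.homologyFiltration A p n ⧸
    (𝒳.homologyFiltration A (p - 1) n).addSubgroupOf (𝒳.homologyFiltration A p n)

end SymmetricCWComplex

end SymmCW

end

open SymmCW

open scoped DirectSum

/-!
Singular chains are modelled by one group `Chain A X` for all degrees, the finitely supported
functions on singular simplices of any dimension with values in `A`. It contains the group of chains
of each degree of Mathlib's singular chain complex (`toChain`, `range_toChain`), so that the terms
`E_r^{p,q}` are subquotients of a single group and no transport between degrees is needed. The
spectral sequence of a filtered differential group is constructed in
`FilteredDifferentialGroup.spectralSequence`; the isomorphism `H(E_r) ≅ E_{r+1}` comes from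
`termD_mk_eq_zero_iff` (a class is a `d_r`-cycle if and only if it comes from `Z_{r+1}`) and
`mem_B_succ_iff`.

*The first page.* By definition `E_1^{p,q}` is the relative homology `H_{p+q}(X^(p), X^(p-1))`
(`nonempty_relHomology_equiv_term`). The characteristic maps of the `p`-cells form a relative
homeomorphism from the disjoint union of the pairs `(B^p / G_i, ∂B^p / G_i)` to `(X^(p), X^(p-1))`
(`isRelHomeo_cellsMap`). The boundary of `B^p / G_i` has a collar, by radial expansion, and a
relative homeomorphism carries a collar of the source to a collar of the target; excision
(`relMap_bijective_of_isOpenEmbedding`, proved by barycentric subdivision) therefore shows that it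
induces isomorphisms of relative homology groups (`IsRelHomeo.relMap_bijective`). Relative homology
takes disjoint unions to direct sums because simplices are connected
(`nonempty_relHomology_sigma_equiv`), and since `B^p / G_i` is contractible, its homology relative
to the boundary is the reduced homology of `S^(p-1) / G_i` in one degree less
(`nonempty_relHomology_equiv_reducedH`).

*Convergence.* If there are no cells of dimension greater than `N` and `r ≥ N + 2`, then an element
of `Z_r^p` is a cycle for `p ≤ N`, as `X^(p-r)` is empty, and represents zero for `p > N`, as
`X^(p-1) = X`. So `d_r` vanishes, and both `E_r^{p,q}` and the graded group of the filtration of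
`H_{p+q}(X)` are quotients of the group of cycles in `X^(p)`, by the subgroup of those that are
homologous in `X` to a cycle in `X^(p-1)` (`nonempty_term_equiv_gradedHomology`).
-/

noncomputable section

namespace SymmCW

/-! ### Subquotients of an abelian group -/

/-- The subquotient `Z / (B ∩ Z)` of an abelian group. -/
def Subquotient {M : Type*} [AddCommGroup M] (Z B : AddSubgroup M) : Type _ :=
  Z ⧸ B.addSubgroupOf Z

namespace Subquotient

variable {M N : Type*} [AddCommGroup M] [AddCommGroup N]

instance (Z B : AddSubgroup M) : AddCommGroup (Subquotient Z B) :=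
  inferInstanceAs (AddCommGroup (Z ⧸ B.addSubgroupOf Z))

/-- The class in `Z / (B ∩ Z)` of an element of `Z`. -/
def mk (Z B : AddSubgroup M) : Z →+ Subquotient Z B := QuotientAddGroup.mk' _

theorem mk_surjective (Z B : AddSubgroup M) : Function.Surjective (mk Z B) :=
  QuotientAddGroup.mk'_surjective _

theorem mk_eq_zero_iff {Z B : AddSubgroup M} (z : Z) : mk Z B z = 0 ↔ (z : M) ∈ B := by
  refine (QuotientAddGroup.eq_zero_iff z).trans ?_
  rw [AddSubgroup.mem_addSubgroupOf]

theorem mk_eq_mk_iff {Z B : AddSubgroup M} (z w : Z) :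
    mk Z B z = mk Z B w ↔ (z - w : M) ∈ B := by
  rw [← sub_eq_zero, ← map_sub, mk_eq_zero_iff]
  rfl

/-- Homomorphisms out of a subquotient. -/
def lift {Z B : AddSubgroup M} (f : Z →+ N) (h : ∀ z : Z, (z : M) ∈ B → f z = 0) :
    Subquotient Z B →+ N :=
  QuotientAddGroup.lift _ f fun z hz => h z (AddSubgroup.mem_addSubgroupOf.1 hz)

/-- The homomorphism of subquotients induced by a homomorphism of groups. -/
def map {Z B : AddSubgroup M} {Z' B' : AddSubgroup N} (f : M →+ N) (hZ : ∀ z ∈ Z, f z ∈ Z')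
    (hB : ∀ z ∈ Z, z ∈ B → f z ∈ B') : Subquotient Z B →+ Subquotient Z' B' :=
  lift ((mk Z' B').comp ((f.comp Z.subtype).codRestrict Z' fun z => hZ z z.2))
    fun z hz => (mk_eq_zero_iff _).2 (hB z z.2 hz)

end Subquotient

/-- Two groups onto which a third one maps with the same kernel are isomorphic. -/
theorem exists_addEquiv_of_ker_eq {C P Q : Type*} [AddCommGroup C] [AddCommGroup P]
    [AddCommGroup Q] (f : C →+ P) (g : C →+ Q) (hf : Function.Surjective f)
    (hg : Function.Surjective g) (h : ∀ c, f c = 0 ↔ g c = 0) :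
    ∃ e : P ≃+ Q, ∀ c, e (f c) = g c := by
  have hk : f.ker = g.ker := by
    ext c
    exact h c
  let e := (QuotientAddGroup.quotientKerEquivOfSurjective f hf).symm.trans
    ((QuotientAddGroup.quotientAddEquivOfEq hk).trans
      (QuotientAddGroup.quotientKerEquivOfSurjective g hg))
  refine ⟨e, fun c => ?_⟩
  have : (QuotientAddGroup.quotientKerEquivOfSurjective f hf).symm (f c) = (c : C ⧸ f.ker) := by
    rw [AddEquiv.symm_apply_eq]; rfl
  simp only [e, AddEquiv.trans_apply, this]
  rfl

/-! ### Elements of the homology of a complex of abelian groups -/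

section Homology

variable {ι : Type*} {c : ComplexShape ι} (K : HomologicalComplex AddCommGrpCat.{u} c)

theorem iCycles_injective (i : ι) : Function.Injective (K.iCycles i).hom :=
  (AddCommGrpCat.mono_iff_injective _).1 inferInstance

theorem homologyπ_surjective (i : ι) : Function.Surjective (K.homologyπ i).hom :=
  (AddCommGrpCat.epi_iff_surjective _).1 inferInstance

theorem d_iCycles_apply (i j : ι) (x : K.cycles i) :
    (K.d i j).hom ((K.iCycles i).hom x) = 0 :=
  congr(($(K.iCycles_d i j)).hom x)

theorem exists_iCycles_eq {i j : ι} (hij : c.next i = j) (x : K.X i) (hx : (K.d i j).hom x = 0) :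
    ∃ y : K.cycles i, (K.iCycles i).hom y = x :=
  (ShortComplex.ab_exact_iff _).1 (ShortComplex.exact_of_f_is_kernel
    (ShortComplex.mk (K.iCycles i) (K.d i j) (K.iCycles_d i j)) (K.cyclesIsKernel i j hij)) x hx

theorem homologyπ_eq_zero_iff {i j : ι} (hij : c.prev j = i) (x : K.cycles j) :
    (K.homologyπ j).hom x = 0 ↔ ∃ y : K.X i, (K.d i j).hom y = (K.iCycles j).hom x := by
  have h (y : K.X i) : (K.iCycles j).hom ((K.toCycles i j).hom y) = (K.d i j).hom y :=
    congr(($(K.toCycles_i i j)).hom y)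
  constructor
  · intro hx
    obtain ⟨y, rfl⟩ := (ShortComplex.ab_exact_iff _).1 (ShortComplex.exact_of_g_is_cokernel
      (ShortComplex.mk (K.toCycles i j) (K.homologyπ j) (K.toCycles_comp_homologyπ i j))
      (K.homologyIsCokernel i j hij)) x hx
    exact ⟨y, (h y).symm⟩
  · rintro ⟨y, hy⟩
    obtain rfl : (K.toCycles i j).hom y = x := iCycles_injective K j ((h y).trans hy)
    exact congr(($(K.toCycles_comp_homologyπ i j)).hom y)

end Homology

/-! ### The spectral sequence of a filtered differential group -/

/-- An abelian group with a differential `D` of degree `-1` with respect to a family of subgroups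
`G m` (the elements of degree `m`), and a filtration `F` by subgroups that `D` preserves. The
elements of degree `m` of all degrees live in one group, so that no transport between degrees is
ever needed. -/
structure FilteredDifferentialGroup (M : Type u) [AddCommGroup M] where
  /-- The differential. -/
  D : M →+ M
  D_D (x : M) : D (D x) = 0
  /-- The elements of degree `m`. -/
  G (m : ℤ) : AddSubgroup M
  D_mem_G (m : ℤ) (x : M) (hx : x ∈ G m) : D x ∈ G (m - 1)
  /-- The filtration. -/
  F (p : ℤ) : AddSubgroup M
  F_mono : Monotone F
  D_mem_F (p : ℤ) (x : M) (hx : x ∈ F p) : D x ∈ F p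

namespace FilteredDifferentialGroup

variable {M : Type u} [AddCommGroup M] (K : FilteredDifferentialGroup M)

/-- The elements of degree `m` of `F_p` whose differential lies in `F_{p-r}`. -/
def Z (r p m : ℤ) : AddSubgroup M := (K.F p ⊓ K.G m) ⊓ (K.F (p - r)).comap K.D

/-- The subgroup `Z_{r-1}^{p-1} + D Z_{r-1}^{p+r-1}` by which `Z_r^p` is divided. -/
def B (r p m : ℤ) : AddSubgroup M :=
  K.Z (r - 1) (p - 1) m ⊔ (K.Z (r - 1) (p + r - 1) (m + 1)).map K.D

theorem mem_Z {r p m : ℤ} {x : M} :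
    x ∈ K.Z r p m ↔ x ∈ K.F p ∧ x ∈ K.G m ∧ K.D x ∈ K.F (p - r) := by
  simp only [Z, AddSubgroup.mem_inf, AddSubgroup.mem_comap, and_assoc]

theorem mem_B {r p m : ℤ} {x : M} :
    x ∈ K.B r p m ↔ ∃ y ∈ K.Z (r - 1) (p - 1) m, ∃ b ∈ K.Z (r - 1) (p + r - 1) (m + 1),
      x = y + K.D b := by
  simp only [B, AddSubgroup.mem_sup, AddSubgroup.mem_map]
  constructor
  · rintro ⟨y, hy, _, ⟨b, hb, rfl⟩, rfl⟩
    exact ⟨y, hy, b, hb, rfl⟩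
  · rintro ⟨y, hy, b, hb, rfl⟩
    exact ⟨y, hy, _, ⟨b, hb, rfl⟩, rfl⟩

theorem D_mem_Z {r p m p' m' : ℤ} (hp : p' = p - r) (hm : m' = m - 1) {x : M}
    (hx : x ∈ K.Z r p m) : K.D x ∈ K.Z r p' m' := by
  subst hp hm
  rw [mem_Z] at hx ⊢
  exact ⟨hx.2.2, K.D_mem_G _ _ hx.2.1, by rw [K.D_D]; exact zero_mem _⟩

theorem D_mem_B {r p m p' m' : ℤ} (hp : p' = p - r) (hm : m' = m - 1) {x : M}
    (hx : x ∈ K.B r p m) : K.D x ∈ K.B r p' m' := by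
  subst hp hm
  rw [mem_B] at hx ⊢
  obtain ⟨y, hy, b, hb, rfl⟩ := hx
  refine ⟨0, zero_mem _, y, ?_, by rw [map_add, K.D_D, add_zero, zero_add]⟩
  rwa [show p - r + r - 1 = p - 1 by ring, sub_add_cancel]

/-- The term `E_r^{p,q}`. -/
abbrev term (r : ℤ) (pq : ℤ × ℤ) : Type u :=
  Subquotient (K.Z r pq.1 (pq.1 + pq.2)) (K.B r pq.1 (pq.1 + pq.2))

/-- The differential `d_r` between two terms whose bidegrees differ by `(-r, r - 1)`. -/
def termD (r : ℤ) (a b : ℤ × ℤ) (h : a + (-r, r - 1) = b) : K.term r a →+ K.term r b :=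
  have h1 : b.1 = a.1 - r := by rw [← h]; rfl
  have h2 : b.1 + b.2 = a.1 + a.2 - 1 := by rw [← h]; simp only [Prod.fst_add, Prod.snd_add]; ring
  Subquotient.map K.D (fun _ hz => K.D_mem_Z h1 h2 hz) (fun _ _ hz => K.D_mem_B h1 h2 hz)

open Classical in
/-- The page `E_r`. -/
def page (r : ℤ) :
    HomologicalComplex AddCommGrpCat.{u} (ComplexShape.up' ((-r, r - 1) : ℤ × ℤ)) where
  X pq := AddCommGrpCat.of (K.term r pq)
  d a b := if h : a + (-r, r - 1) = b then AddCommGrpCat.ofHom (K.termD r a b h) else 0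
  shape a b h := dif_neg h
  d_comp_d' a b c hab hbc := by
    rw [dif_pos (show a + (-r, r - 1) = b from hab), dif_pos (show b + (-r, r - 1) = c from hbc)]
    ext x
    obtain ⟨z, rfl⟩ := Subquotient.mk_surjective _ _ x
    refine (Subquotient.mk_eq_zero_iff _).2 ?_
    change K.D (K.D z.1) ∈ _
    rw [K.D_D]
    exact zero_mem _

theorem page_d {r : ℤ} {a b : ℤ × ℤ} (h : a + (-r, r - 1) = b) :
    (K.page r).d a b = AddCommGrpCat.ofHom (K.termD r a b h) := dif_pos h

theorem page_d_mk {r : ℤ} {a b : ℤ × ℤ} (h : a + (-r, r - 1) = b)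
    (z : K.Z r a.1 (a.1 + a.2)) (w : K.Z r b.1 (b.1 + b.2)) (hw : (w : M) = K.D z) :
    ((K.page r).d a b).hom (Subquotient.mk _ _ z) =
      (Subquotient.mk _ (K.B r b.1 (b.1 + b.2)) w) := by
  rw [K.page_d h]
  obtain ⟨w, hw'⟩ := w
  subst hw
  rfl

/-- A class of `E_r` is a `d_r`-cycle if and only if it is represented by an element of
`Z_{r+1}`. -/
theorem termD_mk_eq_zero_iff {r : ℤ} {a b : ℤ × ℤ} (h : a + (-r, r - 1) = b)
    (z : K.Z r a.1 (a.1 + a.2)) :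
    K.termD r a b h (Subquotient.mk _ _ z) = 0 ↔
      ∃ z' ∈ K.Z (r + 1) a.1 (a.1 + a.2), ∃ w ∈ K.B r a.1 (a.1 + a.2), (z : M) = z' + w := by
  have h1 : b.1 = a.1 - r := by rw [← h]; rfl
  have h2 : b.1 + b.2 = a.1 + a.2 - 1 := by rw [← h]; simp only [Prod.fst_add, Prod.snd_add]; ring
  refine (Subquotient.mk_eq_zero_iff _).trans ?_
  change K.D z.1 ∈ _ ↔ _
  rw [h2, h1, mem_B]
  constructor
  · rintro ⟨y, hy, w, hw, hzw⟩
    rw [show a.1 - r + r - 1 = a.1 - 1 by ring, sub_add_cancel] at hw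
    refine ⟨z - w, ?_, w, ?_, by abel⟩
    · obtain ⟨hw1, hw2, hw3⟩ := K.mem_Z.1 hw
      obtain ⟨hz1, hz2, hz3⟩ := K.mem_Z.1 z.2
      refine K.mem_Z.2 ⟨sub_mem hz1 (K.F_mono (by lia) hw1), sub_mem hz2 hw2, ?_⟩
      rw [map_sub, hzw, add_sub_cancel_right, show a.1 - (r + 1) = a.1 - r - 1 by ring]
      exact (K.mem_Z.1 hy).1
    · exact K.mem_B.2 ⟨w, hw, 0, zero_mem _, by simp⟩
  · rintro ⟨z', hz', w, hw, hzw⟩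
    obtain ⟨y, hy, c, hc, rfl⟩ := K.mem_B.1 hw
    refine ⟨K.D z', ?_, y, ?_, ?_⟩
    · obtain ⟨h1, h2, h3⟩ := K.mem_Z.1 hz'
      refine K.mem_Z.2 ⟨?_, K.D_mem_G _ _ h2, by rw [K.D_D]; exact zero_mem _⟩
      rwa [show a.1 - (r + 1) = a.1 - r - 1 by ring] at h3
    · rwa [show a.1 - r + r - 1 = a.1 - 1 by ring, sub_add_cancel]
    · rw [hzw, map_add, map_add, K.D_D, add_zero]

theorem Z_succ_le (r p m : ℤ) : K.Z (r + 1) p m ≤ K.Z r p m := fun _ hx => by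
  rw [mem_Z] at hx ⊢
  exact ⟨hx.1, hx.2.1, K.F_mono (by lia) hx.2.2⟩

/-- The class in `H(E_r)` of an element of `Z_{r+1}` vanishes if and only if the element lies in
the subgroup by which `Z_{r+1}` is divided to form `E_{r+1}`. -/
theorem mem_B_succ_iff {r p m p' m' : ℤ} (hp : p' = p + r) (hm : m' = m + 1) {x : M}
    (hx : x ∈ K.Z (r + 1) p m) :
    x ∈ K.B (r + 1) p m ↔ ∃ b ∈ K.Z r p' m', x - K.D b ∈ K.B r p m := by
  subst hp hm
  simp only [mem_B]
  rw [add_sub_cancel_right, show p + (r + 1) - 1 = p + r by ring]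
  constructor
  · rintro ⟨y, hy, b, hb, rfl⟩
    refine ⟨b, hb, y, ?_, 0, zero_mem _, by simp⟩
    have := K.Z_succ_le (r - 1) (p - 1) m
    rw [sub_add_cancel] at this
    exact this hy
  · rintro ⟨b, hb, y, hy, c, hc, hxy⟩
    have hx' : x = y + K.D (b + c) := by
      rw [map_add, sub_eq_iff_eq_add.1 hxy]
      abel
    obtain ⟨hc1, hc2, hc3⟩ := K.mem_Z.1 hc
    obtain ⟨hb1, hb2, hb3⟩ := K.mem_Z.1 hb
    obtain ⟨hy1, hy2, hy3⟩ := K.mem_Z.1 hy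
    obtain ⟨hx1, hx2, hx3⟩ := K.mem_Z.1 hx
    refine ⟨y, K.mem_Z.2 ⟨hy1, hy2, ?_⟩, b + c, K.mem_Z.2 ⟨?_, add_mem hb2 hc2, ?_⟩, hx'⟩
    · have : K.D y = K.D x := by rw [hx', map_add, K.D_D, add_zero]
      rw [this, show p - 1 - r = p - (r + 1) by ring]
      exact hx3
    · exact add_mem hb1 (K.F_mono (by lia) hc1)
    · rw [map_add]
      refine add_mem hb3 (K.F_mono (by lia) hc3)

/-- The homology of `E_r` is `E_{r+1}`, where the class of a cycle that an element of `Z_{r+1}`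
represents corresponds to the class of that element. -/
theorem exists_homologyEquiv (r : ℤ) (a : ℤ × ℤ) :
    ∃ e : (K.page r).homology a ≃+ K.term (r + 1) a,
      ∀ (z : K.Z r a.1 (a.1 + a.2)) (z' : K.Z (r + 1) a.1 (a.1 + a.2)) (_ : (z : M) = z')
        (x : (K.page r).cycles a) (_ : ((K.page r).iCycles a).hom x = Subquotient.mk _ _ z),
        e (((K.page r).homologyπ a).hom x) = Subquotient.mk _ _ z' := by
  have hnext : (ComplexShape.up' ((-r, r - 1) : ℤ × ℤ)).next a = a + (-r, r - 1) :=
    ComplexShape.next_eq' _ rfl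
  have hprev : (ComplexShape.up' ((-r, r - 1) : ℤ × ℤ)).prev a = a - (-r, r - 1) :=
    ComplexShape.prev_eq' _ (sub_add_cancel _ _)
  let inc (z' : K.Z (r + 1) a.1 (a.1 + a.2)) : K.Z r a.1 (a.1 + a.2) :=
    ⟨z', K.Z_succ_le _ _ _ z'.2⟩
  have hlift (z' : K.Z (r + 1) a.1 (a.1 + a.2)) : ∃ x : (K.page r).cycles a,
      ((K.page r).iCycles a).hom x = Subquotient.mk _ _ (inc z') := by
    refine exists_iCycles_eq (K.page r) hnext _ ?_
    rw [K.page_d rfl]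
    exact (K.termD_mk_eq_zero_iff rfl _).2 ⟨z', z'.2, 0, zero_mem _, (add_zero _).symm⟩
  choose l hl using hlift
  let L : K.Z (r + 1) a.1 (a.1 + a.2) →+ (K.page r).homology a :=
    ((K.page r).homologyπ a).hom.comp
      (AddMonoidHom.mk' l fun x y => iCycles_injective _ _ (by
        rw [map_add, hl, hl, hl]; exact map_add _ (inc x) (inc y)))
  have hL (z') : L z' = ((K.page r).homologyπ a).hom (l z') := rfl
  have hLsurj : Function.Surjective L := by
    intro y
    obtain ⟨x, rfl⟩ := homologyπ_surjective _ _ y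
    obtain ⟨z, hz⟩ := Subquotient.mk_surjective _ _ (((K.page r).iCycles a).hom x)
    have h0 := d_iCycles_apply (K.page r) a (a + (-r, r - 1)) x
    rw [K.page_d rfl, ← hz] at h0
    obtain ⟨z', hz', w, hw, hzw⟩ := (K.termD_mk_eq_zero_iff rfl z).1 h0
    refine ⟨⟨z', hz'⟩, ?_⟩
    rw [hL]
    congr 1
    refine iCycles_injective _ _ ?_
    rw [hl, ← hz]
    refine (Subquotient.mk_eq_mk_iff _ _).2 ?_
    change z' - (z : M) ∈ _
    rw [hzw, sub_add_cancel_left]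
    exact neg_mem hw
  have hLker (z' : K.Z (r + 1) a.1 (a.1 + a.2)) :
      L z' = 0 ↔ Subquotient.mk _ (K.B (r + 1) a.1 (a.1 + a.2)) z' = 0 := by
    have h1 : (a - (-r, r - 1)).1 = a.1 + r := by simp
    have h2 : (a - (-r, r - 1)).1 + (a - (-r, r - 1)).2 = a.1 + a.2 + 1 := by simp; ring
    rw [hL, homologyπ_eq_zero_iff _ hprev, hl, Subquotient.mk_eq_zero_iff,
      K.mem_B_succ_iff h1 h2 z'.2]
    have hd (b : K.Z r (a - (-r, r - 1)).1 ((a - (-r, r - 1)).1 + (a - (-r, r - 1)).2)) :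
        ((K.page r).d (a - (-r, r - 1)) a).hom (Subquotient.mk _ _ b) =
          Subquotient.mk _ _ (inc z') ↔ (z' : M) - K.D b ∈ K.B r a.1 (a.1 + a.2) := by
      rw [K.page_d (sub_add_cancel _ _)]
      exact eq_comm.trans
        (Subquotient.mk_eq_mk_iff (Z := K.Z r a.1 (a.1 + a.2)) (inc z') ⟨K.D b, _⟩)
    constructor
    · rintro ⟨y, hy⟩
      obtain ⟨b, rfl⟩ := Subquotient.mk_surjective _ _ y
      exact ⟨b, b.2, (hd b).1 hy⟩
    · rintro ⟨b, hb, hzb⟩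
      exact ⟨_, (hd ⟨b, hb⟩).2 hzb⟩
  obtain ⟨e, he⟩ := exists_addEquiv_of_ker_eq L _ hLsurj (Subquotient.mk_surjective _ _) hLker
  refine ⟨e, fun z z' hz x hx => ?_⟩
  rw [← he z', hL]
  congr 2
  refine iCycles_injective _ _ ?_
  rw [hx, hl]
  congr 1
  exact Subtype.ext hz

/-- The isomorphism of the homology of `E_r` with `E_{r+1}`. -/
def homologyEquiv (r : ℤ) (a : ℤ × ℤ) : (K.page r).homology a ≃+ (K.page (r + 1)).X a :=
  (K.exists_homologyEquiv r a).choose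

/-- The spectral sequence of a filtered differential group. -/
def spectralSequence : HomologicalSpectralSequence.{u} where
  page r _ := K.page r
  iso r r' a h _ := by
    subst h
    exact (K.homologyEquiv r a).toAddCommGrpIso

theorem spectralSequence_iso (r : ℤ) (hr : 1 ≤ r) (a : ℤ × ℤ)
    (z : K.Z r a.1 (a.1 + a.2)) (z' : K.Z (r + 1) a.1 (a.1 + a.2)) (hz : (z : M) = z')
    (x : (K.page r).cycles a) (hx : ((K.page r).iCycles a).hom x = Subquotient.mk _ _ z) :
    (K.spectralSequence.iso r (r + 1) a rfl hr).hom.hom (((K.page r).homologyπ a).hom x) =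
      Subquotient.mk _ (K.B (r + 1) a.1 (a.1 + a.2)) z' :=
  (K.exists_homologyEquiv r a).choose_spec z z' hz x hx

end FilteredDifferentialGroup

/-! ### Singular chains of all degrees -/

/-- The standard `n`-simplex. -/
abbrev Simplex (n : ℕ) : Type := stdSimplex ℝ (Fin (n + 1))

/-- The `i`-th face of the standard `(n + 1)`-simplex. -/
def face {n : ℕ} (i : Fin (n + 2)) : C(Simplex n, Simplex (n + 1)) :=
  ⟨stdSimplex.map i.succAbove, stdSimplex.continuous_map _⟩

/-- The singular simplices, of all dimensions, of a space. -/
abbrev SingularSimplex (X : Type*) [TopologicalSpace X] : Type _ := Σ n : ℕ, C(Simplex n, X)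

/-- The singular chains of a space, of all degrees together. -/
abbrev Chain (A : Type*) [AddCommGroup A] (X : Type*) [TopologicalSpace X] : Type _ :=
  SingularSimplex X →₀ A

section

variable {A : Type*} [AddCommGroup A] {X Y Z : Type*} [TopologicalSpace X] [TopologicalSpace Y]
  [TopologicalSpace Z]

variable (A X) in
/-- The boundary of singular chains. -/
def boundary : Chain A X →+ Chain A X :=
  Finsupp.liftAddHom fun s => match s with
    | ⟨0, _⟩ => 0
    | ⟨n + 1, σ⟩ => ∑ i : Fin (n + 2),
        ((-1 : ℤ) ^ (i : ℕ)) • Finsupp.singleAddHom ⟨n, σ.comp (face i)⟩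

@[simp]
theorem boundary_single_zero (σ : C(Simplex 0, X)) (a : A) :
    boundary A X (.single ⟨0, σ⟩ a) = 0 := by
  simp [boundary]

theorem boundary_single_succ {n : ℕ} (σ : C(Simplex (n + 1), X)) (a : A) :
    boundary A X (.single ⟨n + 1, σ⟩ a) =
      ∑ i : Fin (n + 2), ((-1 : ℤ) ^ (i : ℕ)) • .single ⟨n, σ.comp (face i)⟩ a := by
  simp [boundary]

variable (A) in
/-- The homomorphism of chains that a continuous map induces. -/
def chainMap (f : C(X, Y)) : Chain A X →+ Chain A Y :=
  Finsupp.mapDomain.addMonoidHom fun s => ⟨s.1, f.comp s.2⟩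

@[simp]
theorem chainMap_single (f : C(X, Y)) {n : ℕ} (σ : C(Simplex n, X)) (a : A) :
    chainMap A f (.single ⟨n, σ⟩ a) = .single ⟨n, f.comp σ⟩ a :=
  Finsupp.mapDomain_single

theorem chainMap_comp (g : C(Y, Z)) (f : C(X, Y)) (c : Chain A X) :
    chainMap A (g.comp f) c = chainMap A g (chainMap A f c) := by
  suffices h : chainMap A (g.comp f) = (chainMap A g).comp (chainMap A f) from congr($h c)
  ext ⟨n, σ⟩ a : 2
  simp [ContinuousMap.comp_assoc]

theorem chainMap_id (c : Chain A X) : chainMap A (.id X) c = c := by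
  suffices h : chainMap A (.id X) = .id _ from congr($h c)
  ext ⟨n, σ⟩ a : 2
  simp

theorem boundary_chainMap (f : C(X, Y)) (c : Chain A X) :
    boundary A Y (chainMap A f c) = chainMap A f (boundary A X c) := by
  suffices h : (boundary A Y).comp (chainMap A f) = (chainMap A f).comp (boundary A X) from
    congr($h c)
  ext ⟨n, σ⟩ a : 2
  cases n <;> simp [boundary_single_succ, ContinuousMap.comp_assoc]

theorem chainMap_injective {f : C(X, Y)} (hf : Function.Injective f) :
    Function.Injective (chainMap A f) := by
  refine Finsupp.mapDomain_injective ?_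
  rintro ⟨n, σ⟩ ⟨m, τ⟩ h
  obtain rfl : n = m := congr_arg Sigma.fst h
  have h' : f.comp σ = f.comp τ := eq_of_heq (Sigma.mk.inj h).2
  congr 1
  ext x
  exact hf congr($h' x)

variable (A) in
/-- The chains that consist of simplices from a given set. -/
def chainsOf (P : Set (SingularSimplex X)) : AddSubgroup (Chain A X) :=
  (Finsupp.supported A ℤ P).toAddSubgroup

theorem mem_chainsOf {P : Set (SingularSimplex X)} {c : Chain A X} :
    c ∈ chainsOf A P ↔ ∀ s, c s ≠ 0 → s ∈ P := by
  change c ∈ Finsupp.supported A ℤ P ↔ _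
  rw [Finsupp.mem_supported]
  simp [Set.subset_def]

theorem single_mem_chainsOf {P : Set (SingularSimplex X)} {s : SingularSimplex X} (hs : s ∈ P)
    (a : A) : .single s a ∈ chainsOf A P :=
  Finsupp.single_mem_supported ℤ a hs

theorem chainsOf_le_iff {P : Set (SingularSimplex X)} {H : AddSubgroup (Chain A X)} :
    chainsOf A P ≤ H ↔ ∀ s ∈ P, ∀ a, .single s a ∈ H := by
  refine ⟨fun h s hs a => h (single_mem_chainsOf hs a), fun h c hc => ?_⟩
  rw [← c.sum_single]
  exact sum_mem fun s hs => h s (mem_chainsOf.1 hc s (by simpa using hs)) _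

theorem chainsOf_mono {P Q : Set (SingularSimplex X)} (h : P ⊆ Q) : chainsOf A P ≤ chainsOf A Q :=
  chainsOf_le_iff.2 fun _ hs a => single_mem_chainsOf (h hs) a

theorem chainsOf_inter (P Q : Set (SingularSimplex X)) :
    chainsOf A (P ∩ Q) = chainsOf A P ⊓ chainsOf A Q := by
  ext c
  simp only [AddSubgroup.mem_inf, mem_chainsOf, Set.mem_inter_iff, ← forall_and]

theorem chainsOf_union (P Q : Set (SingularSimplex X)) :
    chainsOf A (P ∪ Q) = chainsOf A P ⊔ chainsOf A Q := by
  refine le_antisymm (chainsOf_le_iff.2 ?_)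
    (sup_le (chainsOf_mono Set.subset_union_left) (chainsOf_mono Set.subset_union_right))
  rintro s (hs | hs) a
  · exact AddSubgroup.mem_sup_left (single_mem_chainsOf hs a)
  · exact AddSubgroup.mem_sup_right (single_mem_chainsOf hs a)

variable (A X) in
/-- The chains of degree `m`; they vanish for `m < 0`. -/
def chainsDeg (m : ℤ) : AddSubgroup (Chain A X) := chainsOf A {s | (s.1 : ℤ) = m}

variable (A) in
/-- The chains in a subset. -/
def chainsIn (S : Set X) : AddSubgroup (Chain A X) := chainsOf A {s | Set.range s.2 ⊆ S}

theorem single_mem_chainsDeg {n : ℕ} {m : ℤ} (h : (n : ℤ) = m) (σ : C(Simplex n, X)) (a : A) :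
    .single ⟨n, σ⟩ a ∈ chainsDeg A X m := single_mem_chainsOf h a

theorem single_mem_chainsIn {S : Set X} {n : ℕ} {σ : C(Simplex n, X)} (h : ∀ x, σ x ∈ S) (a : A) :
    .single ⟨n, σ⟩ a ∈ chainsIn A S :=
  single_mem_chainsOf (Set.range_subset_iff.2 h) a

theorem chainsDeg_le_iff {m : ℤ} {H : AddSubgroup (Chain A X)} :
    chainsDeg A X m ≤ H ↔ ∀ (n : ℕ) (_ : (n : ℤ) = m) (σ : C(Simplex n, X)) (a : A),
      .single ⟨n, σ⟩ a ∈ H :=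
  chainsOf_le_iff.trans ⟨fun h n hn σ a => h ⟨n, σ⟩ hn a, fun h ⟨n, σ⟩ hn a => h n hn σ a⟩

theorem chainsIn_le_iff {S : Set X} {H : AddSubgroup (Chain A X)} :
    chainsIn A S ≤ H ↔ ∀ (n : ℕ) (σ : C(Simplex n, X)) (_ : ∀ x, σ x ∈ S) (a : A),
      .single ⟨n, σ⟩ a ∈ H :=
  chainsOf_le_iff.trans ⟨fun h n σ hn a => h ⟨n, σ⟩ (Set.range_subset_iff.2 hn) a,
    fun h ⟨n, σ⟩ hn a => h n σ (Set.range_subset_iff.1 hn) a⟩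

theorem chainsIn_mono {S T : Set X} (h : S ⊆ T) : chainsIn A S ≤ chainsIn A T :=
  chainsOf_mono fun _ hs => hs.trans h

theorem chainsIn_empty : chainsIn A (∅ : Set X) = ⊥ :=
  le_bot_iff.1 <| chainsIn_le_iff.2 fun _ _ h _ => (h (Classical.arbitrary _)).elim

theorem chainsIn_univ : chainsIn A (Set.univ : Set X) = ⊤ :=
  top_le_iff.1 fun _ _ => mem_chainsOf.2 fun _ _ => Set.subset_univ _

theorem chainsDeg_neg {m : ℤ} (hm : m < 0) {c : Chain A X} (hc : c ∈ chainsDeg A X m) : c = 0 := by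
  have : chainsDeg A X m ≤ ⊥ := chainsDeg_le_iff.2 fun n hn => by lia
  exact this hc

theorem boundary_mem_chainsDeg {m : ℤ} {c : Chain A X} (hc : c ∈ chainsDeg A X m) :
    boundary A X c ∈ chainsDeg A X (m - 1) := by
  have : chainsDeg A X m ≤ (chainsDeg A X (m - 1)).comap (boundary A X) := by
    refine chainsDeg_le_iff.2 fun n hn σ a => ?_
    rw [AddSubgroup.mem_comap]
    cases n with
    | zero => rw [boundary_single_zero]; exact zero_mem _
    | succ n =>
      rw [boundary_single_succ]
      exact sum_mem fun i _ => zsmul_mem (single_mem_chainsDeg (by push_cast at hn; lia) _ _) _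
  exact this hc

theorem boundary_mem_chainsIn {S : Set X} {c : Chain A X} (hc : c ∈ chainsIn A S) :
    boundary A X c ∈ chainsIn A S := by
  have : chainsIn A S ≤ (chainsIn A S).comap (boundary A X) := by
    refine chainsIn_le_iff.2 fun n σ h a => ?_
    rw [AddSubgroup.mem_comap]
    cases n with
    | zero => rw [boundary_single_zero]; exact zero_mem _
    | succ n =>
      rw [boundary_single_succ]
      exact sum_mem fun i _ => zsmul_mem (single_mem_chainsIn (fun x => h (face i x)) _) _
  exact this hc

theorem chainMap_mem_chainsDeg (f : C(X, Y)) {m : ℤ} {c : Chain A X} (hc : c ∈ chainsDeg A X m) :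
    chainMap A f c ∈ chainsDeg A Y m := by
  have : chainsDeg A X m ≤ (chainsDeg A Y m).comap (chainMap A f) := by
    refine chainsDeg_le_iff.2 fun n hn σ a => ?_
    rw [AddSubgroup.mem_comap, chainMap_single]
    exact single_mem_chainsDeg hn _ _
  exact this hc

theorem chainMap_mem_chainsIn {f : C(X, Y)} {S : Set X} {T : Set Y} (h : Set.MapsTo f S T)
    {c : Chain A X} (hc : c ∈ chainsIn A S) : chainMap A f c ∈ chainsIn A T := by
  have : chainsIn A S ≤ (chainsIn A T).comap (chainMap A f) := by
    refine chainsIn_le_iff.2 fun n σ hσ a => ?_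
    rw [AddSubgroup.mem_comap, chainMap_single]
    exact single_mem_chainsIn (fun x => h (hσ x)) _
  exact this hc

/-- A chain in the image of an embedding comes from a chain in the source. -/
theorem exists_chainMap_eq {f : C(X, Y)} (hf : Topology.IsEmbedding f) {T : Set Y} {m : ℤ}
    (hT : T ⊆ Set.range f) {c : Chain A Y} (hc : c ∈ chainsIn A T) (hm : c ∈ chainsDeg A Y m) :
    ∃ b ∈ chainsIn A (f ⁻¹' T), b ∈ chainsDeg A X m ∧ chainMap A f b = c := by
  have : chainsOf A ({s : SingularSimplex Y | Set.range s.2 ⊆ T} ∩ {s | (s.1 : ℤ) = m}) ≤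
      (chainsIn A (f ⁻¹' T) ⊓ chainsDeg A X m).map (chainMap A f) := by
    refine chainsOf_le_iff.2 ?_
    rintro ⟨n, σ⟩ ⟨hσ, hn⟩ a
    have h (x) : σ x ∈ Set.range f := hT (hσ ⟨x, rfl⟩)
    choose τ hτ using h
    have hcont : Continuous τ := hf.continuous_iff.2 (by
      rw [show f ∘ τ = σ from funext hτ]; exact σ.continuous)
    refine ⟨.single ⟨n, ⟨τ, hcont⟩⟩ a, ⟨single_mem_chainsIn (fun x => ?_) _,
      single_mem_chainsDeg hn _ _⟩, ?_⟩
    · change f (τ x) ∈ T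
      rw [hτ]
      exact hσ ⟨x, rfl⟩
    · rw [chainMap_single]
      congr 2
      ext x
      exact hτ x
  rw [chainsOf_inter] at this
  obtain ⟨b, ⟨hb, hb'⟩, h⟩ := this ⟨hc, hm⟩
  exact ⟨b, hb, hb', h⟩

/-- A chain whose image lies in a subset lies in the preimage of the subset. -/
theorem mem_chainsIn_of_chainMap {f : C(X, Y)} (hf : Function.Injective f) {T : Set Y}
    {c : Chain A X} (hc : chainMap A f c ∈ chainsIn A T) : c ∈ chainsIn A (f ⁻¹' T) := by
  refine mem_chainsOf.2 fun s hs => ?_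
  have hinj : Function.Injective fun s : SingularSimplex X =>
      (⟨s.1, f.comp s.2⟩ : SingularSimplex Y) := by
    rintro ⟨n, σ⟩ ⟨m, τ⟩ h
    obtain rfl : n = m := congr_arg Sigma.fst h
    have h' : f.comp σ = f.comp τ := eq_of_heq (Sigma.mk.inj h).2
    congr 1
    ext x
    exact hf congr($h' x)
  have h1 : chainMap A f c ⟨s.1, f.comp s.2⟩ = c s := Finsupp.mapDomain_apply hinj c s
  have h2 := mem_chainsOf.1 hc ⟨s.1, f.comp s.2⟩ (by rwa [h1])
  rintro _ ⟨x, rfl⟩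
  exact h2 ⟨x, rfl⟩

end

/-! ### Comparison with the singular chain complex -/

section Comparison

variable (A : Type u) [AddCommGroup A] (X : TopCat.{u})

open Simplicial

/-- The inclusion of the singular chains of degree `n` into the chains of all degrees. -/
def toChain (n : ℕ) : ((chains A).obj X).X n →+ Chain A X :=
  ((SSet.isColimitChainComplexXCofan (TopCat.toSSet.obj X) (AddCommGrpCat.of A) n).desc
    (Limits.Cofan.mk (AddCommGrpCat.of (Chain A X)) fun x =>
      AddCommGrpCat.ofHom (Finsupp.singleAddHom
        (⟨n, X.toSSetObjEquiv (.op ⦋n⦌) x⟩ : SingularSimplex X)))).hom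

/-- The chain with one summand in `C_n(X; A)`. -/
def singleChain {n : ℕ} (σ : C(Simplex n, X)) : A →+ ((chains A).obj X).X n :=
  (SSet.ιChainComplex (R := AddCommGrpCat.of A) (TopCat.toSSet.obj X)
    ((X.toSSetObjEquiv (.op ⦋n⦌)).symm σ)).hom

variable {A X}

theorem chains_hom_ext {n : ℕ} {B : Type u} [AddCommGroup B]
    {f g : ((chains A).obj X).X n →+ B}
    (h : ∀ (σ : C(Simplex n, X)) (a : A), f (singleChain A X σ a) = g (singleChain A X σ a)) :
    f = g := by
  have : AddCommGrpCat.ofHom f = AddCommGrpCat.ofHom g := by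
    refine SSet.chainComplex_hom_ext fun x => ?_
    ext a
    have := h (X.toSSetObjEquiv (.op ⦋n⦌) x) a
    rwa [singleChain, Equiv.symm_apply_apply] at this
  exact congr(($this).hom)

@[simp]
theorem toChain_singleChain {n : ℕ} (σ : C(Simplex n, X)) (a : A) :
    toChain A X n (singleChain A X σ a) = .single ⟨n, σ⟩ a := by
  have := (SSet.isColimitChainComplexXCofan (TopCat.toSSet.obj X) (AddCommGrpCat.of A) n).fac
    (Limits.Cofan.mk (AddCommGrpCat.of (Chain A X)) fun x =>
      AddCommGrpCat.ofHom (Finsupp.singleAddHom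
        (⟨n, X.toSSetObjEquiv (.op ⦋n⦌) x⟩ : SingularSimplex X)))
    ⟨(X.toSSetObjEquiv (.op ⦋n⦌)).symm σ⟩
  refine congr(($this).hom a).trans ?_
  simp

theorem d_singleChain {n : ℕ} (σ : C(Simplex (n + 1), X)) (a : A) :
    (((chains A).obj X).d (n + 1) n).hom (singleChain A X σ a) =
      ∑ i : Fin (n + 2), ((-1 : ℤ) ^ (i : ℕ)) • singleChain A X (σ.comp (face i)) a := by
  have := SSet.ιChainComplex_d (R := AddCommGrpCat.of A) (TopCat.toSSet.obj X)
    ((X.toSSetObjEquiv (.op ⦋n + 1⦌)).symm σ)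
  refine congr(AddCommGrpCat.homAddEquiv $this a).trans ?_
  rw [map_sum, AddMonoidHom.finsetSum_apply]
  rfl

theorem map_singleChain {Y : TopCat.{u}} (f : X ⟶ Y) {n : ℕ} (σ : C(Simplex n, X)) (a : A) :
    (((chains A).map f).f n).hom (singleChain A X σ a) = singleChain A Y (f.hom.comp σ) a := by
  have := SSet.ι_chainComplexMap_f (f := TopCat.toSSet.map f)
    (R := AddCommGrpCat.of A) (x := (X.toSSetObjEquiv (.op ⦋n⦌)).symm σ)
  exact congr(($this).hom a)

theorem toChain_injective (n : ℕ) : Function.Injective (toChain A X n) := by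
  let g : Chain A X →+ ((chains A).obj X).X n := Finsupp.liftAddHom fun s =>
    if h : s.1 = n then singleChain A X (h ▸ s.2) else 0
  have : g.comp (toChain A X n) = .id _ := chains_hom_ext fun σ a => by simp [g]
  exact Function.LeftInverse.injective (g := g) fun x => congr($this x)

theorem range_toChain (n : ℕ) : (toChain A X n).range = chainsDeg A X n := by
  refine le_antisymm ?_ (chainsDeg_le_iff.2 ?_)
  · rintro _ ⟨x, rfl⟩
    have h : (QuotientAddGroup.mk' (chainsDeg A X n)).comp (toChain A X n) = 0 :=
      chains_hom_ext fun σ a => by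
        rw [AddMonoidHom.comp_apply, toChain_singleChain]
        exact (QuotientAddGroup.eq_zero_iff _).2 (single_mem_chainsDeg rfl _ _)
    exact (QuotientAddGroup.eq_zero_iff _).1 congr($h x)
  · intro m hm σ a
    obtain rfl : m = n := by exact_mod_cast hm
    exact ⟨singleChain A X σ a, toChain_singleChain _ _⟩

theorem boundary_toChain_zero (c : ((chains A).obj X).X 0) :
    boundary A X (toChain A X 0 c) = 0 := by
  have : (boundary A X).comp (toChain A X 0) = 0 := chains_hom_ext fun σ a => by simp
  exact congr($this c)

theorem boundary_toChain_succ {n : ℕ} (c : ((chains A).obj X).X (n + 1)) :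
    boundary A X (toChain A X (n + 1) c) =
      toChain A X n ((((chains A).obj X).d (n + 1) n).hom c) := by
  have : (boundary A X).comp (toChain A X (n + 1)) =
      (toChain A X n).comp (((chains A).obj X).d (n + 1) n).hom := chains_hom_ext fun σ a => by
    simp [d_singleChain, boundary_single_succ]
  exact congr($this c)

theorem toChain_map {Y : TopCat.{u}} (f : X ⟶ Y) {n : ℕ} (c : ((chains A).obj X).X n) :
    toChain A Y n ((((chains A).map f).f n).hom c) = chainMap A f.hom (toChain A X n c) := by
  have : (toChain A Y n).comp (((chains A).map f).f n).hom =
      (chainMap A f.hom).comp (toChain A X n) := chains_hom_ext fun σ a => by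
    simp [map_singleChain]
  exact congr($this c)

end Comparison

/-! ### Relative homology in terms of chains -/

section

variable (A : Type*) [AddCommGroup A] (X : Type*) [TopologicalSpace X]

/-- The chains of degree `n` whose boundary lies in `S`. -/
def relCycles (S : Set X) (n : ℤ) : AddSubgroup (Chain A X) :=
  chainsDeg A X n ⊓ (chainsIn A S).comap (boundary A X)

/-- The sums of a chain in `S` and a boundary. -/
def relBoundaries (S : Set X) (n : ℤ) : AddSubgroup (Chain A X) :=
  (chainsIn A S ⊓ chainsDeg A X n) ⊔ (chainsDeg A X (n + 1)).map (boundary A X)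

/-- The relative singular homology `H_n(X, S; A)`. -/
abbrev RelHomology (S : Set X) (n : ℤ) : Type _ :=
  Subquotient (relCycles A X S n) (relBoundaries A X S n)

variable {A X}

theorem mem_relCycles {S : Set X} {n : ℤ} {c : Chain A X} :
    c ∈ relCycles A X S n ↔ c ∈ chainsDeg A X n ∧ boundary A X c ∈ chainsIn A S := Iff.rfl

theorem mem_relBoundaries {S : Set X} {n : ℤ} {c : Chain A X} :
    c ∈ relBoundaries A X S n ↔ ∃ a ∈ chainsIn A S, a ∈ chainsDeg A X n ∧
      ∃ b ∈ chainsDeg A X (n + 1), c = a + boundary A X b := by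
  simp only [relBoundaries, AddSubgroup.mem_sup, AddSubgroup.mem_map, AddSubgroup.mem_inf]
  constructor
  · rintro ⟨a, ⟨ha, ha'⟩, _, ⟨b, hb, rfl⟩, rfl⟩
    exact ⟨a, ha, ha', b, hb, rfl⟩
  · rintro ⟨a, ha, ha', b, hb, rfl⟩
    exact ⟨a, ⟨ha, ha'⟩, _, ⟨b, hb, rfl⟩, rfl⟩

theorem mem_relCycles_empty {n : ℤ} {c : Chain A X} :
    c ∈ relCycles A X ∅ n ↔ c ∈ chainsDeg A X n ∧ boundary A X c = 0 := by
  rw [mem_relCycles, chainsIn_empty, AddSubgroup.mem_bot]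

theorem mem_relBoundaries_empty {n : ℤ} {c : Chain A X} :
    c ∈ relBoundaries A X ∅ n ↔ ∃ b ∈ chainsDeg A X (n + 1), c = boundary A X b := by
  rw [mem_relBoundaries, chainsIn_empty]
  constructor
  · rintro ⟨a, ha, -, b, hb, rfl⟩
    exact ⟨b, hb, by rw [AddSubgroup.mem_bot.1 ha, zero_add]⟩
  · rintro ⟨b, hb, rfl⟩
    exact ⟨0, zero_mem _, zero_mem _, b, hb, by rw [zero_add]⟩

theorem chainMap_mem_relCycles {Y : Type*} [TopologicalSpace Y] {f : C(X, Y)} {S : Set X}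
    {T : Set Y} (h : Set.MapsTo f S T) {n : ℤ} {c : Chain A X} (hc : c ∈ relCycles A X S n) :
    chainMap A f c ∈ relCycles A Y T n :=
  mem_relCycles.2 ⟨chainMap_mem_chainsDeg f hc.1, by
    rw [boundary_chainMap]
    exact chainMap_mem_chainsIn h hc.2⟩

theorem chainMap_mem_relBoundaries {Y : Type*} [TopologicalSpace Y] {f : C(X, Y)} {S : Set X}
    {T : Set Y} (h : Set.MapsTo f S T) {n : ℤ} {c : Chain A X} (hc : c ∈ relBoundaries A X S n) :
    chainMap A f c ∈ relBoundaries A Y T n := by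
  obtain ⟨a, ha, ha', b, hb, rfl⟩ := mem_relBoundaries.1 hc
  exact mem_relBoundaries.2 ⟨_, chainMap_mem_chainsIn h ha, chainMap_mem_chainsDeg f ha', _,
    chainMap_mem_chainsDeg f hb, by rw [map_add, boundary_chainMap]⟩

/-- The homomorphism of relative homology groups that a map of pairs induces. -/
def relMap {Y : Type*} [TopologicalSpace Y] (f : C(X, Y)) {S : Set X} {T : Set Y}
    (h : Set.MapsTo f S T) (n : ℤ) : RelHomology A X S n →+ RelHomology A Y T n :=
  Subquotient.map (chainMap A f) (fun _ hc => chainMap_mem_relCycles h hc)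
    (fun _ _ hc => chainMap_mem_relBoundaries h hc)

theorem relMap_mk {Y : Type*} [TopologicalSpace Y] (f : C(X, Y)) {S : Set X} {T : Set Y}
    (h : Set.MapsTo f S T) (n : ℤ) (c : relCycles A X S n) :
    relMap f h n (Subquotient.mk _ _ c) =
      Subquotient.mk _ _ ⟨chainMap A f c, chainMap_mem_relCycles h c.2⟩ := rfl

theorem relMap_relMap {Y Z : Type*} [TopologicalSpace Y] [TopologicalSpace Z] (f : C(X, Y))
    (g : C(Y, Z)) {S : Set X} {T : Set Y} {U : Set Z} (hf : Set.MapsTo f S T)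
    (hg : Set.MapsTo g T U) (n : ℤ) (x : RelHomology A X S n) :
    relMap g hg n (relMap f hf n x) = relMap (g.comp f) (hg.comp hf) n x := by
  obtain ⟨c, rfl⟩ := Subquotient.mk_surjective _ _ x
  simp only [relMap_mk, chainMap_comp]

end

section Homology

variable {A : Type u} [AddCommGroup A]

theorem boundary_boundary {X : Type u} [TopologicalSpace X] (c : Chain A X) :
    boundary A X (boundary A X c) = 0 := by
  suffices h : (boundary A X).comp (boundary A X) = 0 from congr($h c)
  refine Finsupp.addHom_ext fun ⟨n, σ⟩ a => ?_
  rw [AddMonoidHom.comp_apply, ← toChain_singleChain (X := .of X)]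
  cases n with
  | zero =>
    have := boundary_toChain_zero (singleChain A (.of X) σ a)
    rw [this, map_zero, AddMonoidHom.zero_apply]
  | succ n =>
    have := boundary_toChain_succ (singleChain A (.of X) σ a)
    rw [this]
    cases n with
    | zero => exact boundary_toChain_zero _
    | succ n =>
      refine (boundary_toChain_succ _).trans ?_
      have := congr(($(((chains A).obj (.of X)).d_comp_d (n + 2) (n + 1) n)).hom
        (singleChain A (.of X) σ a))
      refine (congr_arg (toChain A (.of X) n) this).trans ?_
      exact map_zero _

theorem exists_cycle {X : TopCat.{u}} {n : ℕ} {z : Chain A X} (hz : z ∈ relCycles A X ∅ n) :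
    ∃ y : ((chains A).obj X).cycles n,
      toChain A X n ((((chains A).obj X).iCycles n).hom y) = z := by
  obtain ⟨h1, h2⟩ := mem_relCycles_empty.1 hz
  rw [← range_toChain] at h1
  obtain ⟨c, rfl⟩ := h1
  obtain ⟨y, rfl⟩ := exists_iCycles_eq ((chains A).obj X) rfl c (by
    cases n with
    | zero => rw [HomologicalComplex.shape _ _ _ (by simp)]; rfl
    | succ n =>
      rw [ChainComplex.next_nat_succ]
      refine toChain_injective _ ?_
      rw [← boundary_toChain_succ, h2, map_zero])
  exact ⟨y, rfl⟩

variable (A)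

/-- The homology class of a cycle. In negative degrees both groups vanish. -/
def homologyClass (X : TopCat.{u}) : (n : ℤ) → relCycles A X ∅ n →+ (homologyFunctor A n).obj X
  | .ofNat n => (((chains A).obj X).homologyπ n).hom.comp
      (AddMonoidHom.mk' (fun z => (exists_cycle z.2).choose) fun x y =>
        iCycles_injective _ _ <| toChain_injective _ <| by
          rw [(exists_cycle (x + y).2).choose_spec, map_add, map_add,
            (exists_cycle x.2).choose_spec, (exists_cycle y.2).choose_spec]
          rfl)
  | .negSucc _ => 0

variable {A}

theorem homologyClass_ofNat {X : TopCat.{u}} {n : ℕ} (z : relCycles A X ∅ n)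
    (y : ((chains A).obj X).cycles n)
    (h : toChain A X n ((((chains A).obj X).iCycles n).hom y) = z) :
    homologyClass A X n z = (((chains A).obj X).homologyπ n).hom y := by
  have : (exists_cycle z.2).choose = y := iCycles_injective _ _ <| toChain_injective _ <| by
    rw [(exists_cycle z.2).choose_spec, h]
  rw [← this]
  rfl

theorem toChain_iCycles_mem {X : TopCat.{u}} {n : ℕ} (y : ((chains A).obj X).cycles n) :
    toChain A X n ((((chains A).obj X).iCycles n).hom y) ∈ relCycles A X ∅ n := by
  refine mem_relCycles_empty.2 ⟨?_, ?_⟩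
  · rw [← range_toChain]
    exact ⟨_, rfl⟩
  · cases n with
    | zero => exact boundary_toChain_zero _
    | succ n =>
      rw [boundary_toChain_succ]
      have := d_iCycles_apply ((chains A).obj X) (n + 1) n y
      rw [this, map_zero]

theorem homologyClass_surjective (X : TopCat.{u}) (n : ℤ) :
    Function.Surjective (homologyClass A X n) := by
  cases n with
  | ofNat n =>
    intro x
    obtain ⟨y, rfl⟩ := homologyπ_surjective ((chains A).obj X) n x
    exact ⟨⟨_, toChain_iCycles_mem y⟩, homologyClass_ofNat _ y rfl⟩
  | negSucc n => exact fun x => ⟨0, rfl⟩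

theorem homologyClass_eq_zero_iff {X : TopCat.{u}} {n : ℤ} (z : relCycles A X ∅ n) :
    homologyClass A X n z = 0 ↔ ∃ b ∈ chainsDeg A X (n + 1), (z : Chain A X) = boundary A X b := by
  cases n with
  | ofNat n =>
    obtain ⟨y, hy⟩ := exists_cycle z.2
    refine (Eq.congr_left (homologyClass_ofNat z y hy)).trans
      ((homologyπ_eq_zero_iff _ (ChainComplex.prev ℕ n) y).trans ?_)
    have hG : chainsDeg A X (Int.ofNat n + 1) = (toChain A X (n + 1)).range :=
      (range_toChain (n + 1)).symm
    rw [hG, ← hy]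
    constructor
    · rintro ⟨b, hb⟩
      exact ⟨_, ⟨b, rfl⟩, by rw [← hb, boundary_toChain_succ]⟩
    · rintro ⟨_, ⟨b, rfl⟩, hb⟩
      exact ⟨b, toChain_injective _ (by rw [hb, boundary_toChain_succ])⟩
  | negSucc n =>
    have : (z : Chain A X) = 0 := chainsDeg_neg (Int.negSucc_lt_zero n) z.2.1
    exact ⟨fun _ => ⟨0, zero_mem _, by rw [this, map_zero]⟩, fun _ => rfl⟩

theorem map_homologyClass {X Y : TopCat.{u}} (f : X ⟶ Y) {n : ℤ} (z : relCycles A X ∅ n)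
    (w : relCycles A Y ∅ n) (hw : (w : Chain A Y) = chainMap A f.hom z) :
    ((homologyFunctor A n).map f).hom (homologyClass A X n z) = homologyClass A Y n w := by
  cases n with
  | ofNat n =>
    obtain ⟨y, hy⟩ := exists_cycle z.2
    have h : toChain A Y n ((((chains A).obj Y).iCycles n).hom
        ((HomologicalComplex.cyclesMap ((chains A).map f) n).hom y)) = w := by
      rw [hw, ← hy, ← toChain_map]
      congr 1
      exact congr(($(HomologicalComplex.cyclesMap_i ((chains A).map f) n)).hom y)
    refine (congr_arg _ (homologyClass_ofNat z y hy)).trans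
      (Eq.trans ?_ (homologyClass_ofNat w _ h).symm)
    exact congr(($(HomologicalComplex.homologyπ_naturality ((chains A).map f) n)).hom y)
  | negSucc n => rfl

/-- Homotopic maps send a cycle to homologous cycles. -/
theorem exists_boundary_of_homotopic {X Y : Type u} [TopologicalSpace X] [TopologicalSpace Y]
    {f g : C(X, Y)} (h : f.Homotopic g) {n : ℤ} {z : Chain A X} (hz : z ∈ chainsDeg A X n)
    (hz' : boundary A X z = 0) :
    ∃ b ∈ chainsDeg A Y (n + 1), chainMap A f z = chainMap A g z + boundary A Y b := by
  have hz0 : z ∈ relCycles A X ∅ n := mem_relCycles_empty.2 ⟨hz, hz'⟩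
  have hm (f : C(X, Y)) : chainMap A f z ∈ relCycles A Y ∅ n :=
    chainMap_mem_relCycles (Set.mapsTo_empty _ _) hz0
  obtain ⟨H⟩ := h
  have key : homologyClass A (.of Y) n ⟨_, hm f⟩ = homologyClass A (.of Y) n ⟨_, hm g⟩ := by
    rw [← map_homologyClass (X := .of X) (TopCat.ofHom f) ⟨z, hz0⟩ _ rfl,
      ← map_homologyClass (X := .of X) (TopCat.ofHom g) ⟨z, hz0⟩ _ rfl]
    congr 2
    cases n with
    | ofNat n =>
      exact TopCat.Homotopy.congr_homologyMap_singularChainComplexFunctor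
        (f := TopCat.ofHom f) (g := TopCat.ofHom g) H _ n
    | negSucc n => rfl
  rw [← sub_eq_zero, ← map_sub, homologyClass_eq_zero_iff] at key
  obtain ⟨b, hb, h⟩ := key
  exact ⟨b, hb, (sub_eq_iff_eq_add'.1 h)⟩

/-- The singular homology of a space is its homology relative to the empty subset. -/
theorem nonempty_relHomology_empty_equiv (X : TopCat.{u}) (n : ℤ) :
    Nonempty (RelHomology A X ∅ n ≃+ (homologyFunctor A n).obj X) := by
  obtain ⟨e, -⟩ := exists_addEquiv_of_ker_eq _ _
    (Subquotient.mk_surjective _ (relBoundaries A X ∅ n)) (homologyClass_surjective X n) fun z => by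
      rw [Subquotient.mk_eq_zero_iff, homologyClass_eq_zero_iff, mem_relBoundaries_empty]
  exact ⟨e⟩

end Homology

/-! ### Affine simplices in a standard simplex -/

/-- The affine map between standard simplices with given values at the vertices. -/
def affine {m n : ℕ} (v : Fin (m + 1) → Simplex n) : C(Simplex m, Simplex n) where
  toFun t := ⟨fun k => ∑ i, t i * v i k, fun k => Finset.sum_nonneg fun i _ =>
      mul_nonneg (stdSimplex.zero_le t i) (stdSimplex.zero_le (v i) k), by
    rw [Finset.sum_comm]
    simp_rw [← Finset.mul_sum, stdSimplex.sum_eq_one, mul_one, stdSimplex.sum_eq_one]⟩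
  continuous_toFun := by
    refine Continuous.subtype_mk (continuous_pi fun k => continuous_finsetSum _ fun i _ => ?_) _
    exact ((continuous_apply i).comp continuous_subtype_val).mul continuous_const

@[simp]
theorem affine_apply {m n : ℕ} (v : Fin (m + 1) → Simplex n) (t : Simplex m) (k : Fin (n + 1)) :
    affine v t k = ∑ i, t i * v i k := rfl

@[simp]
theorem affine_vertex {m n : ℕ} (v : Fin (m + 1) → Simplex n) (i : Fin (m + 1)) :
    affine v (stdSimplex.vertex i) = v i := by
  ext k
  simp [Pi.single_apply]

theorem affine_comp {l m n : ℕ} (w : Fin (m + 1) → Simplex n) (v : Fin (l + 1) → Simplex m) :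
    (affine w).comp (affine v) = affine (affine w ∘ v) := by
  ext t k
  simp only [ContinuousMap.comp_apply, affine_apply, Function.comp_apply, Finset.sum_mul,
    Finset.mul_sum]
  rw [Finset.sum_comm]
  simp only [mul_assoc]

theorem affine_vertices (n : ℕ) :
    affine (fun i : Fin (n + 1) => stdSimplex.vertex i) = .id (Simplex n) := by
  ext t k
  simp [Pi.single_apply]

theorem face_eq_affine {n : ℕ} (i : Fin (n + 2)) :
    face i = affine fun j : Fin (n + 1) => stdSimplex.vertex (i.succAbove j) := by
  ext t k
  simp [face, FunOnFinite.linearMap_apply_apply, Pi.single_apply, Finset.sum_filter, eq_comm]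

theorem affine_comp_face {m n : ℕ} (v : Fin (m + 2) → Simplex n) (i : Fin (m + 2)) :
    (affine v).comp (face i) = affine (v ∘ i.succAbove) := by
  rw [face_eq_affine, affine_comp]
  congr 1
  ext j : 1
  exact affine_vertex _ _

/-- The distance of a point from a point of an affine simplex is at most the corresponding mean of
its distances from the vertices. -/
theorem dist_affine_le {m n : ℕ} (v : Fin (m + 1) → Simplex n) (t : Simplex m) (p : Simplex n) :
    dist (affine v t) p ≤ ∑ i, t i * dist (v i) p := by
  refine (dist_pi_le_iff (Finset.sum_nonneg fun i _ =>
    mul_nonneg (stdSimplex.zero_le t i) dist_nonneg)).2 fun k => ?_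
  have h : affine v t k - p k = ∑ i, t i * (v i k - p k) := by
    simp only [mul_sub, Finset.sum_sub_distrib, ← Finset.sum_mul, stdSimplex.sum_eq_one, one_mul,
      affine_apply]
  change |affine v t k - p k| ≤ _
  rw [h]
  refine (Finset.abs_sum_le_sum_abs _ _).trans (Finset.sum_le_sum fun i _ => ?_)
  rw [abs_mul, abs_of_nonneg (stdSimplex.zero_le t i)]
  exact mul_le_mul_of_nonneg_left (dist_le_pi_dist (v i).1 p.1 k) (stdSimplex.zero_le t i)

theorem dist_affine_le_of_forall {m n : ℕ} {v : Fin (m + 1) → Simplex n} (t : Simplex m)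
    {p : Simplex n} {r : ℝ} (h : ∀ i, dist (v i) p ≤ r) : dist (affine v t) p ≤ r := by
  refine (dist_affine_le v t p).trans ?_
  calc ∑ i, t i * dist (v i) p ≤ ∑ i, t i * r :=
        Finset.sum_le_sum fun i _ => mul_le_mul_of_nonneg_left (h i) (stdSimplex.zero_le t i)
    _ = r := by rw [← Finset.sum_mul, stdSimplex.sum_eq_one, one_mul]

/-! ### Formal chains of tuples of points -/

/-- The formal integral combinations of `m`-tuples of points. A tuple with `m + 1` entries stands
for an affine `m`-simplex; the empty tuple makes the chain complex augmented. -/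
abbrev TupleChain (K : Type*) (m : ℕ) : Type _ := (Fin m → K) →₀ ℤ

section TupleChain

variable {K L : Type*}

variable (K) in
/-- The boundary of a tuple: the alternating sum over the ways to omit an entry. -/
def tupleBoundary (m : ℕ) : TupleChain K (m + 1) →ₗ[ℤ] TupleChain K m :=
  Finsupp.linearCombination ℤ fun v =>
    ∑ i : Fin (m + 1), ((-1 : ℤ) ^ (i : ℕ)) • .single (v ∘ i.succAbove) 1

theorem tupleBoundary_single {m : ℕ} (v : Fin (m + 1) → K) :
    tupleBoundary K m (.single v 1) =
      ∑ i : Fin (m + 1), ((-1 : ℤ) ^ (i : ℕ)) • .single (v ∘ i.succAbove) 1 := by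
  simp [tupleBoundary]

/-- The homomorphism that applies a map to all entries. -/
def tupleMap (f : K → L) (m : ℕ) : TupleChain K m →ₗ[ℤ] TupleChain L m :=
  Finsupp.lmapDomain ℤ ℤ fun v => f ∘ v

@[simp]
theorem tupleMap_single (f : K → L) {m : ℕ} (v : Fin m → K) (k : ℤ) :
    tupleMap f m (.single v k) = .single (f ∘ v) k := by
  simp [tupleMap]

/-- The cone with apex `b`: the homomorphism that puts `b` in front of all tuples. -/
def tupleCone (b : K) (m : ℕ) : TupleChain K m →ₗ[ℤ] TupleChain K (m + 1) :=
  Finsupp.lmapDomain ℤ ℤ fun v => Fin.cons b v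

@[simp]
theorem tupleCone_single (b : K) {m : ℕ} (v : Fin m → K) (k : ℤ) :
    tupleCone b m (.single v k) = .single (Fin.cons b v) k := by
  simp [tupleCone]

theorem tupleBoundary_tupleMap (f : K → L) {m : ℕ} (c : TupleChain K (m + 1)) :
    tupleBoundary L m (tupleMap f _ c) = tupleMap f _ (tupleBoundary K m c) := by
  suffices h : (tupleBoundary L m) ∘ₗ (tupleMap f _) = (tupleMap f _) ∘ₗ (tupleBoundary K m) from
    congr($h c)
  ext v : 2
  simp [tupleBoundary_single, Function.comp_assoc]

theorem tupleMap_tupleCone (f : K → L) (b : K) {m : ℕ} (c : TupleChain K m) :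
    tupleMap f _ (tupleCone b m c) = tupleCone (f b) m (tupleMap f _ c) := by
  suffices h : (tupleMap f _) ∘ₗ (tupleCone b m) = (tupleCone (f b) m) ∘ₗ (tupleMap f _) from
    congr($h c)
  ext v : 2
  simp only [LinearMap.comp_apply, Finsupp.lsingle_apply, tupleCone_single, tupleMap_single]
  congr 1
  ext i
  cases i using Fin.cases <;> rfl

theorem tupleBoundary_tupleCone_zero (b : K) (c : TupleChain K 0) :
    tupleBoundary K 0 (tupleCone b 0 c) = c := by
  suffices h : (tupleBoundary K 0) ∘ₗ (tupleCone b 0) = .id from congr($h c)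
  ext v : 2
  simp [tupleBoundary_single]

theorem tupleBoundary_tupleCone_succ (b : K) {m : ℕ} (c : TupleChain K (m + 1)) :
    tupleBoundary K (m + 1) (tupleCone b (m + 1) c) = c - tupleCone b m (tupleBoundary K m c) := by
  suffices h : (tupleBoundary K (m + 1)) ∘ₗ (tupleCone b (m + 1)) =
      .id - (tupleCone b m) ∘ₗ (tupleBoundary K m) from congr($h c)
  ext v : 2
  simp only [LinearMap.comp_apply, Finsupp.lsingle_apply, tupleCone_single, tupleBoundary_single,
    LinearMap.sub_apply, LinearMap.id_apply, map_sum, map_zsmul]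
  rw [Fin.sum_univ_succ]
  have h0 : (Fin.cons b v : Fin (m + 2) → K) ∘ (0 : Fin (m + 2)).succAbove = v := by
    ext i; simp
  have h1 (i : Fin (m + 1)) : (Fin.cons b v : Fin (m + 2) → K) ∘ i.succ.succAbove =
      Fin.cons b (v ∘ i.succAbove) := by
    ext j
    cases j using Fin.cases <;> simp
  simp only [h0, h1, Fin.val_zero, pow_zero, one_smul, Fin.val_succ, pow_succ, mul_neg, mul_one,
    neg_smul, Finset.sum_neg_distrib, sub_eq_add_neg]

theorem tupleBoundary_tupleBoundary {m : ℕ} (c : TupleChain K (m + 2)) :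
    tupleBoundary K m (tupleBoundary K (m + 1) c) = 0 := by
  suffices h : (tupleBoundary K m) ∘ₗ (tupleBoundary K (m + 1)) = 0 from congr($h c)
  ext v : 2
  have hv : Finsupp.single v (1 : ℤ) = tupleCone (v 0) _ (.single (Fin.tail v) 1) := by simp
  simp only [LinearMap.comp_apply, Finsupp.lsingle_apply, LinearMap.zero_apply]
  rw [hv, tupleBoundary_tupleCone_succ, map_sub, sub_eq_zero, eq_comm]
  cases m with
  | zero => exact tupleBoundary_tupleCone_zero _ _
  | succ m => rw [tupleBoundary_tupleCone_succ, tupleBoundary_tupleBoundary, map_zero, sub_zero]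

end TupleChain

/-! ### Barycentric subdivision of affine simplices -/

section Subdivision

variable {n : ℕ}

/-- The barycenter of an affine simplex. -/
def center {m : ℕ} (v : Fin (m + 1) → Simplex n) : Simplex n := affine v stdSimplex.barycenter

theorem affine_center {k m : ℕ} (w : Fin (n + 1) → Simplex k) (v : Fin (m + 1) → Simplex n) :
    affine w (center v) = center (affine w ∘ v) := by
  rw [center, center, ← affine_comp, ContinuousMap.comp_apply]

variable (n) in
/-- Barycentric subdivision: a simplex is replaced by the cone, with apex its barycenter, over the
subdivision of its boundary. -/
def tupleSd : (m : ℕ) → TupleChain (Simplex n) m →ₗ[ℤ] TupleChain (Simplex n) m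
  | 0 => .id
  | m + 1 => Finsupp.linearCombination ℤ fun v =>
      tupleCone (center v) m (tupleSd m (tupleBoundary _ m (.single v 1)))

variable (n) in
/-- The chain homotopy between barycentric subdivision and the identity. -/
def tupleHtpy : (m : ℕ) → TupleChain (Simplex n) m →ₗ[ℤ] TupleChain (Simplex n) (m + 1)
  | 0 => 0
  | m + 1 => Finsupp.linearCombination ℤ fun v =>
      tupleCone (center v) (m + 1)
        (.single v 1 - tupleHtpy m (tupleBoundary _ m (.single v 1)))

theorem tupleSd_single {m : ℕ} (v : Fin (m + 1) → Simplex n) :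
    tupleSd n (m + 1) (.single v 1) =
      tupleCone (center v) m (tupleSd n m (tupleBoundary _ m (.single v 1))) := by
  simp [tupleSd]

theorem tupleHtpy_single {m : ℕ} (v : Fin (m + 1) → Simplex n) :
    tupleHtpy n (m + 1) (.single v 1) = tupleCone (center v) (m + 1)
      (.single v 1 - tupleHtpy n m (tupleBoundary _ m (.single v 1))) := by
  simp [tupleHtpy]

theorem tupleBoundary_tupleSd {m : ℕ} (c : TupleChain (Simplex n) (m + 1)) :
    tupleBoundary _ m (tupleSd n (m + 1) c) = tupleSd n m (tupleBoundary _ m c) := by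
  suffices h : (tupleBoundary _ m) ∘ₗ (tupleSd n (m + 1)) = (tupleSd n m) ∘ₗ (tupleBoundary _ m)
    from congr($h c)
  ext v : 2
  simp only [LinearMap.comp_apply, Finsupp.lsingle_apply, tupleSd_single]
  cases m with
  | zero => exact tupleBoundary_tupleCone_zero _ _
  | succ m =>
    rw [tupleBoundary_tupleCone_succ, tupleBoundary_tupleSd, tupleBoundary_tupleBoundary, map_zero,
      map_zero, sub_zero]

theorem tupleBoundary_tupleHtpy_zero (c : TupleChain (Simplex n) 1) :
    tupleBoundary _ 1 (tupleHtpy n 1 c) = c - tupleSd n 1 c := by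
  suffices h : (tupleBoundary _ 1) ∘ₗ (tupleHtpy n 1) = .id - tupleSd n 1 from congr($h c)
  ext v : 2
  simp only [LinearMap.comp_apply, Finsupp.lsingle_apply, tupleHtpy_single, LinearMap.sub_apply,
    LinearMap.id_apply, tupleSd_single]
  rw [tupleBoundary_tupleCone_succ]
  simp [tupleHtpy, tupleSd]

theorem tupleBoundary_tupleHtpy {m : ℕ} (c : TupleChain (Simplex n) (m + 1)) :
    tupleBoundary _ (m + 1) (tupleHtpy n (m + 1) c) + tupleHtpy n m (tupleBoundary _ m c) =
      c - tupleSd n (m + 1) c := by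
  induction m with
  | zero => rw [tupleBoundary_tupleHtpy_zero, tupleHtpy, LinearMap.zero_apply, add_zero]
  | succ m ih =>
    suffices h : (tupleBoundary _ (m + 2)) ∘ₗ (tupleHtpy n (m + 2)) +
        (tupleHtpy n (m + 1)) ∘ₗ (tupleBoundary _ (m + 1)) = .id - tupleSd n (m + 2) from
      congr($h c)
    ext v : 2
    simp only [LinearMap.comp_apply, Finsupp.lsingle_apply, tupleHtpy_single, LinearMap.sub_apply,
      LinearMap.id_apply, tupleSd_single, LinearMap.add_apply]
    have := ih (tupleBoundary _ (m + 1) (.single v 1))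
    rw [tupleBoundary_tupleBoundary, map_zero, add_zero] at this
    rw [tupleBoundary_tupleCone_succ, map_sub (tupleBoundary _ (m + 1)), this, sub_sub_cancel]
    abel

theorem tupleMap_tupleSd {k : ℕ} (w : Fin (n + 1) → Simplex k) {m : ℕ}
    (c : TupleChain (Simplex n) m) :
    tupleMap (affine w) m (tupleSd n m c) = tupleSd k m (tupleMap (affine w) m c) := by
  induction m with
  | zero => rfl
  | succ m ih =>
    suffices h : (tupleMap (affine w) _) ∘ₗ (tupleSd n (m + 1)) =
        (tupleSd k (m + 1)) ∘ₗ (tupleMap (affine w) _) from congr($h c)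
    ext v : 2
    simp only [LinearMap.comp_apply, Finsupp.lsingle_apply, tupleSd_single, tupleMap_single,
      tupleMap_tupleCone, ih, ← tupleBoundary_tupleMap, affine_center]

theorem tupleMap_tupleHtpy {k : ℕ} (w : Fin (n + 1) → Simplex k) {m : ℕ}
    (c : TupleChain (Simplex n) m) :
    tupleMap (affine w) (m + 1) (tupleHtpy n m c) = tupleHtpy k m (tupleMap (affine w) m c) := by
  induction m with
  | zero => simp [tupleHtpy]
  | succ m ih =>
    suffices h : (tupleMap (affine w) _) ∘ₗ (tupleHtpy n (m + 1)) =
        (tupleHtpy k (m + 1)) ∘ₗ (tupleMap (affine w) _) from congr($h c)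
    ext v : 2
    simp only [LinearMap.comp_apply, Finsupp.lsingle_apply, tupleHtpy_single, tupleMap_single,
      tupleMap_tupleCone, ih, ← tupleBoundary_tupleMap, affine_center, map_sub]

/-- The chains of tuples whose entries have pairwise distances at most `d`. -/
def smallTuples (n m : ℕ) (d : ℝ) : Submodule ℤ (TupleChain (Simplex n) m) :=
  Finsupp.supported ℤ ℤ {v | ∀ i j, dist (v i) (v j) ≤ d}

theorem dist_center_le {m : ℕ} {v : Fin (m + 1) → Simplex n} {d : ℝ}
    (hv : ∀ i j, dist (v i) (v j) ≤ d) (j : Fin (m + 1)) :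
    dist (center v) (v j) ≤ m / (m + 1) * d := by
  refine (dist_affine_le v _ _).trans ?_
  rw [← Finset.add_sum_erase _ _ (Finset.mem_univ j), dist_self, mul_zero, zero_add]
  have h (i) : (stdSimplex.barycenter : Simplex m) i = ((m : ℝ) + 1)⁻¹ := by
    rw [← Nat.cast_add_one]
    exact (stdSimplex.barycenter_apply i).trans (by rw [Fintype.card_fin])
  calc ∑ i ∈ Finset.univ.erase j, (stdSimplex.barycenter : Simplex m) i * dist (v i) (v j)
      ≤ ∑ i ∈ Finset.univ.erase j, ((m : ℝ) + 1)⁻¹ * d :=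
        Finset.sum_le_sum fun i _ => by
          rw [h]
          exact mul_le_mul_of_nonneg_left (hv i j) (by positivity)
    _ = m / (m + 1) * d := by
        rw [Finset.sum_const, Finset.card_erase_of_mem (Finset.mem_univ j)]
        simp
        ring

/-- The tuples in the subdivision of a tuple of diameter at most `d` have diameter at most
`m / (m + 1) * d`. The induction uses that they stay in all closed balls that contain the
given points. -/
theorem tupleSd_single_mem {m : ℕ} {v : Fin m → Simplex n} {d : ℝ} (hd : 0 ≤ d)
    (hv : ∀ i j, dist (v i) (v j) ≤ d) :
    tupleSd n m (.single v 1) ∈ Finsupp.supported ℤ ℤ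
      {w : Fin m → Simplex n | (∀ i j, dist (w i) (w j) ≤ (m - 1 : ℝ) / m * d) ∧
        ∀ p r, (∀ j, dist (v j) p ≤ r) → ∀ j, dist (w j) p ≤ r} := by
  induction m with
  | zero => exact Finsupp.single_mem_supported _ _ ⟨fun i => i.elim0, fun _ _ _ i => i.elim0⟩
  | succ m ih =>
    have hm : (m - 1 : ℝ) / m ≤ m / (m + 1) := by
      rcases m.eq_zero_or_pos with rfl | hm
      · simp
      · have : (0 : ℝ) < m := by exact_mod_cast hm
        rw [div_le_div_iff₀ this (by positivity)]
        nlinarith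
    rw [tupleSd_single, tupleBoundary_single, map_sum, map_sum]
    refine sum_mem fun i _ => ?_
    rw [map_zsmul, map_zsmul]
    refine Submodule.smul_mem _ _ ?_
    have h := ih (v := v ∘ i.succAbove) (fun _ _ => hv _ _)
    refine (Finsupp.mem_supported ℤ _).2 fun w hw => ?_
    obtain ⟨u, hu, rfl⟩ : ∃ u ∈ (tupleSd n m (.single (v ∘ i.succAbove) 1)).support,
        Fin.cons (center v) u = w := by
      classical
      simpa using Finsupp.mapDomain_support hw
    obtain ⟨h1, h2⟩ := (Finsupp.mem_supported ℤ _).1 h hu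
    have h3 (p r) (hp : ∀ j, dist (v j) p ≤ r) (j) : dist (u j) p ≤ r := h2 p r (fun j => hp _) j
    have h4 (j) : dist (u j) (center v) ≤ m / (m + 1) * d :=
      h3 _ _ (fun j => by rw [dist_comm]; exact dist_center_le hv j) j
    refine ⟨fun a b => ?_, fun p r hp a => ?_⟩
    · push_cast
      rw [add_sub_cancel_right]
      cases a using Fin.cases with
      | zero =>
        cases b using Fin.cases with
        | zero => simp only [dist_self]; positivity
        | succ b => rw [dist_comm]; exact h4 b
      | succ a =>
        cases b using Fin.cases with
        | zero => exact h4 a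
        | succ b => exact (h1 a b).trans (mul_le_mul_of_nonneg_right hm hd)
    · cases a using Fin.cases with
      | zero => exact dist_affine_le_of_forall _ hp
      | succ a => exact h3 p r hp a

theorem tupleSd_mem_smallTuples {m : ℕ} {d : ℝ} (hd : 0 ≤ d) {c : TupleChain (Simplex n) (m + 1)}
    (hc : c ∈ smallTuples n (m + 1) d) :
    tupleSd n (m + 1) c ∈ smallTuples n (m + 1) (m / (m + 1) * d) := by
  rw [← c.sum_single, Finsupp.sum, map_sum]
  refine sum_mem fun v hv => ?_
  rw [← Finsupp.smul_single_one, map_zsmul]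
  refine Submodule.smul_mem _ _ (Finsupp.supported_mono ?_
    (tupleSd_single_mem hd ((Finsupp.mem_supported ℤ _).1 hc hv)))
  rintro w ⟨hw, -⟩ i j
  simpa using hw i j

theorem tupleSd_iterate_mem_smallTuples {m : ℕ} {d : ℝ} (hd : 0 ≤ d)
    {c : TupleChain (Simplex n) (m + 1)} (hc : c ∈ smallTuples n (m + 1) d) (k : ℕ) :
    (tupleSd n (m + 1))^[k] c ∈ smallTuples n (m + 1) (((m : ℝ) / (m + 1)) ^ k * d) := by
  induction k with
  | zero => simpa using hc
  | succ k ih =>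
    rw [Function.iterate_succ_apply', pow_succ', mul_assoc]
    exact tupleSd_mem_smallTuples (by positivity) ih

end Subdivision

/-! ### Barycentric subdivision of singular chains -/

section SingularSubdivision

variable {A : Type*} [AddCommGroup A] {X : Type*} [TopologicalSpace X]

variable (A) in
/-- The image under a singular simplex of a formal chain of affine simplices, as a homomorphism in
the coefficient. -/
def push {n : ℕ} (σ : C(Simplex n, X)) (m : ℕ) :
    TupleChain (Simplex n) (m + 1) →ₗ[ℤ] A →+ Chain A X :=
  Finsupp.linearCombination ℤ fun v => Finsupp.singleAddHom ⟨m, σ.comp (affine v)⟩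

@[simp]
theorem push_single {n : ℕ} (σ : C(Simplex n, X)) {m : ℕ} (v : Fin (m + 1) → Simplex n) (a : A) :
    push A σ m (.single v 1) a = .single ⟨m, σ.comp (affine v)⟩ a := by
  simp [push]

variable (n : ℕ) in
/-- The standard simplex, as the tuple of its vertices. -/
def vertexTuple : TupleChain (Simplex n) (n + 1) :=
  .single (fun i => stdSimplex.vertex i) 1

theorem push_vertexTuple {n : ℕ} (σ : C(Simplex n, X)) (a : A) :
    push A σ n (vertexTuple n) a = .single ⟨n, σ⟩ a := by
  rw [vertexTuple, push_single, affine_vertices, ContinuousMap.comp_id]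

theorem push_comp_affine {n k : ℕ} (σ : C(Simplex k, X)) (w : Fin (n + 1) → Simplex k) {m : ℕ}
    (c : TupleChain (Simplex n) (m + 1)) :
    push A (σ.comp (affine w)) m c = push A σ m (tupleMap (affine w) _ c) := by
  suffices h : push A (σ.comp (affine w)) m = (push A σ m) ∘ₗ (tupleMap (affine w) _) from
    congr($h c)
  ext v a : 4
  simp [ContinuousMap.comp_assoc, affine_comp]

theorem boundary_push_zero {n : ℕ} (σ : C(Simplex n, X)) (c : TupleChain (Simplex n) 1) (a : A) :
    boundary A X (push A σ 0 c a) = 0 := by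
  suffices h : ((AddMonoidHom.compHom (boundary A X)).toIntLinearMap) ∘ₗ (push A σ 0) = 0 from
    congr($h c a)
  ext v a : 4
  simp

theorem boundary_push_succ {n : ℕ} (σ : C(Simplex n, X)) {m : ℕ}
    (c : TupleChain (Simplex n) (m + 2)) (a : A) :
    boundary A X (push A σ (m + 1) c a) = push A σ m (tupleBoundary _ _ c) a := by
  suffices h : ((AddMonoidHom.compHom (boundary A X)).toIntLinearMap) ∘ₗ (push A σ (m + 1)) =
      (push A σ m) ∘ₗ (tupleBoundary _ _) from congr($h c a)
  ext v a : 3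
  simp only [LinearMap.comp_apply, Finsupp.lsingle_apply, tupleBoundary_single, map_sum, map_zsmul,
    AddMonoidHom.coe_toIntLinearMap, AddMonoidHom.compHom_apply_apply, AddMonoidHom.comp_apply,
    push_single, boundary_single_succ, AddMonoidHom.finsetSum_apply, AddMonoidHom.zsmul_apply,
    ContinuousMap.comp_assoc, affine_comp_face]

theorem push_mem_chainsIn {n : ℕ} {σ : C(Simplex n, X)} {S : Set X} (hσ : ∀ x, σ x ∈ S) {m : ℕ}
    (c : TupleChain (Simplex n) (m + 1)) (a : A) : push A σ m c a ∈ chainsIn A S := by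
  rw [push, Finsupp.linearCombination_apply, Finsupp.sum, AddMonoidHom.finsetSum_apply]
  refine sum_mem fun v _ => ?_
  exact zsmul_mem (single_mem_chainsIn (fun x => hσ (affine v x)) _) _

theorem push_mem_chainsDeg {n : ℕ} (σ : C(Simplex n, X)) {m : ℕ} {k : ℤ} (hk : (m : ℤ) = k)
    (c : TupleChain (Simplex n) (m + 1)) (a : A) : push A σ m c a ∈ chainsDeg A X k := by
  rw [push, Finsupp.linearCombination_apply, Finsupp.sum, AddMonoidHom.finsetSum_apply]
  refine sum_mem fun v _ => ?_
  exact zsmul_mem (single_mem_chainsDeg hk _ _) _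

variable (A X) in
/-- Barycentric subdivision of singular chains. -/
def subdivision : Chain A X →+ Chain A X :=
  Finsupp.liftAddHom fun s => push A s.2 s.1 (tupleSd s.1 _ (vertexTuple s.1))

variable (A X) in
/-- The chain homotopy between barycentric subdivision and the identity. -/
def subdivisionHtpy : Chain A X →+ Chain A X :=
  Finsupp.liftAddHom fun s => push A s.2 (s.1 + 1) (tupleHtpy s.1 _ (vertexTuple s.1))

theorem subdivision_push {n : ℕ} (σ : C(Simplex n, X)) {m : ℕ}
    (c : TupleChain (Simplex n) (m + 1)) (a : A) :
    subdivision A X (push A σ m c a) = push A σ m (tupleSd n _ c) a := by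
  suffices h : ((AddMonoidHom.compHom (subdivision A X)).toIntLinearMap) ∘ₗ (push A σ m) =
      (push A σ m) ∘ₗ (tupleSd n _) from congr($h c a)
  ext v a : 4
  have h : tupleMap (affine v) _ (vertexTuple m) = .single v 1 := by
    rw [vertexTuple, tupleMap_single]
    congr 1
    ext i : 1
    exact affine_vertex _ _
  simp [subdivision, push_comp_affine, tupleMap_tupleSd, h]

theorem subdivisionHtpy_push {n : ℕ} (σ : C(Simplex n, X)) {m : ℕ}
    (c : TupleChain (Simplex n) (m + 1)) (a : A) :
    subdivisionHtpy A X (push A σ m c a) = push A σ (m + 1) (tupleHtpy n _ c) a := by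
  suffices h : ((AddMonoidHom.compHom (subdivisionHtpy A X)).toIntLinearMap) ∘ₗ (push A σ m) =
      (push A σ (m + 1)) ∘ₗ (tupleHtpy n _) from congr($h c a)
  ext v a : 4
  have h : tupleMap (affine v) _ (vertexTuple m) = .single v 1 := by
    rw [vertexTuple, tupleMap_single]
    congr 1
    ext i : 1
    exact affine_vertex _ _
  simp [subdivisionHtpy, push_comp_affine, tupleMap_tupleHtpy, h]

theorem subdivision_iterate_push {n : ℕ} (σ : C(Simplex n, X)) {m : ℕ}
    (c : TupleChain (Simplex n) (m + 1)) (a : A) (k : ℕ) :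
    (subdivision A X)^[k] (push A σ m c a) = push A σ m ((tupleSd n _)^[k] c) a := by
  induction k with
  | zero => rfl
  | succ k ih =>
    rw [Function.iterate_succ_apply', ih, subdivision_push, Function.iterate_succ_apply']

theorem chain_induction {p : Chain A X → Prop} (hz : p 0) (ha : ∀ c c', p c → p c' → p (c + c'))
    (hs : ∀ n (σ : C(Simplex n, X)) a, p (.single ⟨n, σ⟩ a)) (c : Chain A X) : p c :=
  Finsupp.induction_linear c hz ha fun s a => hs s.1 s.2 a

theorem chainMap_subdivision {Y : Type*} [TopologicalSpace Y] (f : C(X, Y)) (c : Chain A X) :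
    chainMap A f (subdivision A X c) = subdivision A Y (chainMap A f c) := by
  have h {n : ℕ} (σ : C(Simplex n, X)) {m : ℕ} (t : TupleChain (Simplex n) (m + 1)) (a : A) :
      chainMap A f (push A σ m t a) = push A (f.comp σ) m t a := by
    suffices h : ((AddMonoidHom.compHom (chainMap A f)).toIntLinearMap) ∘ₗ (push A σ m) =
        push A (f.comp σ) m from congr($h t a)
    ext v a : 4
    simp [ContinuousMap.comp_assoc]
  induction c using chain_induction with
  | hz => simp
  | ha c c' h h' => simp only [map_add, h, h']
  | hs n σ a =>
    rw [← push_vertexTuple, subdivision_push, h, h, subdivision_push]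

theorem boundary_subdivision (c : Chain A X) :
    boundary A X (subdivision A X c) = subdivision A X (boundary A X c) := by
  induction c using chain_induction with
  | hz => simp
  | ha c c' h h' => simp only [map_add, h, h']
  | hs n σ a =>
    rw [← push_vertexTuple, subdivision_push]
    cases n with
    | zero => rw [boundary_push_zero, boundary_push_zero, map_zero]
    | succ n => rw [boundary_push_succ, boundary_push_succ, subdivision_push, tupleBoundary_tupleSd]

theorem subdivisionHtpy_spec (c : Chain A X) :
    c = subdivision A X c + (boundary A X (subdivisionHtpy A X c) +
      subdivisionHtpy A X (boundary A X c)) := by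
  induction c using chain_induction with
  | hz => simp
  | ha c c' h h' =>
    simp only [map_add]
    nth_rw 1 [h, h']
    abel
  | hs n σ a =>
    rw [← push_vertexTuple, subdivision_push, subdivisionHtpy_push, boundary_push_succ]
    cases n with
    | zero =>
      rw [boundary_push_zero, map_zero, add_zero, tupleBoundary_tupleHtpy_zero, map_sub,
        AddMonoidHom.sub_apply]
      abel
    | succ n =>
      rw [boundary_push_succ, subdivisionHtpy_push, ← AddMonoidHom.add_apply, ← map_add,
        tupleBoundary_tupleHtpy, map_sub, AddMonoidHom.sub_apply]
      abel

theorem subdivision_mem_chainsIn {S : Set X} {c : Chain A X} (hc : c ∈ chainsIn A S) :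
    subdivision A X c ∈ chainsIn A S := by
  have : chainsIn A S ≤ (chainsIn A S).comap (subdivision A X) :=
    chainsIn_le_iff.2 fun n σ h a => by
      rw [AddSubgroup.mem_comap, ← push_vertexTuple, subdivision_push]
      exact push_mem_chainsIn h _ _
  exact this hc

theorem subdivision_mem_chainsDeg {m : ℤ} {c : Chain A X} (hc : c ∈ chainsDeg A X m) :
    subdivision A X c ∈ chainsDeg A X m := by
  have : chainsDeg A X m ≤ (chainsDeg A X m).comap (subdivision A X) :=
    chainsDeg_le_iff.2 fun n h σ a => by
      rw [AddSubgroup.mem_comap, ← push_vertexTuple, subdivision_push]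
      exact push_mem_chainsDeg _ h _ _
  exact this hc

theorem subdivisionHtpy_mem_chainsIn {S : Set X} {c : Chain A X} (hc : c ∈ chainsIn A S) :
    subdivisionHtpy A X c ∈ chainsIn A S := by
  have : chainsIn A S ≤ (chainsIn A S).comap (subdivisionHtpy A X) :=
    chainsIn_le_iff.2 fun n σ h a => by
      rw [AddSubgroup.mem_comap, ← push_vertexTuple, subdivisionHtpy_push]
      exact push_mem_chainsIn h _ _
  exact this hc

theorem subdivisionHtpy_mem_chainsDeg {m : ℤ} {c : Chain A X} (hc : c ∈ chainsDeg A X m) :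
    subdivisionHtpy A X c ∈ chainsDeg A X (m + 1) := by
  have : chainsDeg A X m ≤ (chainsDeg A X (m + 1)).comap (subdivisionHtpy A X) :=
    chainsDeg_le_iff.2 fun n h σ a => by
      rw [AddSubgroup.mem_comap, ← push_vertexTuple, subdivisionHtpy_push]
      exact push_mem_chainsDeg _ (by rw [← h]; push_cast; rfl) _ _
  exact this hc

theorem subdivision_iterate_mem_chainsIn {S : Set X} {c : Chain A X} (hc : c ∈ chainsIn A S)
    (k : ℕ) : (subdivision A X)^[k] c ∈ chainsIn A S := by
  induction k with
  | zero => exact hc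
  | succ k ih => rw [Function.iterate_succ_apply']; exact subdivision_mem_chainsIn ih

theorem subdivision_iterate_mem_chainsDeg {m : ℤ} {c : Chain A X} (hc : c ∈ chainsDeg A X m)
    (k : ℕ) : (subdivision A X)^[k] c ∈ chainsDeg A X m := by
  induction k with
  | zero => exact hc
  | succ k ih => rw [Function.iterate_succ_apply']; exact subdivision_mem_chainsDeg ih

theorem boundary_subdivision_iterate (c : Chain A X) (k : ℕ) :
    boundary A X ((subdivision A X)^[k] c) = (subdivision A X)^[k] (boundary A X c) := by
  induction k with
  | zero => rfl
  | succ k ih => rw [Function.iterate_succ_apply', boundary_subdivision, ih,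
      Function.iterate_succ_apply']

theorem subdivision_iterate_add (c c' : Chain A X) (k : ℕ) :
    (subdivision A X)^[k] (c + c') = (subdivision A X)^[k] c + (subdivision A X)^[k] c' :=
  iterate_map_add _ _ _ _

/-- Iterated subdivision is chain homotopic to the identity, by a homotopy that preserves
the chains in each subset. -/
theorem exists_subdivision_iterate_htpy (k : ℕ) : ∃ T : Chain A X →+ Chain A X,
    (∀ c, c = (subdivision A X)^[k] c + (boundary A X (T c) + T (boundary A X c))) ∧
    (∀ S : Set X, ∀ c ∈ chainsIn A S, T c ∈ chainsIn A S) ∧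
    ∀ m, ∀ c ∈ chainsDeg A X m, T c ∈ chainsDeg A X (m + 1) := by
  induction k with
  | zero => exact ⟨0, fun c => by simp, fun _ _ _ => zero_mem _, fun _ _ _ => zero_mem _⟩
  | succ k ih =>
    obtain ⟨T, h1, h2, h3⟩ := ih
    refine ⟨T + (subdivisionHtpy A X).comp (AddMonoidHom.mk' (subdivision A X)^[k]
      fun c c' => subdivision_iterate_add c c' k), fun c => ?_, fun S c hc => ?_, fun m c hc => ?_⟩
    · have h4 := h1 c
      have h5 := subdivisionHtpy_spec ((subdivision A X)^[k] c)
      rw [← Function.iterate_succ_apply' (⇑(subdivision A X)), boundary_subdivision_iterate] at h5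
      nth_rw 1 [h4]
      nth_rw 1 [h5]
      simp only [AddMonoidHom.add_apply, map_add, AddMonoidHom.comp_apply, AddMonoidHom.mk'_apply]
      abel
    · exact add_mem (h2 S c hc)
        (subdivisionHtpy_mem_chainsIn (subdivision_iterate_mem_chainsIn hc k))
    · exact add_mem (h3 m c hc)
        (subdivisionHtpy_mem_chainsDeg (subdivision_iterate_mem_chainsDeg hc k))

/-! ### Small chains and excision -/

/-- A push-forward of small tuples consists of simplices in `U` and simplices in `V`, if all
sufficiently small balls lie in the preimage of one of these sets. -/
theorem push_mem_sup {n : ℕ} {σ : C(Simplex n, X)} {U V : Set X} {δ : ℝ}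
    (hδ : ∀ x, Metric.ball x δ ⊆ σ ⁻¹' U ∨ Metric.ball x δ ⊆ σ ⁻¹' V) {m : ℕ} {d : ℝ} (hd : d < δ)
    {c : TupleChain (Simplex n) (m + 1)} (hc : c ∈ smallTuples n (m + 1) d) (a : A) :
    push A σ m c a ∈ chainsIn A U ⊔ chainsIn A V := by
  rw [push, Finsupp.linearCombination_apply, Finsupp.sum, AddMonoidHom.finsetSum_apply]
  refine sum_mem fun v hv => zsmul_mem ?_ _
  have hv' : ∀ i j, dist (v i) (v j) ≤ d := (Finsupp.mem_supported ℤ _).1 hc hv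
  have hball (t) : affine v t ∈ Metric.ball (v 0) δ :=
    (dist_affine_le_of_forall t fun i => hv' i 0).trans_lt hd
  rcases hδ (v 0) with h | h
  · exact AddSubgroup.mem_sup_left
      (single_mem_chainsIn (σ := σ.comp (affine v)) (fun t => h (hball t)) _)
  · exact AddSubgroup.mem_sup_right
      (single_mem_chainsIn (σ := σ.comp (affine v)) (fun t => h (hball t)) _)

theorem vertexTuple_mem_smallTuples (n : ℕ) : vertexTuple n ∈ smallTuples n (n + 1) 1 := by
  refine Finsupp.single_mem_supported _ _ fun i j => ?_
  exact (Metric.dist_le_diam_of_mem (bounded_stdSimplex _) (stdSimplex.vertex i).2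
    (stdSimplex.vertex j).2).trans diam_stdSimplex_le

/-- Sufficiently fine subdivisions of a chain are sums of chains in the members of an open
cover. -/
theorem exists_subdivision_iterate_mem {U V : Set X} (hU : IsOpen U) (hV : IsOpen V)
    (hUV : U ∪ V = Set.univ) (c : Chain A X) :
    ∃ k, (subdivision A X)^[k] c ∈ chainsIn A U ⊔ chainsIn A V := by
  suffices h : ∃ k₀, ∀ k ≥ k₀, (subdivision A X)^[k] c ∈ chainsIn A U ⊔ chainsIn A V from
    ⟨h.choose, h.choose_spec _ le_rfl⟩
  induction c using chain_induction with
  | hz => exact ⟨0, fun k _ => by rw [iterate_map_zero]; exact zero_mem _⟩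
  | ha c c' h h' =>
    obtain ⟨k, hk⟩ := h
    obtain ⟨k', hk'⟩ := h'
    refine ⟨max k k', fun l hl => ?_⟩
    rw [subdivision_iterate_add]
    exact add_mem (hk _ (le_of_max_le_left hl)) (hk' _ (le_of_max_le_right hl))
  | hs n σ a =>
    obtain ⟨δ, hδ, hball⟩ := lebesgue_number_lemma_of_metric
      (s := (Set.univ : Set (Simplex n))) (c := fun b : Bool => σ ⁻¹' (bif b then U else V))
      isCompact_univ (by rintro (_ | _) <;> exact IsOpen.preimage σ.continuous ‹_›)
      (fun x _ => by
        rcases (hUV ▸ Set.mem_univ (σ x) : σ x ∈ U ∪ V) with h | h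
        · exact Set.mem_iUnion.2 ⟨true, h⟩
        · exact Set.mem_iUnion.2 ⟨false, h⟩)
    have hq : (n : ℝ) / (n + 1) < 1 := by rw [div_lt_one (by positivity)]; linarith
    obtain ⟨k₀, hk₀⟩ := exists_pow_lt_of_lt_one hδ hq
    refine ⟨k₀, fun k hk => ?_⟩
    rw [← push_vertexTuple, subdivision_iterate_push]
    refine push_mem_sup (δ := δ) (fun x => ?_) ?_
      (tupleSd_iterate_mem_smallTuples zero_le_one (vertexTuple_mem_smallTuples n) k) a
    · obtain ⟨b, hb⟩ := hball x trivial
      cases b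
      · exact Or.inr hb
      · exact Or.inl hb
    · rw [mul_one]
      exact (pow_le_pow_of_le_one (by positivity) hq.le hk).trans_lt hk₀

theorem exists_add_of_mem_sup {U V : Set X} {n : ℤ} {c : Chain A X}
    (hc : c ∈ chainsIn A U ⊔ chainsIn A V) (hn : c ∈ chainsDeg A X n) :
    ∃ a ∈ chainsIn A U, a ∈ chainsDeg A X n ∧ ∃ b ∈ chainsIn A V, b ∈ chainsDeg A X n ∧
      c = a + b := by
  have h : c ∈ chainsOf A (({s : SingularSimplex X | Set.range s.2 ⊆ U} ∪
      {s | Set.range s.2 ⊆ V}) ∩ {s | (s.1 : ℤ) = n}) := by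
    rw [chainsOf_inter, chainsOf_union]
    exact ⟨hc, hn⟩
  rw [Set.union_inter_distrib_right, chainsOf_union, chainsOf_inter, chainsOf_inter] at h
  obtain ⟨a, ⟨ha, ha'⟩, b, ⟨hb, hb'⟩, rfl⟩ := AddSubgroup.mem_sup.1 h
  exact ⟨a, ha, ha', b, hb, hb', rfl⟩

/-- Excision: the homology of a space relative to an open subset `U` is not changed if the space
is replaced by an open subset that together with `U` covers it. -/
theorem relMap_bijective_of_isOpenEmbedding {V : Type*} [TopologicalSpace V] {ι : C(V, X)}
    (hι : Topology.IsOpenEmbedding ι) {U : Set X} (hU : IsOpen U) (hUV : U ∪ Set.range ι = Set.univ)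
    (n : ℤ) :
    Function.Bijective (relMap (A := A) ι (Set.mapsTo_preimage ι U) n) := by
  have hemb : Topology.IsEmbedding ι := hι.isEmbedding
  have hV : IsOpen (Set.range ι) := hι.isOpen_range
  have hpre (S : Set X) (c : Chain A V) (h : chainMap A ι c ∈ chainsIn A S) :
      c ∈ chainsIn A (ι ⁻¹' S) := mem_chainsIn_of_chainMap hemb.injective h
  constructor
  · rw [injective_iff_map_eq_zero]
    intro x hx
    obtain ⟨⟨a, ha⟩, rfl⟩ := Subquotient.mk_surjective _ _ x
    rw [relMap_mk, Subquotient.mk_eq_zero_iff] at hx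
    obtain ⟨u, hu, hu', e, he, hue⟩ := mem_relBoundaries.1 hx
    rw [Subquotient.mk_eq_zero_iff]
    -- after subdivision, `e` is the sum of a chain `e₂` in `U` and the image of a chain `b`, and
    -- subtracting the boundary of `b` from the subdivision of `a` leaves a chain in `U`
    obtain ⟨k, hk⟩ := exists_subdivision_iterate_mem hU hV hUV e
    obtain ⟨e₂, h2, h2', e₁, h1, h1', he12⟩ :=
      exists_add_of_mem_sup hk (subdivision_iterate_mem_chainsDeg he k)
    obtain ⟨T, hT, hTin, hTdeg⟩ := exists_subdivision_iterate_htpy (A := A) (X := V) k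
    obtain ⟨b, -, hb, hbe⟩ := exists_chainMap_eq hemb le_rfl h1 h1'
    have hsd (c : Chain A V) : chainMap A ι ((subdivision A V)^[k] c) =
        (subdivision A X)^[k] (chainMap A ι c) :=
      (Function.Semiconj.iterate_right (f := chainMap A ι) (chainMap_subdivision ι) k) c
    refine mem_relBoundaries.2 ⟨a - boundary A V (T a + b), ?_, ?_, T a + b,
      add_mem (hTdeg _ _ ha.1) hb, by abel⟩
    · rw [map_add, ← sub_sub]
      have : a - boundary A V (T a) - boundary A V b =
          ((subdivision A V)^[k] a - boundary A V b) + T (boundary A V a) := by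
        nth_rw 1 [hT a]
        abel
      rw [this]
      refine add_mem (hpre _ _ ?_) (hTin _ _ ha.2)
      have h3 : chainMap A ι ((subdivision A V)^[k] a - boundary A V b) =
          (subdivision A X)^[k] u + boundary A X e₂ := by
        rw [map_sub, hsd, ← boundary_chainMap, hbe]
        change (subdivision A X)^[k] (chainMap A ι a) - _ = _
        rw [show chainMap A ι a = _ from hue, subdivision_iterate_add,
          ← boundary_subdivision_iterate, he12, map_add]
        abel
      rw [h3]
      exact add_mem (subdivision_iterate_mem_chainsIn hu k) (boundary_mem_chainsIn h2)
    · refine sub_mem ha.1 ?_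
      have := boundary_mem_chainsDeg (add_mem (hTdeg _ _ ha.1) hb)
      rwa [add_sub_cancel_right] at this
  · intro x
    obtain ⟨⟨c, hc⟩, rfl⟩ := Subquotient.mk_surjective _ _ x
    -- a subdivision of `c` represents the same class, and its part in `U` can be dropped
    obtain ⟨k, hk⟩ := exists_subdivision_iterate_mem hU hV hUV c
    obtain ⟨b, hb, hb', a, ha, ha', hab⟩ :=
      exists_add_of_mem_sup hk (subdivision_iterate_mem_chainsDeg hc.1 k)
    obtain ⟨T, hT, hTin, hTdeg⟩ := exists_subdivision_iterate_htpy (A := A) (X := X) k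
    obtain ⟨a', -, hadeg, rfl⟩ := exists_chainMap_eq hemb le_rfl ha ha'
    refine ⟨Subquotient.mk _ _ ⟨a', mem_relCycles.2 ⟨hadeg, hpre _ _ ?_⟩⟩, ?_⟩
    · rw [← boundary_chainMap, ← sub_eq_iff_eq_add'.2 hab, map_sub, boundary_subdivision_iterate]
      exact sub_mem (subdivision_iterate_mem_chainsIn hc.2 k) (boundary_mem_chainsIn hb)
    · rw [relMap_mk]
      refine (Subquotient.mk_eq_mk_iff _ _).2 (mem_relBoundaries.2
        ⟨-(b + T (boundary A X c)), neg_mem (add_mem hb (hTin _ _ hc.2)), ?_, -T c,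
          neg_mem (hTdeg _ _ hc.1), ?_⟩)
      · have := hTdeg _ _ (boundary_mem_chainsDeg hc.1)
        rw [sub_add_cancel] at this
        exact neg_mem (add_mem hb' this)
      · change chainMap A ι a' - c = _
        nth_rw 1 [hT c]
        rw [hab, map_neg]
        abel

end SingularSubdivision

/-! ### Collars and relative homeomorphisms -/

/-- A deformation of a space into itself, relative to a closed subset `S`, at the end of which an
open neighbourhood of `S` has been moved into `S`. -/
structure Collar {Y : Type*} [TopologicalSpace Y] (S : Set Y) where
  isClosed : IsClosed S
  /-- The neighbourhood of `S`. -/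
  nhd : Set Y
  isOpen_nhd : IsOpen nhd
  subset_nhd : S ⊆ nhd
  /-- The deformation. -/
  h : C(unitInterval × Y, Y)
  h_zero (y : Y) : h (0, y) = y
  h_of_mem (t : unitInterval) {y : Y} (hy : y ∈ S) : h (t, y) = y
  h_mem_nhd (t : unitInterval) {y : Y} (hy : y ∈ nhd) : h (t, y) ∈ nhd
  h_one_mem {y : Y} (hy : y ∈ nhd) : h (1, y) ∈ S

section

variable {A : Type u} [AddCommGroup A]

/-- A cycle in `T` is homologous, in `T`, to its image at the end of a deformation that
preserves `T`. -/
theorem exists_eq_chainMap_add_boundary {Y : Type u} [TopologicalSpace Y] {T : Set Y}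
    (h : C(unitInterval × Y, Y)) (h_zero : ∀ y, h (0, y) = y) (hT : ∀ t, ∀ y ∈ T, h (t, y) ∈ T)
    {h₁ : C(Y, Y)} (h_one : ∀ y, h₁ y = h (1, y)) {n : ℤ} {z : Chain A Y}
    (hz : z ∈ chainsIn A T) (hn : z ∈ chainsDeg A Y n) (hz' : boundary A Y z = 0) :
    ∃ e ∈ chainsIn A T, e ∈ chainsDeg A Y (n + 1) ∧
      z = chainMap A h₁ z + boundary A Y e := by
  let ι : C(T, Y) := ⟨Subtype.val, continuous_subtype_val⟩
  have hemb : Topology.IsEmbedding ι := Topology.IsEmbedding.subtypeVal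
  obtain ⟨w, -, hwn, rfl⟩ := exists_chainMap_eq hemb (T := T) Subtype.range_coe.ge hz hn
  let H : C(unitInterval × T, T) := ⟨fun x => ⟨h (x.1, x.2.1), hT _ _ x.2.2⟩, by fun_prop⟩
  let g : C(T, T) := ⟨fun x => H (1, x), by fun_prop⟩
  have hid : (ContinuousMap.id T).Homotopic g :=
    ⟨{ H with
        map_zero_left := fun x => Subtype.ext (h_zero x.1)
        map_one_left := fun x => rfl }⟩
  have hw : boundary A T w = 0 := by
    rw [boundary_chainMap] at hz'
    exact chainMap_injective hemb.injective (hz'.trans (map_zero _).symm)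
  obtain ⟨b, hb, hwb⟩ := exists_boundary_of_homotopic hid hwn hw
  refine ⟨chainMap A ι b, chainMap_mem_chainsIn (S := Set.univ) (fun x _ => x.2)
    (by rw [chainsIn_univ]; trivial), chainMap_mem_chainsDeg _ hb, ?_⟩
  rw [chainMap_id] at hwb
  nth_rw 1 [hwb]
  rw [map_add, boundary_chainMap, ← chainMap_comp, ← chainMap_comp]
  congr 3
  ext x : 1
  exact (h_one _).symm

theorem chainMap_eq_self {Y : Type*} [TopologicalSpace Y] {S : Set Y} {f : C(Y, Y)}
    (hf : ∀ y ∈ S, f y = y) {c : Chain A Y} (hc : c ∈ chainsIn A S) : chainMap A f c = c := by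
  have : chainsIn A S ≤ (chainMap A f).eqLocus (.id _) := chainsIn_le_iff.2 fun n σ hσ a => by
    change chainMap A f _ = _
    rw [chainMap_single]
    congr 2
    ext x
    exact hf _ (hσ x)
  exact this hc

theorem Collar.mapsTo_id {Y : Type*} [TopologicalSpace Y] {S : Set Y} (κ : Collar S) :
    Set.MapsTo (ContinuousMap.id Y) S κ.nhd := κ.subset_nhd

/-- The homology relative to a collared subset agrees with the homology relative to the
neighbourhood. -/
theorem Collar.relMap_id_bijective {Y : Type u} [TopologicalSpace Y] {S : Set Y} (κ : Collar S)
    (n : ℤ) :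
    Function.Bijective (relMap (A := A) (ContinuousMap.id Y) κ.mapsTo_id n) := by
  let h₁ : C(Y, Y) := ⟨fun y => κ.h (1, y), by fun_prop⟩
  -- a cycle in the neighbourhood is homologous, in the neighbourhood, to a cycle in `S`
  have push_in {m : ℤ} {z : Chain A Y} (hz : z ∈ chainsIn A κ.nhd) (hm : z ∈ chainsDeg A Y m)
      (hz' : boundary A Y z = 0) : ∃ e ∈ chainsIn A κ.nhd, e ∈ chainsDeg A Y (m + 1) ∧
        ∃ b ∈ chainsIn A S, b ∈ chainsDeg A Y m ∧ z = b + boundary A Y e := by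
    obtain ⟨e, he, he', hze⟩ := exists_eq_chainMap_add_boundary κ.h κ.h_zero
      (fun t y hy => κ.h_mem_nhd t hy) (h₁ := h₁) (fun _ => rfl) hz hm hz'
    exact ⟨e, he, he', _, chainMap_mem_chainsIn (fun y hy => κ.h_one_mem hy) hz,
      chainMap_mem_chainsDeg _ hm, hze⟩
  constructor
  · rw [injective_iff_map_eq_zero]
    intro x hx
    obtain ⟨⟨c, hc⟩, rfl⟩ := Subquotient.mk_surjective _ _ x
    rw [relMap_mk, Subquotient.mk_eq_zero_iff] at hx
    rw [Subquotient.mk_eq_zero_iff]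
    obtain ⟨w, hw, hw', e, he, hwe⟩ := mem_relBoundaries.1 hx
    replace hwe : c = w + boundary A Y e := (chainMap_id c).symm.trans hwe
    have hcw : boundary A Y w = boundary A Y c := by
      rw [hwe, map_add, boundary_boundary, add_zero]
    have hb := chainMap_mem_chainsIn (f := h₁) (fun y hy => κ.h_one_mem hy) hw
    have hcyc : boundary A Y (w - chainMap A h₁ w) = 0 := by
      rw [map_sub, boundary_chainMap, hcw, chainMap_eq_self (fun y hy => κ.h_of_mem 1 hy) hc.2,
        sub_self]
    have hdeg := chainMap_mem_chainsDeg h₁ hw'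
    obtain ⟨e', -, he', b', hb', hb'', hwb⟩ :=
      push_in (sub_mem hw (chainsIn_mono κ.subset_nhd hb)) (sub_mem hw' hdeg) hcyc
    refine mem_relBoundaries.2 ⟨chainMap A h₁ w + b', add_mem hb hb', add_mem hdeg hb'', e + e',
      add_mem he he', ?_⟩
    calc c = chainMap A h₁ w + (w - chainMap A h₁ w) + boundary A Y e := by rw [hwe]; abel
      _ = _ := by rw [hwb, map_add]; abel
  · intro x
    obtain ⟨⟨c, hc⟩, rfl⟩ := Subquotient.mk_surjective _ _ x
    obtain ⟨e, he, he', b, hb, -, hcb⟩ :=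
      push_in hc.2 (boundary_mem_chainsDeg hc.1) (boundary_boundary c)
    rw [sub_add_cancel] at he'
    refine ⟨Subquotient.mk _ _ ⟨c - e, mem_relCycles.2 ⟨sub_mem hc.1 he', ?_⟩⟩, ?_⟩
    · rwa [map_sub, hcb, add_sub_cancel_right]
    · rw [relMap_mk]
      refine (Subquotient.mk_eq_mk_iff _ _).2 (mem_relBoundaries.2
        ⟨-e, neg_mem he, neg_mem he', 0, zero_mem _, ?_⟩)
      change chainMap A (.id Y) (c - e) - c = _
      rw [chainMap_id, map_zero]
      abel

theorem relMap_bijective_congr {X Y : Type*} [TopologicalSpace X] [TopologicalSpace Y] {f : C(X, Y)}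
    {S S' : Set X} {T : Set Y} (h : S = S') (hS : Set.MapsTo f S T) (hS' : Set.MapsTo f S' T)
    (n : ℤ) (hb : Function.Bijective (relMap (A := A) f hS n)) :
    Function.Bijective (relMap (A := A) f hS' n) := by
  subst h
  exact hb

/-- The map on the target of a relative homeomorphism that corresponds to a map on the source: it
fixes the points of `B`, and a point outside `B` is moved as its preimage under `f` is. -/
def extend {D Y : Type*} (f : D → Y) (B : Set Y) (k : D → D) (y : Y) : Y :=
  open Classical in if h : y ∉ B ∧ ∃ x, f x = y then f (k h.2.choose) else y

theorem extend_of_mem {D Y : Type*} {B : Set Y} (f : D → Y) (k : D → D) {y : Y} (hy : y ∈ B) :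
    extend f B k y = y :=
  dif_neg fun h => h.1 hy

/-- A map `f : D → Y` that maps `D \ S` bijectively onto `Y \ B`, such that `Y` carries the quotient
topology of the disjoint union of `D` and `B`. -/
structure IsRelHomeo {D Y : Type*} [TopologicalSpace D] [TopologicalSpace Y] (f : C(D, Y))
    (S : Set D) (B : Set Y) : Prop where
  isClosed : IsClosed B
  preimage : f ⁻¹' B = S
  injOn : Set.InjOn f Sᶜ
  compl_subset : Bᶜ ⊆ Set.range f
  isClosed_of_preimage (T : Set Y) : IsClosed (T ∩ B) → IsClosed (f ⁻¹' T) → IsClosed T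

namespace IsRelHomeo

variable {D Y : Type u} [TopologicalSpace D] [TopologicalSpace Y] {f : C(D, Y)} {S : Set D}
  {B : Set Y}

theorem mem_iff (hf : IsRelHomeo f S B) {x : D} : f x ∈ B ↔ x ∈ S := by
  rw [← hf.preimage]
  rfl

theorem mapsTo (hf : IsRelHomeo f S B) : Set.MapsTo f S B := fun _ hx => hf.mem_iff.2 hx

theorem eq_of_notMem (hf : IsRelHomeo f S B) {x y : D} (hx : x ∉ S) (h : f y = f x) : y = x :=
  hf.injOn (fun hy => hx (hf.mem_iff.1 (h ▸ hf.mem_iff.2 hy))) hx h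

theorem isQuotientMap (hf : IsRelHomeo f S B) :
    Topology.IsQuotientMap (Sum.elim f (Subtype.val : B → Y)) := by
  rw [Topology.isQuotientMap_iff_isClosed]
  refine ⟨fun y => ?_, fun T => ⟨fun hT => hT.preimage (by fun_prop), fun hT => ?_⟩⟩
  · by_cases hy : y ∈ B
    · exact ⟨.inr ⟨y, hy⟩, rfl⟩
    · obtain ⟨x, hx⟩ := hf.compl_subset hy
      exact ⟨.inl x, hx⟩
  · rw [isClosed_sum_iff] at hT
    refine hf.isClosed_of_preimage T ?_ hT.1
    have := hf.isClosed.isClosedEmbedding_subtypeVal.isClosedMap _ hT.2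
    convert this using 1
    rw [← Set.preimage_comp, Sum.elim_comp_inr, Subtype.image_preimage_coe, Set.inter_comm]

theorem extend_apply (hf : IsRelHomeo f S B) {k : D → D} (hk : ∀ x ∈ S, k x = x) (x : D) :
    extend f B k (f x) = f (k x) := by
  by_cases hx : x ∈ S
  · rw [extend_of_mem _ _ (hf.mapsTo hx), hk x hx]
  · have h : f x ∉ B ∧ ∃ x', f x' = f x := ⟨fun h => hx (hf.mem_iff.1 h), x, rfl⟩
    rw [extend, dif_pos h, hf.eq_of_notMem hx h.2.choose_spec]

/-- The deformation of the target of a relative homeomorphism that corresponds to the deformation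
of a collar in the source. -/
def extendHtpy (hf : IsRelHomeo f S B) (κ : Collar S) : C(unitInterval × Y, Y) where
  toFun x := extend f B (fun d => κ.h (x.1, d)) x.2
  continuous_toFun := by
    -- the unit interval is locally compact, so its product with a quotient map is one too
    refine hf.isQuotientMap.continuous_lift_prod_right ?_
    rw [← (Homeomorph.prodSumDistrib (X := unitInterval) (Y := D)
      (Z := B)).symm.comp_continuous_iff']
    refine continuous_sum_dom.2 ⟨?_, ?_⟩
    · refine (show Continuous fun x : unitInterval × D => f (κ.h x) by fun_prop).congr fun x => ?_
      exact (hf.extend_apply (fun _ h => κ.h_of_mem x.1 h) x.2).symm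
    · refine (show Continuous fun x : unitInterval × B => (x.2 : Y) by fun_prop).congr fun x => ?_
      exact (extend_of_mem f (fun d => κ.h (x.1, d)) x.2.2).symm

theorem extendHtpy_of_mem (hf : IsRelHomeo f S B) (κ : Collar S) (t : unitInterval) {y : Y}
    (hy : y ∈ B) : hf.extendHtpy κ (t, y) = y :=
  extend_of_mem f (fun d => κ.h (t, d)) hy

theorem extendHtpy_apply (hf : IsRelHomeo f S B) (κ : Collar S) (t : unitInterval) (x : D) :
    hf.extendHtpy κ (t, f x) = f (κ.h (t, x)) :=
  hf.extend_apply (fun _ h => κ.h_of_mem t h) x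

theorem preimage_nhd (hf : IsRelHomeo f S B) (κ : Collar S) :
    f ⁻¹' (B ∪ f '' κ.nhd) = κ.nhd := by
  ext x
  constructor
  · rintro (h | ⟨x', hx', h⟩)
    · exact κ.subset_nhd (hf.mem_iff.1 h)
    · by_cases hx : x ∈ S
      · exact κ.subset_nhd hx
      · rwa [← hf.eq_of_notMem hx h]
  · exact fun h => Or.inr ⟨x, h, rfl⟩

/-- The collar in the target of a relative homeomorphism. -/
def collar (hf : IsRelHomeo f S B) (κ : Collar S) : Collar B where
  isClosed := hf.isClosed
  nhd := B ∪ f '' κ.nhd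
  isOpen_nhd := by
    rw [← isClosed_compl_iff]
    refine hf.isClosed_of_preimage _ ?_ ?_
    · convert isClosed_empty
      ext y
      simp only [Set.mem_inter_iff, Set.mem_compl_iff, Set.mem_union, Set.mem_empty_iff_false]
      tauto
    · rw [Set.preimage_compl, hf.preimage_nhd]
      exact κ.isOpen_nhd.isClosed_compl
  subset_nhd := Set.subset_union_left
  h := hf.extendHtpy κ
  h_zero y := by
    by_cases hy : y ∈ B
    · exact hf.extendHtpy_of_mem κ 0 hy
    · obtain ⟨x, rfl⟩ := hf.compl_subset hy
      rw [hf.extendHtpy_apply, κ.h_zero]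
  h_of_mem t y hy := hf.extendHtpy_of_mem κ t hy
  h_mem_nhd t y hy := by
    rcases hy with hy | ⟨x, hx, rfl⟩
    · rw [hf.extendHtpy_of_mem κ t hy]
      exact Or.inl hy
    · rw [hf.extendHtpy_apply]
      exact Or.inr ⟨_, κ.h_mem_nhd t hx, rfl⟩
  h_one_mem {y} hy := by
    rcases hy with hy | ⟨x, hx, rfl⟩
    · rwa [hf.extendHtpy_of_mem κ 1 hy]
    · rw [hf.extendHtpy_apply]
      exact hf.mapsTo (κ.h_one_mem hx)

theorem isOpenEmbedding (hf : IsRelHomeo f S B) (hS : IsClosed S) :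
    Topology.IsOpenEmbedding fun x : (Sᶜ : Set D) => f x := by
  refine .of_continuous_injective_isOpenMap (by fun_prop)
    (fun x y h => Subtype.ext (hf.injOn x.2 y.2 h)) fun W hW => ?_
  obtain ⟨V, hV, rfl⟩ := isOpen_induced_iff.1 hW
  have himg : (fun x : (Sᶜ : Set D) => f x) '' (Subtype.val ⁻¹' V) = f '' (V ∩ Sᶜ) := by
    rw [← Function.comp_def, Set.image_comp, Subtype.image_preimage_coe, Set.inter_comm]
  rw [himg, ← isClosed_compl_iff]
  have hpre : f ⁻¹' (f '' (V ∩ Sᶜ)) = V ∩ Sᶜ := by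
    refine (Set.subset_preimage_image _ _).antisymm' ?_
    rintro x ⟨x', ⟨hx', hxS'⟩, h⟩
    rw [hf.eq_of_notMem hxS' h.symm]
    exact ⟨hx', hxS'⟩
  refine hf.isClosed_of_preimage _ ?_ ?_
  · convert hf.isClosed
    refine Set.inter_eq_right.2 ?_
    rintro y hy ⟨x, hx, rfl⟩
    exact hx.2 (hf.mem_iff.1 hy)
  · rw [Set.preimage_compl, hpre]
    exact (hV.inter hS.isOpen_compl).isClosed_compl

/-- A relative homeomorphism whose source is collared induces isomorphisms of relative homology
groups. -/
theorem relMap_bijective (hf : IsRelHomeo f S B) (κ : Collar S) (n : ℤ) :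
    Function.Bijective (relMap (A := A) f hf.mapsTo n) := by
  obtain ⟨κ', hκ'⟩ : ∃ κ' : Collar B, f ⁻¹' κ'.nhd = κ.nhd := ⟨hf.collar κ, hf.preimage_nhd κ⟩
  let j : C((Sᶜ : Set D), D) := ⟨Subtype.val, continuous_subtype_val⟩
  have hj : Topology.IsOpenEmbedding j := κ.isClosed.isOpen_compl.isOpenEmbedding_subtypeVal
  have hU : Set.MapsTo f κ.nhd κ'.nhd := hκ'.ge
  -- the vertical maps of the excision square are isomorphisms
  have h1 := relMap_bijective_of_isOpenEmbedding (A := A) hj κ.isOpen_nhd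
    (Set.eq_univ_of_forall fun x => by
      by_cases hx : x ∈ S
      · exact Or.inl (κ.subset_nhd hx)
      · exact Or.inr ⟨⟨x, hx⟩, rfl⟩) n
  have h2 : Function.Bijective
      (relMap (A := A) (f.comp j) (hU.comp (Set.mapsTo_preimage j κ.nhd)) n) := by
    have h := relMap_bijective_of_isOpenEmbedding (A := A) (ι := f.comp j)
      (hf.isOpenEmbedding κ.isClosed) κ'.isOpen_nhd (Set.eq_univ_of_forall fun y => by
        by_cases hy : y ∈ B
        · exact Or.inl (κ'.subset_nhd hy)
        · obtain ⟨x, rfl⟩ := hf.compl_subset hy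
          exact Or.inr ⟨⟨x, fun hx => hy (hf.mapsTo hx)⟩, rfl⟩) n
    have hW : (f.comp j) ⁻¹' κ'.nhd = j ⁻¹' κ.nhd := by rw [← hκ']; rfl
    exact relMap_bijective_congr hW _ _ n h
  have h3 : Function.Bijective (relMap (A := A) f hU n) := by
    refine (Function.Bijective.of_comp_iff _ h1).1 ?_
    have : relMap (A := A) f hU n ∘ relMap j (Set.mapsTo_preimage j κ.nhd) n =
        relMap (f.comp j) (hU.comp (Set.mapsTo_preimage j κ.nhd)) n :=
      funext fun x => relMap_relMap _ _ _ _ _ x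
    rw [this]
    exact h2
  refine (Function.Bijective.of_comp_iff' (κ'.relMap_id_bijective (A := A) n) _).1 ?_
  have : relMap (A := A) (ContinuousMap.id Y) κ'.mapsTo_id n ∘ relMap f hf.mapsTo n =
      relMap f hU n ∘ relMap (ContinuousMap.id D) κ.mapsTo_id n :=
    funext fun x => by
      obtain ⟨c, rfl⟩ := Subquotient.mk_surjective _ _ x
      simp only [Function.comp_apply, relMap_mk, chainMap_id]
  rw [this]
  exact h3.comp (κ.relMap_id_bijective (A := A) n)

end IsRelHomeo

end

/-! ### Quotients of balls -/

section BallQuotient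

variable {p : ℕ} (G : Subgroup (O p))

/-- The distance from the centre of a point of `B^p / G`. -/
def radius : BallQuotient G → ℝ :=
  Quotient.lift (fun x => ‖x.1‖) fun x y ⟨g, _, h⟩ => by rw [← h, g.norm_map]

theorem continuous_radius : Continuous (radius G) :=
  continuous_quot_lift _ (by fun_prop)

theorem radius_le_one (x : BallQuotient G) : radius G x ≤ 1 := by
  induction x using Quotient.inductionOn with
  | h x => exact mem_closedBall_zero_iff.1 x.2

theorem mem_ballInterior_iff {x : BallQuotient G} : x ∈ ballInterior G ↔ radius G x < 1 := by
  constructor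
  · rintro ⟨y, hy, rfl⟩
    exact hy
  · induction x using Quotient.inductionOn with
    | h x => exact fun h => ⟨x, h, rfl⟩

theorem mem_ballBoundary_iff {x : BallQuotient G} : x ∈ ballBoundary G ↔ radius G x = 1 := by
  constructor
  · rintro ⟨y, hy, rfl⟩
    exact hy
  · induction x using Quotient.inductionOn with
    | h x => exact fun h => ⟨x, h, rfl⟩

theorem compl_ballBoundary : (ballBoundary G)ᶜ = ballInterior G := by
  ext x
  rw [Set.mem_compl_iff, mem_ballBoundary_iff, mem_ballInterior_iff]
  exact (radius_le_one G x).lt_iff_ne.symm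

instance : CompactSpace (BallQuotient G) := Quotient.compactSpace

/-- Multiplication of the points of `B^p / G` by a scalar that depends only on the distance from
the centre. -/
def radialScale (s : ℝ → ℝ) (hs : ∀ a, 0 ≤ a → a ≤ 1 → |s a| * a ≤ 1) :
    BallQuotient G → BallQuotient G :=
  Quotient.map (fun x => ⟨s ‖x.1‖ • x.1, mem_closedBall_zero_iff.2 (by
    rw [norm_smul, Real.norm_eq_abs]
    exact hs _ (norm_nonneg _) (mem_closedBall_zero_iff.1 x.2))⟩) <| by
    rintro x y ⟨g, hg, h⟩
    exact ⟨g, hg, by simp only [map_smul, h, ← g.norm_map x.1]⟩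

theorem radius_radialScale (s : ℝ → ℝ) (hs : ∀ a, 0 ≤ a → a ≤ 1 → |s a| * a ≤ 1)
    (x : BallQuotient G) : radius G (radialScale G s hs x) = |s (radius G x)| * radius G x := by
  induction x using Quotient.inductionOn with
  | h x => exact (norm_smul _ _).trans (by rw [Real.norm_eq_abs]; rfl)

theorem radialScale_eq_self (s : ℝ → ℝ) (hs : ∀ a, 0 ≤ a → a ≤ 1 → |s a| * a ≤ 1)
    {x : BallQuotient G} (hx : s (radius G x) = 1) : radialScale G s hs x = x := by
  induction x using Quotient.inductionOn with
  | h x => exact congr_arg _ (Subtype.ext ((congr_arg (· • x.1) hx).trans (one_smul _ _)))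

theorem continuous_radialScale {s : unitInterval → ℝ → ℝ}
    (hs : ∀ t a, 0 ≤ a → a ≤ 1 → |s t a| * a ≤ 1)
    (hc : Continuous fun x : unitInterval × ℝ => s x.1 x.2) :
    Continuous fun x : unitInterval × BallQuotient G => radialScale G (s x.1) (hs x.1) x.2 := by
  refine (isQuotientMap_quotient_mk' (s := orbitSetoid G _)).continuous_lift_prod_right ?_
  refine continuous_quotient_mk'.comp (Continuous.subtype_mk ?_ _)
  exact (hc.comp (by fun_prop : Continuous fun x : unitInterval × Ball p => (x.1, ‖x.2.1‖))).smul
    (by fun_prop)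

/-- The collar of the boundary in `B^p / G`: radial expansion by the factor `1 + t`, cut off at the
boundary. -/
def ballCollar : Collar (ballBoundary G) :=
  have hm (t : unitInterval) (a : ℝ) : 0 < max 1 ((1 + (t : ℝ)) * a) :=
    lt_max_of_lt_left one_pos
  have habs (t : unitInterval) (a : ℝ) (ha : 0 ≤ a) :
      |(1 + (t : ℝ)) / max 1 ((1 + (t : ℝ)) * a)| * a =
        (1 + (t : ℝ)) * a / max 1 ((1 + (t : ℝ)) * a) := by
    rw [abs_of_nonneg (div_nonneg (by linarith [t.2.1]) (hm t a).le), div_mul_eq_mul_div]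
  have hs (t : unitInterval) (a : ℝ) (ha : 0 ≤ a) (_ : a ≤ 1) :
      |(1 + (t : ℝ)) / max 1 ((1 + (t : ℝ)) * a)| * a ≤ 1 := by
    rw [habs t a ha, div_le_one (hm t a)]
    exact le_max_right _ _
  have hnonneg (x : BallQuotient G) : 0 ≤ radius G x := by
    induction x using Quotient.inductionOn with
    | h x => exact norm_nonneg _
  { isClosed := by
      have : ballBoundary G = radius G ⁻¹' {1} := Set.ext fun x => mem_ballBoundary_iff G
      rw [this]
      exact isClosed_singleton.preimage (continuous_radius G)
    nhd := {x | 1 / 2 < radius G x}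
    isOpen_nhd := isOpen_lt continuous_const (continuous_radius G)
    subset_nhd x hx := by
      refine lt_of_lt_of_eq ?_ ((mem_ballBoundary_iff G).1 hx).symm
      norm_num
    h :=
      { toFun x := radialScale G (fun a => (1 + (x.1 : ℝ)) / max 1 ((1 + (x.1 : ℝ)) * a)) (hs x.1)
          x.2
        continuous_toFun := continuous_radialScale G hs <|
          Continuous.div (by fun_prop) (by fun_prop) fun x => (hm x.1 x.2).ne' }
    h_zero y := radialScale_eq_self G _ (hs 0) (by simp [radius_le_one])
    h_of_mem t y hy := radialScale_eq_self G _ (hs t) (by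
      rw [(mem_ballBoundary_iff G).1 hy, mul_one, max_eq_right (by linarith [t.2.1]),
        div_self (by linarith [t.2.1])])
    h_mem_nhd t y hy := by
      refine lt_of_lt_of_eq ?_ (radius_radialScale G _ (hs t) y).symm
      rw [habs t _ (hnonneg y), lt_div_iff₀ (hm t _), mul_max_of_nonneg _ _ (by norm_num)]
      have h1 : 1 / 2 < radius G y := hy
      have h2 : radius G y ≤ (1 + (t : ℝ)) * radius G y := by
        nlinarith [t.2.1, hnonneg y]
      exact max_lt (by linarith) (by linarith)
    h_one_mem {y} hy := by
      rw [mem_ballBoundary_iff]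
      refine (radius_radialScale G _ (hs 1) y).trans ?_
      have h1 : 1 / 2 < radius G y := hy
      rw [habs 1 _ (hnonneg y), max_eq_right (by simp; linarith), div_self]
      simp; linarith }

/-- `B^p / G` is contractible. -/
theorem exists_homotopic_const_ballQuotient :
    ∃ x : BallQuotient G, (ContinuousMap.id (BallQuotient G)).Homotopic (.const _ x) := by
  have hs (t : unitInterval) (a : ℝ) (ha : 0 ≤ a) (ha' : a ≤ 1) : |1 - (t : ℝ)| * a ≤ 1 := by
    rw [abs_of_nonneg (by linarith [t.2.2])]
    nlinarith [t.2.1, t.2.2]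
  refine ⟨Quotient.mk _ ⟨0, by simp⟩, ⟨
    { toFun := fun x => radialScale G (fun _ => 1 - (x.1 : ℝ)) (hs x.1) x.2
      continuous_toFun := continuous_radialScale G (s := fun t _ => 1 - (t : ℝ)) hs
        (by fun_prop)
      map_zero_left := fun x => radialScale_eq_self G _ (hs 0) (by simp)
      map_one_left := fun x => ?_ }⟩⟩
  induction x using Quotient.inductionOn with
  | h x => exact congr_arg _ (Subtype.ext (by simp))

/-- The inclusion of `S^(p-1) / G` into `B^p / G`. -/
def sphereIncl : C(SphereQuotient G, BallQuotient G) where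
  toFun := Quotient.map (fun x => ⟨x.1, Metric.sphere_subset_closedBall x.2⟩) fun _ _ h => h
  continuous_toFun := Continuous.quotient_map' (by fun_prop) _

theorem range_sphereIncl : Set.range (sphereIncl G) = ballBoundary G := by
  ext x
  constructor
  · rintro ⟨y, rfl⟩
    induction y using Quotient.inductionOn with
    | h y => exact ⟨⟨y.1, Metric.sphere_subset_closedBall y.2⟩, mem_sphere_zero_iff_norm.1 y.2, rfl⟩
  · rintro ⟨y, hy, rfl⟩
    exact ⟨Quotient.mk _ ⟨y.1, mem_sphere_zero_iff_norm.2 hy⟩, rfl⟩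

theorem isEmbedding_sphereIncl : Topology.IsEmbedding (sphereIncl G) := by
  refine (Topology.IsClosedEmbedding.of_continuous_injective_isClosedMap
    (sphereIncl G).continuous ?_ fun T hT => ?_).isEmbedding
  · intro x y
    induction x, y using Quotient.inductionOn₂ with
    | h x y =>
      intro h
      exact Quotient.sound (Quotient.exact (s := orbitSetoid G (Metric.closedBall 0 1))
        (a := ⟨x.1, Metric.sphere_subset_closedBall x.2⟩)
        (b := ⟨y.1, Metric.sphere_subset_closedBall y.2⟩) h)
  · -- the union of the orbits that belong to `T` is closed in the ball
    have hcl : Topology.IsClosedEmbedding fun x : Sphere p =>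
        (⟨x.1, Metric.sphere_subset_closedBall x.2⟩ : Ball p) :=
      (Topology.IsClosedEmbedding.inclusion Metric.sphere_subset_closedBall
        (Metric.isClosed_sphere.preimage continuous_subtype_val))
    rw [← (isQuotientMap_quotient_mk' (s := orbitSetoid G _)).isClosed_preimage] at hT ⊢
    convert hcl.isClosedMap _ hT using 1
    ext x
    constructor
    · rintro ⟨y, hy, h⟩
      induction y using Quotient.inductionOn with
      | h y =>
        obtain ⟨g, hg, h⟩ := Quotient.exact h
        have hx : x.1 ∈ Metric.sphere (0 : EuclideanSpace ℝ (Fin p)) 1 := by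
          rw [← h, mem_sphere_zero_iff_norm, g.norm_map]
          exact mem_sphere_zero_iff_norm.1 y.2
        refine ⟨⟨x.1, hx⟩, ?_, rfl⟩
        have : (Quotient.mk (orbitSetoid G _) ⟨x.1, hx⟩ : SphereQuotient G) = Quotient.mk _ y :=
          Quotient.sound ((orbitSetoid G _).symm ⟨g, hg, h⟩)
        exact Set.mem_of_eq_of_mem (s := T) this hy
    · rintro ⟨y, hy, rfl⟩
      exact ⟨_, hy, rfl⟩

theorem sphereQuotient_nonempty (hp : 1 ≤ p) : Nonempty (SphereQuotient G) :=
  ⟨Quotient.mk _ ⟨EuclideanSpace.single ⟨0, hp⟩ 1, by simp⟩⟩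

end BallQuotient

/-- The collar of a disjoint union. -/
def Collar.sigma {ι : Type*} {E : ι → Type*} [∀ i, TopologicalSpace (E i)] {S : ∀ i, Set (E i)}
    (κ : ∀ i, Collar (S i)) : Collar {x : Σ i, E i | x.2 ∈ S x.1} where
  isClosed := isClosed_sigma_iff.2 fun i => (κ i).isClosed
  nhd := {x | x.2 ∈ (κ x.1).nhd}
  isOpen_nhd := isOpen_sigma_iff.2 fun i => (κ i).isOpen_nhd
  subset_nhd x hx := (κ x.1).subset_nhd hx
  h :=
    { toFun := fun x => ⟨x.2.1, (κ x.2.1).h (x.1, x.2.2)⟩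
      continuous_toFun := by
        rw [← ((Homeomorph.prodComm _ _).trans
          Homeomorph.sigmaProdDistrib).symm.comp_continuous_iff']
        refine continuous_sigma fun i => ?_
        exact continuous_sigmaMk.comp
          ((κ i).h.continuous.comp (continuous_swap (X := E i) (Y := unitInterval))) }
  h_zero y := Sigma.ext rfl (heq_of_eq ((κ y.1).h_zero y.2))
  h_of_mem t y hy := Sigma.ext rfl (heq_of_eq ((κ y.1).h_of_mem t hy))
  h_mem_nhd t y hy := (κ y.1).h_mem_nhd t hy
  h_one_mem {y} hy := (κ y.1).h_one_mem hy

/-! ### The skeleta of a symmetric CW-complex -/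

namespace SymmetricCWComplex

variable {X : Type u} [TopologicalSpace X] (𝒳 : SymmetricCWComplex X)

theorem eq_of_mem_openCell {c c' : Σ p, 𝒳.cell p} {x : X} (h : x ∈ 𝒳.openCell c.2)
    (h' : x ∈ 𝒳.openCell c'.2) : c = c' := by
  by_contra hne
  exact Set.disjoint_left.1 (𝒳.pairwise_disjoint hne) h h'

theorem skeleton_mono : Monotone 𝒳.skeleton :=
  fun _ _ h _ ⟨m, i, hm, hx⟩ => ⟨m, i, hm.trans h, hx⟩

theorem skeleton_of_neg {p : ℤ} (hp : p < 0) : 𝒳.skeleton p = ∅ :=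
  Set.eq_empty_of_forall_notMem fun _ ⟨m, _, hm, _⟩ => by lia

theorem skeleton_eq_univ {N : ℕ} (hN : ∀ p, N < p → IsEmpty (𝒳.cell p)) {p : ℤ} (hp : N ≤ p) :
    𝒳.skeleton p = Set.univ := by
  refine Set.eq_univ_of_forall fun x => ?_
  obtain ⟨c, hc⟩ := Set.mem_iUnion.1 (𝒳.iUnion_eq.ge (Set.mem_univ x))
  refine ⟨c.1, c.2, ?_, hc⟩
  by_contra h
  exact (hN c.1 (by lia)).elim c.2

theorem map_mem_skeleton_of_mem_ballBoundary {m : ℕ} (i : 𝒳.cell m) {x : BallQuotient (𝒳.group i)}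
    (hx : x ∈ ballBoundary (𝒳.group i)) : 𝒳.map i x ∈ 𝒳.skeleton (m - 1) := by
  obtain ⟨S, hS, h⟩ := 𝒳.closure_finite i
  obtain ⟨c, hc, hxc⟩ := Set.mem_iUnion₂.1 (h ⟨x, hx, rfl⟩)
  exact ⟨c.1, c.2, by have := hS c hc; lia, hxc⟩

theorem range_map_subset {m : ℕ} (i : 𝒳.cell m) {p : ℤ} (h : m ≤ p) :
    Set.range (𝒳.map i) ⊆ 𝒳.skeleton p := by
  rintro _ ⟨x, rfl⟩
  by_cases hx : x ∈ ballBoundary (𝒳.group i)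
  · exact 𝒳.skeleton_mono (by lia) (𝒳.map_mem_skeleton_of_mem_ballBoundary i hx)
  · rw [← Set.mem_compl_iff, compl_ballBoundary] at hx
    exact ⟨m, i, h, x, hx, rfl⟩

theorem isClosed_range_map {m : ℕ} (i : 𝒳.cell m) : IsClosed (Set.range (𝒳.map i)) :=
  have := 𝒳.t2
  (isCompact_range (𝒳.continuous_map i)).isClosed

theorem closure_openCell_subset {m : ℕ} (i : 𝒳.cell m) :
    closure (𝒳.openCell i) ⊆ Set.range (𝒳.map i) :=
  closure_minimal (Set.image_subset_range _ _) (𝒳.isClosed_range_map i)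

/-- Whether a subset of a skeleton is closed can be tested on the images of the characteristic maps
of the cells of that skeleton. -/
theorem isClosed_of_subset_skeleton {p : ℤ} {T : Set X} (hT : T ⊆ 𝒳.skeleton p)
    (h : ∀ (m : ℕ) (i : 𝒳.cell m), m ≤ p → IsClosed (T ∩ Set.range (𝒳.map i))) : IsClosed T := by
  refine (𝒳.isClosed_iff T).2 fun c => ?_
  change IsClosed (T ∩ closure (𝒳.openCell c.2))
  by_cases hc : (c.1 : ℤ) ≤ p
  · convert (h c.1 c.2 hc).inter (isClosed_closure (s := 𝒳.openCell c.2)) using 1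
    rw [Set.inter_assoc, Set.inter_eq_right.2 (𝒳.closure_openCell_subset c.2)]
  · -- `T` meets the closure of the cell in finitely many cells of the skeleton
    obtain ⟨S, -, hS⟩ := 𝒳.closure_finite c.2
    have hfin : ({c' ∈ S | (c'.1 : ℤ) ≤ p} : Set (Σ m, 𝒳.cell m)).Finite :=
      S.finite_toSet.subset fun _ h => h.1
    convert (isClosed_closure (s := 𝒳.openCell c.2)).inter
      (hfin.isClosed_biUnion fun c' hc' => h c'.1 c'.2 hc'.2) using 1
    ext x
    simp only [Set.mem_inter_iff, Set.mem_iUnion, exists_prop]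
    constructor
    · rintro ⟨hxT, hx⟩
      obtain ⟨m, i, hm, hxi⟩ := hT hxT
      refine ⟨hx, ⟨m, i⟩, ⟨?_, hm⟩, hxT, Set.image_subset_range _ _ hxi⟩
      obtain ⟨y, rfl⟩ := 𝒳.closure_openCell_subset c.2 hx
      by_cases hy : y ∈ ballBoundary (𝒳.group c.2)
      · obtain ⟨c', hc', hyc'⟩ := Set.mem_iUnion₂.1 (hS ⟨y, hy, rfl⟩)
        rwa [𝒳.eq_of_mem_openCell (c := ⟨m, i⟩) hxi hyc']
      · rw [← Set.mem_compl_iff, compl_ballBoundary] at hy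
        have := 𝒳.eq_of_mem_openCell (c := ⟨m, i⟩) (c' := c) hxi ⟨y, hy, rfl⟩
        subst this
        exact (hc hm).elim
    · rintro ⟨hx, c', -, hxT, -⟩
      exact ⟨hxT, hx⟩

theorem isClosed_skeleton (p : ℤ) : IsClosed (𝒳.skeleton p) :=
  𝒳.isClosed_of_subset_skeleton subset_rfl fun m i hm => by
    rw [Set.inter_eq_right.2 (𝒳.range_map_subset i hm)]
    exact 𝒳.isClosed_range_map i

/-- The characteristic maps of all `p`-cells together. -/
def cellsMap (p : ℕ) : C(Σ i : 𝒳.cell p, BallQuotient (𝒳.group i), 𝒳.skeleton p) where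
  toFun x := ⟨𝒳.map x.1 x.2, 𝒳.range_map_subset x.1 le_rfl ⟨x.2, rfl⟩⟩
  continuous_toFun := (continuous_sigma fun i => 𝒳.continuous_map i).subtype_mk _

theorem cellsMap_mem_iff (p : ℕ) (x : Σ i : 𝒳.cell p, BallQuotient (𝒳.group i)) :
    (𝒳.cellsMap p x : X) ∈ 𝒳.skeleton (p - 1) ↔ x.2 ∈ ballBoundary (𝒳.group x.1) := by
  refine ⟨fun ⟨m, i, hm, hx⟩ => ?_, 𝒳.map_mem_skeleton_of_mem_ballBoundary x.1⟩
  by_contra hxb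
  rw [← Set.mem_compl_iff, compl_ballBoundary] at hxb
  have := congr_arg Sigma.fst
    (𝒳.eq_of_mem_openCell (c := ⟨m, i⟩) (c' := ⟨p, x.1⟩) hx ⟨x.2, hxb, rfl⟩)
  dsimp only at this
  lia

/-- The `p`-skeleton arises from the `(p-1)`-skeleton by attaching the `p`-cells. -/
theorem isRelHomeo_cellsMap (p : ℕ) :
    IsRelHomeo (𝒳.cellsMap p) {x | x.2 ∈ ballBoundary (𝒳.group x.1)}
      (Subtype.val ⁻¹' 𝒳.skeleton (p - 1)) where
  isClosed := (𝒳.isClosed_skeleton _).preimage continuous_subtype_val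
  preimage := Set.ext fun x => 𝒳.cellsMap_mem_iff p x
  injOn := by
    rintro ⟨i, x⟩ hx ⟨j, y⟩ hy h
    replace h : 𝒳.map i x = 𝒳.map j y := congr_arg Subtype.val h
    replace hx : x ∈ ballInterior (𝒳.group i) := (compl_ballBoundary _).le hx
    replace hy : y ∈ ballInterior (𝒳.group j) := (compl_ballBoundary _).le hy
    have := 𝒳.eq_of_mem_openCell (c := ⟨p, i⟩) (c' := ⟨p, j⟩) ⟨x, hx, rfl⟩ ⟨y, hy, h.symm⟩
    obtain rfl : i = j := by simpa using this
    have := @(𝒳.isEmbedding_map i).injective ⟨x, hx⟩ ⟨y, hy⟩ h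
    simpa using this
  compl_subset := by
    rintro ⟨x, m, i, hm, y, hy, rfl⟩ hx
    obtain rfl : m = p := by
      by_contra hne
      exact hx ⟨m, i, by lia, y, hy, rfl⟩
    exact ⟨⟨i, y⟩, rfl⟩
  isClosed_of_preimage T hT hfT := by
    have hemb := (𝒳.isClosed_skeleton p).isClosedEmbedding_subtypeVal
    rw [hemb.isClosed_iff_image_isClosed] at hT ⊢
    refine 𝒳.isClosed_of_subset_skeleton (p := p) (by rintro _ ⟨x, -, rfl⟩; exact x.2)
      fun m i hm => ?_
    rcases hm.lt_or_eq with hm | hm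
    · convert hT.inter (𝒳.isClosed_range_map i) using 1
      ext x
      constructor
      · rintro ⟨⟨y, hy, rfl⟩, hx⟩
        exact ⟨⟨y, ⟨hy, 𝒳.range_map_subset i (by lia) hx⟩, rfl⟩, hx⟩
      · rintro ⟨⟨y, hy, rfl⟩, hx⟩
        exact ⟨⟨y, hy.1, rfl⟩, hx⟩
    · obtain rfl : m = p := by lia
      have := 𝒳.t2
      have hi : IsClosed ((fun x => (⟨i, x⟩ : Σ i : 𝒳.cell m, BallQuotient (𝒳.group i))) ⁻¹'
        (𝒳.cellsMap m ⁻¹' T)) := hfT.preimage continuous_sigmaMk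
      convert (hi.isCompact.image (𝒳.continuous_map i)).isClosed using 1
      ext x
      constructor
      · rintro ⟨⟨y, hy, hyx⟩, z, rfl⟩
        refine ⟨z, ?_, rfl⟩
        rwa [show y = 𝒳.cellsMap m ⟨i, z⟩ from Subtype.ext hyx] at hy
      · rintro ⟨z, hz, rfl⟩
        exact ⟨⟨_, hz, rfl⟩, z, rfl⟩

end SymmetricCWComplex

/-! ### The homology of a disjoint union -/

section Sigma

variable {A : Type*} [AddCommGroup A] {ι : Type*} {E : ι → Type*} [∀ i, TopologicalSpace (E i)]

/-- The inclusion of a summand of a disjoint union. -/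
def sigmaIncl (i : ι) : C(E i, Σ i, E i) := ⟨Sigma.mk i, continuous_sigmaMk⟩

theorem exists_eq_sigmaIncl_comp {n : ℕ} (σ : C(Simplex n, Σ i, E i)) :
    ∃ (i : ι) (τ : C(Simplex n, E i)), σ = (sigmaIncl i).comp τ := by
  obtain ⟨i, g, hg, h⟩ := σ.continuous.exists_lift_sigma
  exact ⟨i, ⟨g, hg⟩, ContinuousMap.ext fun x => congr_fun h x⟩

theorem sigmaIncl_comp_injective (i : ι) : Function.Injective fun s : SingularSimplex (E i) =>
    (⟨s.1, (sigmaIncl i).comp s.2⟩ : SingularSimplex (Σ i, E i)) := by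
  rintro ⟨n, σ⟩ ⟨m, τ⟩ h
  obtain rfl : n = m := congr_arg Sigma.fst h
  have h' : (sigmaIncl i).comp σ = (sigmaIncl i).comp τ := eq_of_heq (Sigma.mk.inj h).2
  congr 1
  ext x
  exact sigma_mk_injective congr($h' x)

variable (A) in
/-- The part of a chain in a disjoint union that lies in a given summand. -/
def summandChain (i : ι) : Chain A (Σ i, E i) →+ Chain A (E i) :=
  Finsupp.comapDomain.addMonoidHom (sigmaIncl_comp_injective i)

theorem summandChain_single (i : ι) {n : ℕ} (τ : C(Simplex n, E i)) (a : A) :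
    summandChain A i (.single ⟨n, (sigmaIncl i).comp τ⟩ a) = .single ⟨n, τ⟩ a :=
  Finsupp.comapDomain_single (f := fun s : SingularSimplex (E i) =>
    (⟨s.1, (sigmaIncl i).comp s.2⟩ : SingularSimplex (Σ i, E i))) ⟨n, τ⟩ a
      (sigmaIncl_comp_injective i).injOn

theorem summandChain_single_of_ne {i j : ι} (h : j ≠ i) {n : ℕ} (τ : C(Simplex n, E j)) (a : A) :
    summandChain A i (.single ⟨n, (sigmaIncl j).comp τ⟩ a) = 0 := by
  ext ⟨m, τ'⟩
  refine Finsupp.single_eq_of_ne fun h' => h ?_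
  obtain rfl : n = m := congr_arg Sigma.fst h'.symm
  have h' : (sigmaIncl i).comp τ' = (sigmaIncl j).comp τ := eq_of_heq (Sigma.mk.inj h').2
  exact congr_arg Sigma.fst congr($h' (Classical.arbitrary _)).symm

theorem summandChain_chainMap (i : ι) (c : Chain A (E i)) :
    summandChain A i (chainMap A (sigmaIncl i) c) = c := by
  suffices h : (summandChain A i).comp (chainMap A (sigmaIncl i)) = .id _ from congr($h c)
  refine Finsupp.addHom_ext fun ⟨n, σ⟩ a => ?_
  rw [AddMonoidHom.comp_apply, chainMap_single, summandChain_single, AddMonoidHom.id_apply]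

theorem summandChain_chainMap_of_ne {i j : ι} (h : j ≠ i) (c : Chain A (E j)) :
    summandChain A i (chainMap A (sigmaIncl j) c) = 0 := by
  suffices h : (summandChain A i).comp (chainMap A (sigmaIncl j)) = 0 from congr($h c)
  refine Finsupp.addHom_ext fun ⟨n, σ⟩ a => ?_
  rw [AddMonoidHom.comp_apply, chainMap_single, summandChain_single_of_ne h,
    AddMonoidHom.zero_apply]

theorem boundary_summandChain (i : ι) (c : Chain A (Σ i, E i)) :
    boundary A (E i) (summandChain A i c) = summandChain A i (boundary A _ c) := by
  suffices h : (boundary A (E i)).comp (summandChain A i) = (summandChain A i).comp (boundary A _)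
    from congr($h c)
  refine Finsupp.addHom_ext fun ⟨n, σ⟩ a => ?_
  obtain ⟨j, τ, rfl⟩ := exists_eq_sigmaIncl_comp σ
  rw [AddMonoidHom.comp_apply, AddMonoidHom.comp_apply, ← chainMap_single, boundary_chainMap]
  obtain rfl | h := eq_or_ne j i
  · rw [summandChain_chainMap, summandChain_chainMap]
  · rw [summandChain_chainMap_of_ne h, summandChain_chainMap_of_ne h, map_zero]

theorem summandChain_mem_chainsDeg (i : ι) {m : ℤ} {c : Chain A (Σ i, E i)}
    (hc : c ∈ chainsDeg A _ m) : summandChain A i c ∈ chainsDeg A (E i) m :=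
  mem_chainsOf.2 fun s hs => mem_chainsOf.1 hc ⟨s.1, (sigmaIncl i).comp s.2⟩ hs

theorem summandChain_mem_chainsIn (i : ι) {S : ∀ i, Set (E i)} {c : Chain A (Σ i, E i)}
    (hc : c ∈ chainsIn A {x | x.2 ∈ S x.1}) : summandChain A i c ∈ chainsIn A (S i) :=
  mem_chainsOf.2 fun s hs => by
    rintro _ ⟨x, rfl⟩
    exact mem_chainsOf.1 hc ⟨s.1, (sigmaIncl i).comp s.2⟩ hs ⟨x, rfl⟩

open Classical in
theorem exists_eq_sum_summandChain (c : Chain A (Σ i, E i)) :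
    ∃ I : Finset ι, c = ∑ i ∈ I, chainMap A (sigmaIncl i) (summandChain A i c) := by
  let comp (s : SingularSimplex (Σ i, E i)) : ι := (s.2 (Classical.arbitrary _)).1
  refine ⟨c.support.image comp, ?_⟩
  generalize hI : c.support.image comp = I
  have : chainsOf A {s | comp s ∈ I} ≤ (AddMonoidHom.id _).eqLocus
      (∑ i ∈ I, (chainMap A (sigmaIncl i)).comp (summandChain A i)) := by
    refine chainsOf_le_iff.2 fun ⟨n, σ⟩ hσ a => ?_
    obtain ⟨j, τ, rfl⟩ := exists_eq_sigmaIncl_comp σ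
    change _ = (∑ i ∈ I, (chainMap A (sigmaIncl i)).comp (summandChain A i)) _
    rw [AddMonoidHom.finsetSum_apply, Finset.sum_eq_single j]
    · rw [AddMonoidHom.comp_apply, summandChain_single, chainMap_single]
      rfl
    · intro i _ hi
      rw [AddMonoidHom.comp_apply, summandChain_single_of_ne hi.symm, map_zero]
    · exact fun h => (h hσ).elim
  have hc : c ∈ chainsOf A {s | comp s ∈ I} := mem_chainsOf.2 fun s hs => by
    subst hI
    exact Finset.mem_image_of_mem _ (Finsupp.mem_support_iff.2 hs)
  replace hc : c = (∑ i ∈ I, (chainMap A (sigmaIncl i)).comp (summandChain A i)) c := this hc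
  rwa [AddMonoidHom.finsetSum_apply] at hc

variable (S : ∀ i, Set (E i)) (n : ℤ)

theorem mapsTo_sigmaIncl (i : ι) : Set.MapsTo (sigmaIncl i) (S i) {x | x.2 ∈ S x.1} :=
  fun _ hx => hx

theorem summandChain_mem_relCycles (i : ι) {c : Chain A (Σ i, E i)}
    (hc : c ∈ relCycles A _ {x : Σ i, E i | x.2 ∈ S x.1} n) :
    summandChain A i c ∈ relCycles A (E i) (S i) n :=
  mem_relCycles.2 ⟨summandChain_mem_chainsDeg i hc.1, by
    rw [boundary_summandChain]
    exact summandChain_mem_chainsIn i hc.2⟩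

/-- The projection of the relative homology of a disjoint union to that of a summand. -/
def summandMap (i : ι) :
    RelHomology A (Σ i, E i) {x | x.2 ∈ S x.1} n →+ RelHomology A (E i) (S i) n :=
  Subquotient.map (summandChain A i) (fun _ hc => summandChain_mem_relCycles S n i hc) <| by
    rintro _ - hc
    obtain ⟨a, ha, ha', b, hb, rfl⟩ := mem_relBoundaries.1 hc
    exact mem_relBoundaries.2 ⟨_, summandChain_mem_chainsIn i ha, summandChain_mem_chainsDeg i ha',
      _, summandChain_mem_chainsDeg i hb, by rw [map_add, boundary_summandChain]⟩

theorem summandMap_relMap (i : ι) (x : RelHomology A (E i) (S i) n) :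
    summandMap S n i (relMap (sigmaIncl i) (mapsTo_sigmaIncl S i) n x) = x := by
  obtain ⟨c, rfl⟩ := Subquotient.mk_surjective _ _ x
  refine congr_arg (Subquotient.mk _ _) (Subtype.ext ?_)
  exact summandChain_chainMap i (c : Chain A (E i))

theorem summandMap_relMap_of_ne {i j : ι} (h : j ≠ i) (x : RelHomology A (E j) (S j) n) :
    summandMap S n i (relMap (sigmaIncl j) (mapsTo_sigmaIncl S j) n x) = 0 := by
  obtain ⟨c, rfl⟩ := Subquotient.mk_surjective _ _ x
  refine (congr_arg (Subquotient.mk _ _) (Subtype.ext ?_)).trans (map_zero _)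
  exact summandChain_chainMap_of_ne h (c : Chain A (E j))

/-- The relative homology of a disjoint union is the direct sum of the relative homology groups of
the summands. -/
theorem nonempty_relHomology_sigma_equiv :
    Nonempty (RelHomology A (Σ i, E i) {x | x.2 ∈ S x.1} n ≃+
      ⨁ i, RelHomology A (E i) (S i) n) := by
  classical
  let Φ : (⨁ i, RelHomology A (E i) (S i) n) →+ RelHomology A (Σ i, E i) {x | x.2 ∈ S x.1} n :=
    DirectSum.toAddMonoid fun i => relMap (sigmaIncl i) (mapsTo_sigmaIncl S i) n
  have hΦ (i : ι) (x) : summandMap S n i (Φ x) = x i := by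
    induction x using DirectSum.induction_on with
    | zero => rw [map_zero, map_zero]; rfl
    | of j x =>
      rw [DirectSum.toAddMonoid_of]
      obtain rfl | h := eq_or_ne j i
      · rw [summandMap_relMap, DirectSum.of_eq_same]
      · rw [summandMap_relMap_of_ne S n h, DirectSum.of_eq_of_ne _ _ _ h.symm]
    | add x y hx hy => rw [map_add, map_add, hx, hy]; rfl
  refine ⟨(AddEquiv.ofBijective Φ ⟨?_, fun x => ?_⟩).symm⟩
  · refine (injective_iff_map_eq_zero Φ).2 fun x hx => DFinsupp.ext fun i => ?_
    exact (hΦ i x).symm.trans (by rw [hx, map_zero]; rfl)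
  · obtain ⟨⟨c, hc⟩, rfl⟩ := Subquotient.mk_surjective _ _ x
    obtain ⟨I, hI⟩ := exists_eq_sum_summandChain c
    refine ⟨∑ i ∈ I, DirectSum.of (fun i => RelHomology A (E i) (S i) n) i
      (Subquotient.mk _ _ ⟨_, summandChain_mem_relCycles S n i hc⟩), ?_⟩
    rw [map_sum]
    simp only [Φ, DirectSum.toAddMonoid_of, relMap_mk]
    rw [← map_sum]
    refine congr_arg (Subquotient.mk _ _) (Subtype.ext ?_)
    rw [AddSubgroup.val_finsetSum]
    exact hI.symm

end Sigma

/-- Relative homology does not depend on the universe of the space. -/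
theorem nonempty_relHomology_uLift_equiv {A : Type*} [AddCommGroup A] {Y : Type*}
    [TopologicalSpace Y] (S : Set Y) (n : ℤ) :
    Nonempty (RelHomology A Y S n ≃+ RelHomology A (ULift.{u} Y) (ULift.down ⁻¹' S) n) := by
  let up : C(Y, ULift.{u} Y) := ⟨ULift.up, continuous_uliftUp⟩
  let down : C(ULift.{u} Y, Y) := ⟨ULift.down, continuous_uliftDown⟩
  refine ⟨
    { relMap (A := A) up (S := S) (T := ULift.down ⁻¹' S) (fun _ hx => hx) n with
      invFun := relMap (A := A) down (S := ULift.down ⁻¹' S) (T := S) (fun _ hx => hx) n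
      left_inv := fun x => ?_
      right_inv := fun x => ?_ }⟩
  · obtain ⟨c, rfl⟩ := Subquotient.mk_surjective _ _ x
    refine congr_arg (Subquotient.mk _ _) (Subtype.ext ?_)
    exact (chainMap_comp _ _ _).symm.trans (chainMap_id _)
  · obtain ⟨c, rfl⟩ := Subquotient.mk_surjective _ _ x
    refine congr_arg (Subquotient.mk _ _) (Subtype.ext ?_)
    exact (chainMap_comp _ _ _).symm.trans (chainMap_id _)

/-! ### The homology of a contractible space relative to a subspace -/

section Contractible

variable {A : Type u} [AddCommGroup A]

theorem nonempty_addEquiv_of_subsingleton (P Q : Type*) [AddCommGroup P] [AddCommGroup Q]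
    [Subsingleton P] [Subsingleton Q] : Nonempty (P ≃+ Q) :=
  ⟨{ (0 : P →+ Q) with
      invFun := 0
      left_inv := fun _ => Subsingleton.elim _ _
      right_inv := fun _ => Subsingleton.elim _ _ }⟩

theorem chainMap_mem_chainsIn_range {X Y : Type*} [TopologicalSpace X] [TopologicalSpace Y]
    (f : C(X, Y)) (c : Chain A X) : chainMap A f c ∈ chainsIn A (Set.range f) :=
  chainMap_mem_chainsIn (S := Set.univ) (fun x _ => Set.mem_range_self x)
    (by rw [chainsIn_univ]; trivial)

/-- The inclusion of a point. -/
def ofPoint {Y : Type u} [TopologicalSpace Y] (y : Y) : TopCat.of PUnit.{u + 1} ⟶ TopCat.of Y :=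
  TopCat.ofHom (.const _ y)

theorem exists_boundary_of_point {n : ℤ} (hn : 0 < n) {c : Chain A PUnit.{u + 1}}
    (hc : c ∈ chainsDeg A PUnit n) (hc' : boundary A _ c = 0) :
    ∃ b ∈ chainsDeg A PUnit (n + 1), c = boundary A _ b := by
  have hz : Limits.IsZero ((homologyFunctor A n).obj (.of PUnit.{u + 1})) := by
    obtain ⟨k, rfl⟩ := Int.eq_succ_of_zero_lt hn
    exact AlgebraicTopology.isZero_singularHomologyFunctor_of_totallyDisconnectedSpace _ _ _ _
      (Nat.succ_ne_zero k)
  have := AddCommGrpCat.subsingleton_of_isZero hz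
  exact (homologyClass_eq_zero_iff (X := .of PUnit.{u + 1})
    ⟨c, mem_relCycles_empty.2 ⟨hc, hc'⟩⟩).1 (Subsingleton.elim _ _)

variable {Y : Type u} [TopologicalSpace Y] {y₀ : Y}

/-- In a contractible space, a cycle is a boundary as soon as its image in a point is. -/
theorem exists_boundary_of_contractible (h₀ : (ContinuousMap.id Y).Homotopic (.const _ y₀)) {n : ℤ}
    {c : Chain A Y} (hc : c ∈ chainsDeg A Y n)
    (hc' : boundary A Y c = 0)
    (h : ∃ b ∈ chainsDeg A PUnit.{u + 1} (n + 1),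
      chainMap A (toPoint Y).hom c = boundary A _ b) :
    ∃ b ∈ chainsDeg A Y (n + 1), c = boundary A Y b := by
  obtain ⟨e, he, hce⟩ := exists_boundary_of_homotopic h₀ hc hc'
  obtain ⟨b, hb, hcb⟩ := h
  have hconst : chainMap A (.const Y y₀) c =
      chainMap A (ofPoint y₀).hom (chainMap A (toPoint Y).hom c) := by
    rw [← chainMap_comp]
    rfl
  refine ⟨chainMap A (ofPoint y₀).hom b + e, add_mem (chainMap_mem_chainsDeg _ hb) he, ?_⟩
  rw [map_add, boundary_chainMap, ← hcb]
  change _ = chainMap A (ofPoint y₀).hom (chainMap A (toPoint Y).hom c) + _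
  rw [← hconst, ← hce, chainMap_id]

theorem subsingleton_relHomology_zero (h₀ : (ContinuousMap.id Y).Homotopic (.const _ y₀))
    {S : Set Y} (hS : S.Nonempty) :
    Subsingleton (RelHomology A Y S 0) := by
  refine subsingleton_of_forall_eq 0 fun x => ?_
  obtain ⟨⟨c, hc⟩, rfl⟩ := Subquotient.mk_surjective _ _ x
  obtain ⟨s, hs⟩ := hS
  rw [Subquotient.mk_eq_zero_iff]
  have hdeg : chainMap A (.const Y s) c ∈ chainsDeg A Y 0 := chainMap_mem_chainsDeg _ hc.1
  have hbd {c : Chain A Y} (hc : c ∈ chainsDeg A Y 0) : boundary A Y c = 0 :=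
    chainsDeg_neg (by lia) (boundary_mem_chainsDeg hc)
  -- the chain is homologous to its image under a constant map to `S`
  obtain ⟨b, hb, hcb⟩ := exists_boundary_of_contractible h₀ (sub_mem hc.1 hdeg)
    (by rw [map_sub, hbd hc.1, hbd hdeg, sub_zero])
    ⟨0, zero_mem _, by
      rw [map_sub, ← chainMap_comp, map_zero, sub_eq_zero]
      rfl⟩
  refine mem_relBoundaries.2 ⟨chainMap A (.const Y s) c, ?_, hdeg, b, hb, eq_add_of_sub_eq' hcb⟩
  exact chainMap_mem_chainsIn (S := Set.univ) (fun _ _ => hs) (by rw [chainsIn_univ]; trivial)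

variable {W : Type u} [TopologicalSpace W] {f : C(W, Y)}

theorem nonempty_relHomology_succ_equiv (h₀ : (ContinuousMap.id Y).Homotopic (.const _ y₀))
    (hf : Topology.IsEmbedding f) (n : ℕ) :
    Nonempty (RelHomology A Y (Set.range f) (n + 1) ≃+ reducedH A n W) := by
  have hex (c : relCycles A Y (Set.range f) (n + 1)) :
      ∃ b : relCycles A W ∅ n, chainMap A f b = boundary A Y c := by
    have hdeg := boundary_mem_chainsDeg c.2.1
    rw [add_sub_cancel_right] at hdeg
    obtain ⟨b, -, hb, h⟩ := exists_chainMap_eq hf subset_rfl c.2.2 hdeg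
    refine ⟨⟨b, mem_relCycles_empty.2 ⟨hb, chainMap_injective hf.injective ?_⟩⟩, h⟩
    rw [← boundary_chainMap, h, boundary_boundary, map_zero]
  choose b hb using hex
  -- the connecting homomorphism, on the level of cycles
  let δ : relCycles A Y (Set.range f) (n + 1) →+ (homologyFunctor A n).obj (.of W) :=
    (homologyClass A (.of W) n).comp (AddMonoidHom.mk' b fun c c' => Subtype.ext <|
      chainMap_injective hf.injective <| by
        rw [hb, AddSubgroup.coe_add, map_add, AddSubgroup.coe_add, map_add, hb, hb])
  have hpt (z : relCycles A W ∅ n) :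
      ((homologyFunctor A n).map (toPoint W)).hom (homologyClass A (.of W) n z) = 0 ↔
        ∃ w ∈ chainsDeg A PUnit.{u + 1} (n + 1),
          chainMap A (toPoint W).hom z = boundary A _ w := by
    rw [map_homologyClass (toPoint W) z ⟨_, chainMap_mem_relCycles (Set.mapsTo_empty _ _) z.2⟩ rfl,
      homologyClass_eq_zero_iff]
  have hcomp (z : Chain A W) : chainMap A (toPoint Y).hom (chainMap A f z) =
      chainMap A (toPoint W).hom z := by
    rw [← chainMap_comp]
    rfl
  have hker (c : relCycles A Y (Set.range f) (n + 1)) :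
      δ c ∈ ((homologyFunctor A n).map (toPoint W)).hom.ker := by
    refine (hpt (b c)).2 ⟨chainMap A (toPoint Y).hom c, chainMap_mem_chainsDeg _ c.2.1, ?_⟩
    rw [boundary_chainMap, ← hb, hcomp]
  have hsurj : Function.Surjective (δ.codRestrict _ hker) := by
    rintro ⟨x, hx⟩
    obtain ⟨z, rfl⟩ := homologyClass_surjective _ _ x
    obtain ⟨w, hw, hzw⟩ := (hpt z).1 hx
    obtain ⟨hz, hz'⟩ := mem_relCycles_empty.1 z.2
    obtain ⟨e, he, hze⟩ := exists_boundary_of_contractible h₀ (chainMap_mem_chainsDeg f hz)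
      (by rw [boundary_chainMap, hz', map_zero]) ⟨w, hw, by rw [hcomp, hzw]⟩
    have he' : e ∈ relCycles A Y (Set.range f) (n + 1) := mem_relCycles.2 ⟨he, by
      rw [← hze]
      exact chainMap_mem_chainsIn_range f (z : Chain A W)⟩
    refine ⟨⟨e, he'⟩, Subtype.ext ?_⟩
    refine congr_arg (homologyClass A (.of W) n)
      (Subtype.ext (chainMap_injective hf.injective ?_))
    rw [hze]
    exact hb ⟨e, he'⟩
  obtain ⟨e, -⟩ := exists_addEquiv_of_ker_eq (Subquotient.mk _ _) _
    (Subquotient.mk_surjective _ (relBoundaries A Y (Set.range f) (n + 1))) hsurj fun c => by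
      rw [Subquotient.mk_eq_zero_iff, ← (AddSubgroup.subtype_injective _).eq_iff, map_zero]
      change _ ↔ homologyClass A (.of W) n (b c) = 0
      rw [homologyClass_eq_zero_iff, mem_relBoundaries]
      constructor
      · rintro ⟨a, ha, ha', w, hw, h⟩
        obtain ⟨v, -, hv, rfl⟩ := exists_chainMap_eq hf subset_rfl ha ha'
        refine ⟨v, hv, chainMap_injective hf.injective ?_⟩
        rw [hb, h, map_add, boundary_boundary, add_zero, boundary_chainMap]
      · rintro ⟨a, ha, h⟩
        have hdeg : (c - chainMap A f a : Chain A Y) ∈ chainsDeg A Y (n + 1) :=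
          sub_mem c.2.1 (chainMap_mem_chainsDeg f ha)
        have hcyc : boundary A Y (c - chainMap A f a) = 0 := by
          rw [map_sub, boundary_chainMap, ← h, hb, sub_self]
        obtain ⟨w, hw, hcw⟩ := exists_boundary_of_contractible h₀ hdeg hcyc
          (exists_boundary_of_point (by lia) (chainMap_mem_chainsDeg _ hdeg)
            (by rw [boundary_chainMap, hcyc, map_zero]))
        exact ⟨chainMap A f a, chainMap_mem_chainsIn_range f a, chainMap_mem_chainsDeg f ha, w, hw,
          eq_add_of_sub_eq' hcw⟩
  exact ⟨e.trans (AddCommGrpCat.kernelIsoKer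
    ((homologyFunctor A n).map (toPoint W))).symm.addCommGroupIsoToAddEquiv⟩

/-- The homology of a contractible space relative to a nonempty subspace is the reduced homology of
the subspace in one degree less. -/
theorem nonempty_relHomology_equiv_reducedH [Nonempty W]
    (h₀ : (ContinuousMap.id Y).Homotopic (.const _ y₀))
    (hf : Topology.IsEmbedding f) (n : ℤ) :
    Nonempty (RelHomology A Y (Set.range f) n ≃+ reducedH A (n - 1) W) := by
  rcases lt_trichotomy n 0 with hn | rfl | hn
  · obtain ⟨m, rfl⟩ := Int.eq_negSucc_of_lt_zero hn
    have : Subsingleton (RelHomology A Y (Set.range f) (Int.negSucc m)) := by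
      refine subsingleton_of_forall_eq 0 fun x => ?_
      obtain ⟨c, rfl⟩ := Subquotient.mk_surjective _ _ x
      rw [Subquotient.mk_eq_zero_iff, chainsDeg_neg hn c.2.1]
      exact zero_mem _
    have : Subsingleton (reducedH A (Int.negSucc m - 1) W) :=
      inferInstanceAs (Subsingleton PUnit)
    exact nonempty_addEquiv_of_subsingleton _ _
  · have := subsingleton_relHomology_zero (A := A) h₀ (Set.range_nonempty f)
    have hsplit : ofPoint (Classical.arbitrary W) ≫ toPoint W = 𝟙 _ := rfl
    have : IsSplitEpi (toPoint W) := ⟨⟨⟨_, hsplit⟩⟩⟩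
    have : Subsingleton (reducedH A (0 - 1) W) :=
      AddCommGrpCat.subsingleton_of_isZero
        (Limits.isZero_cokernel_of_epi ((homologyFunctor A 0).map (toPoint W)))
    exact nonempty_addEquiv_of_subsingleton _ _
  · obtain ⟨k, rfl⟩ := Int.eq_succ_of_zero_lt hn
    have h := nonempty_relHomology_succ_equiv (A := A) h₀ hf k
    rw [add_sub_cancel_right]
    exact h

end Contractible

/-- The homology of `B^p / G` relative to its boundary. -/
theorem nonempty_relHomology_ballQuotient_equiv (A : Type u) [AddCommGroup A] {p : ℕ} (hp : 1 ≤ p)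
    (G : Subgroup (O p)) (n : ℤ) :
    Nonempty (RelHomology A (BallQuotient G) (ballBoundary G) n ≃+
      reducedH A (n - 1) (ULift.{u} (SphereQuotient G))) := by
  obtain ⟨e⟩ := nonempty_relHomology_uLift_equiv.{u} (A := A) (ballBoundary G) n
  obtain ⟨x, ⟨H⟩⟩ := exists_homotopic_const_ballQuotient G
  let f : C(ULift.{u} (SphereQuotient G), ULift.{u} (BallQuotient G)) :=
    ⟨fun x => ⟨sphereIncl G x.down⟩, by fun_prop⟩
  have hf : Topology.IsEmbedding f :=
    Homeomorph.ulift.symm.isEmbedding.comp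
      ((isEmbedding_sphereIncl G).comp Homeomorph.ulift.isEmbedding)
  have hrange : Set.range f = ULift.down ⁻¹' ballBoundary G := by
    rw [← range_sphereIncl]
    ext y
    constructor
    · rintro ⟨z, rfl⟩
      exact ⟨z.down, rfl⟩
    · rintro ⟨z, hz⟩
      exact ⟨⟨z⟩, ULift.ext _ _ hz⟩
  have h₀ : (ContinuousMap.id (ULift.{u} (BallQuotient G))).Homotopic (.const _ ⟨x⟩) :=
    ⟨{ toFun := fun y => ⟨H (y.1, y.2.down)⟩
       continuous_toFun := by fun_prop
       map_zero_left := fun y => ULift.ext _ _ (H.map_zero_left y.down)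
       map_one_left := fun y => ULift.ext _ _ (H.map_one_left y.down) }⟩
  have := sphereQuotient_nonempty G hp
  obtain ⟨e'⟩ := nonempty_relHomology_equiv_reducedH (A := A) h₀ hf n
  rw [hrange] at e'
  exact ⟨e.trans e'⟩

/-! ### The spectral sequence of the skeletal filtration -/

namespace SymmetricCWComplex

variable {X : Type u} [TopologicalSpace X] (𝒳 : SymmetricCWComplex X)
  (A : Type u) [AddCommGroup A]

/-- The singular chains of `X`, filtered by the chains in the skeleta. -/
def chainFiltration : FilteredDifferentialGroup (Chain A X) where
  D := boundary A X
  D_D := boundary_boundary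
  G := chainsDeg A X
  D_mem_G _ _ hx := boundary_mem_chainsDeg hx
  F p := chainsIn A (𝒳.skeleton p)
  F_mono _ _ h := chainsIn_mono (𝒳.skeleton_mono h)
  D_mem_F _ _ hx := boundary_mem_chainsIn hx

/-- The inclusion of a skeleton. -/
abbrev skeletonIncl (p : ℤ) : C(𝒳.skeleton p, X) := ⟨Subtype.val, continuous_subtype_val⟩

theorem isEmbedding_skeletonIncl (p : ℤ) : Topology.IsEmbedding (𝒳.skeletonIncl p) :=
  Topology.IsEmbedding.subtypeVal

theorem range_skeletonIncl (p : ℤ) : Set.range (𝒳.skeletonIncl p) = 𝒳.skeleton p :=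
  Subtype.range_coe

variable {A}

theorem mem_chainFiltration_Z {r p m : ℤ} {c : Chain A X} :
    c ∈ (𝒳.chainFiltration A).Z r p m ↔ c ∈ chainsIn A (𝒳.skeleton p) ∧ c ∈ chainsDeg A X m ∧
      boundary A X c ∈ chainsIn A (𝒳.skeleton (p - r)) :=
  (𝒳.chainFiltration A).mem_Z

theorem exists_skeletonIncl_eq {p n : ℤ} {c : Chain A X} (hc : c ∈ chainsIn A (𝒳.skeleton p))
    (hn : c ∈ chainsDeg A X n) :
    ∃ b ∈ chainsDeg A (𝒳.skeleton p) n, chainMap A (𝒳.skeletonIncl p) b = c := by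
  obtain ⟨b, -, hb, h⟩ := exists_chainMap_eq (𝒳.isEmbedding_skeletonIncl p)
    (𝒳.range_skeletonIncl p).ge hc hn
  exact ⟨b, hb, h⟩

theorem chainMap_skeletonIncl_mem {p : ℤ} (c : Chain A (𝒳.skeleton p)) :
    chainMap A (𝒳.skeletonIncl p) c ∈ chainsIn A (𝒳.skeleton p) := by
  have := chainMap_mem_chainsIn_range (𝒳.skeletonIncl p) c
  rwa [range_skeletonIncl] at this

theorem mem_skeletalFiltration_iff {p : ℤ} {n : ℕ} {c : ((chains A).obj (TopCat.of X)).X n} :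
    c ∈ 𝒳.skeletalFiltration A p n ↔ toChain A (.of X) n c ∈ chainsIn A (𝒳.skeleton p) := by
  constructor
  · rintro ⟨b, rfl⟩
    have := toChain_map (A := A) (incl (𝒳.skeleton p)) b
    rw [this]
    exact 𝒳.chainMap_skeletonIncl_mem _
  · intro h
    obtain ⟨b, hb, hbc⟩ := 𝒳.exists_skeletonIncl_eq h
      ((range_toChain (A := A) (X := .of X) n).le ⟨c, rfl⟩)
    obtain ⟨b, rfl⟩ := (range_toChain (A := A) (X := .of (𝒳.skeleton p)) n).ge hb
    exact ⟨b, toChain_injective n ((toChain_map (incl (𝒳.skeleton p)) b).trans hbc)⟩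

theorem mem_approxCycles_iff {r p m : ℤ} {n : ℕ} (hm : m = n)
    {c : ((chains A).obj (TopCat.of X)).X n} :
    c ∈ approxCycles (𝒳.skeletalFiltration A) r p n ↔
      toChain A (.of X) n c ∈ (𝒳.chainFiltration A).Z r p m := by
  subst hm
  rw [mem_chainFiltration_Z, approxCycles, AddSubgroup.mem_inf, AddSubgroup.mem_iInf,
    mem_skeletalFiltration_iff]
  refine and_congr_right fun _ =>
    (Iff.trans ?_ (and_iff_right ((range_toChain (A := A) (X := .of X) n).le ⟨c, rfl⟩)).symm)
  simp only [AddSubgroup.mem_comap, mem_skeletalFiltration_iff]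
  have hshape (k : ℕ) (hk : k + 1 ≠ n) : (((chains A).obj (.of X)).d n k).hom c = 0 :=
    congr(($(((chains A).obj (.of X)).shape n k hk)).hom c)
  cases n with
  | zero =>
    have h0 := boundary_toChain_zero (A := A) (X := .of X) c
    rw [h0]
    refine iff_of_true (fun k => ?_) (zero_mem _)
    rw [hshape k (by simp), map_zero]
    exact zero_mem _
  | succ n =>
    have h0 := boundary_toChain_succ (A := A) (X := .of X) c
    rw [h0]
    refine ⟨fun h => h n, fun h k => ?_⟩
    obtain rfl | hk := eq_or_ne k n
    · exact h
    · rw [hshape k (by simpa using hk), map_zero]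
      exact zero_mem _

theorem exists_approxCycles_eq {r p m : ℤ} {n : ℕ} (hm : m = n) {z : Chain A X}
    (hz : z ∈ (𝒳.chainFiltration A).Z r p m) :
    ∃ c ∈ approxCycles (𝒳.skeletalFiltration A) r p n, toChain A (.of X) n c = z := by
  obtain ⟨c, rfl⟩ := (range_toChain (A := A) (X := .of X) n).ge
    (hm ▸ (𝒳.mem_chainFiltration_Z.1 hz).2.1)
  exact ⟨c, (𝒳.mem_approxCycles_iff hm).2 hz, rfl⟩

/-- The class in `E_r^{p,n-p}` of an approximate cycle of the singular chain complex. -/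
def pageClass (r p : ℤ) (n : ℕ) :
    approxCycles (𝒳.skeletalFiltration A) r p n →+
      (𝒳.chainFiltration A).term r (p, (n : ℤ) - p) :=
  (Subquotient.mk _ _).comp
    (((toChain A (.of X) n).comp (AddSubgroup.subtype _)).codRestrict _ fun z =>
      (𝒳.mem_approxCycles_iff (add_sub_cancel p (n : ℤ))).1 z.2)

theorem isSpectralSequenceOf_spectralSequence :
    Nonempty (IsSpectralSequenceOf (𝒳.skeletalFiltration A)
      (𝒳.chainFiltration A).spectralSequence) := by
  refine ⟨{
    cls := fun r _ p n => 𝒳.pageClass r p n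
    cls_surjective := fun r _ p n x => ?_
    cls_eq_zero_iff := fun r _ p n z => ?_
    d_cls := fun r _ p n z w hw => ?_
    iso_cls := fun r hr p n z z' hz x hx => ?_
    isZero := fun r _ p q hpq => ?_ }⟩
  · obtain ⟨⟨z, hz⟩, rfl⟩ := Subquotient.mk_surjective _ _ x
    obtain ⟨c, hc, rfl⟩ := 𝒳.exists_approxCycles_eq (add_sub_cancel p (n : ℤ)) hz
    exact ⟨⟨c, hc⟩, rfl⟩
  · refine (Subquotient.mk_eq_zero_iff _).trans
      ((𝒳.chainFiltration A).mem_B.trans ⟨?_, ?_⟩)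
    · rintro ⟨y, hy, b, hb, h⟩
      obtain ⟨y, hy', rfl⟩ := 𝒳.exists_approxCycles_eq (add_sub_cancel p (n : ℤ)) hy
      obtain ⟨b, hb', rfl⟩ := 𝒳.exists_approxCycles_eq (n := n + 1) (by push_cast; ring) hb
      refine ⟨y, hy', b, hb', toChain_injective n (h.trans ?_)⟩
      rw [map_add]
      exact congr_arg _ (boundary_toChain_succ (X := .of X) b)
    · rintro ⟨y, hy, b, hb, h⟩
      refine ⟨_, (𝒳.mem_approxCycles_iff (add_sub_cancel p (n : ℤ))).1 hy, _,
        (𝒳.mem_approxCycles_iff (by push_cast; ring)).1 hb, ?_⟩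
      refine (congr_arg (toChain A (.of X) n) h).trans ((map_add _ _ _).trans ?_)
      exact congr_arg _ (boundary_toChain_succ (X := .of X) b).symm
  · refine (𝒳.chainFiltration A).page_d_mk ?_ _ _ ?_
    · ext
      · rfl
      · simp only [Prod.snd_add]
        push_cast
        ring
    · exact (congr_arg (toChain A (.of X) n) hw).trans
        (boundary_toChain_succ (X := .of X) (z : ((chains A).obj (.of X)).X (n + 1))).symm
  · exact (𝒳.chainFiltration A).spectralSequence_iso r hr _ _ _
      (congr_arg (toChain A (.of X) n) hz) x hx
  · have : Subsingleton ((𝒳.chainFiltration A).term r (p, q)) := by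
      refine subsingleton_of_forall_eq 0 fun x => ?_
      obtain ⟨z, rfl⟩ := Subquotient.mk_surjective _ _ x
      rw [Subquotient.mk_eq_zero_iff, chainsDeg_neg hpq (𝒳.mem_chainFiltration_Z.1 z.2).2.1]
      exact zero_mem _
    exact AddCommGrpCat.isZero_of_subsingleton (.of ((𝒳.chainFiltration A).term r (p, q)))

/-! ### The first page -/

/-- The first page consists of the homology groups of the skeleta relative to the preceding
skeleta. -/
theorem nonempty_relHomology_equiv_term {p q m : ℤ} (hm : p + q = m) :
    Nonempty (RelHomology A (𝒳.skeleton p) (Subtype.val ⁻¹' 𝒳.skeleton (p - 1)) m ≃+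
      (𝒳.chainFiltration A).term 1 (p, q)) := by
  subst hm
  have hinj := chainMap_injective (A := A) (𝒳.isEmbedding_skeletonIncl p).injective
  have hmem (c : relCycles A (𝒳.skeleton p) (Subtype.val ⁻¹' 𝒳.skeleton (p - 1)) (p + q)) :
      chainMap A (𝒳.skeletonIncl p) c ∈ (𝒳.chainFiltration A).Z 1 p (p + q) :=
    𝒳.mem_chainFiltration_Z.2 ⟨𝒳.chainMap_skeletonIncl_mem _, chainMap_mem_chainsDeg _ c.2.1, by
      rw [boundary_chainMap]
      exact chainMap_mem_chainsIn (fun x hx => hx) c.2.2⟩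
  refine (exists_addEquiv_of_ker_eq
    (Subquotient.mk _ (relBoundaries A (𝒳.skeleton p) (Subtype.val ⁻¹' 𝒳.skeleton (p - 1)) (p + q)))
    ((Subquotient.mk _ ((𝒳.chainFiltration A).B 1 p (p + q))).comp
      (((chainMap A (𝒳.skeletonIncl p)).comp (AddSubgroup.subtype _)).codRestrict _ hmem))
    (Subquotient.mk_surjective _ _) ?_ ?_).nonempty
  · intro x
    obtain ⟨⟨z, hz⟩, rfl⟩ := Subquotient.mk_surjective _ _ x
    obtain ⟨h1, h2, h3⟩ := 𝒳.mem_chainFiltration_Z.1 hz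
    obtain ⟨b, hb, rfl⟩ := 𝒳.exists_skeletonIncl_eq h1 h2
    rw [boundary_chainMap] at h3
    exact ⟨⟨b, mem_relCycles.2
      ⟨hb, mem_chainsIn_of_chainMap (𝒳.isEmbedding_skeletonIncl p).injective h3⟩⟩, rfl⟩
  · intro c
    rw [Subquotient.mk_eq_zero_iff]
    refine mem_relBoundaries.trans (Iff.trans ⟨?_, ?_⟩
      ((Subquotient.mk_eq_zero_iff _).trans (𝒳.chainFiltration A).mem_B).symm)
    · rintro ⟨a, ha, ha', b, hb, h⟩
      have ha2 : chainMap A (𝒳.skeletonIncl p) a ∈ chainsIn A (𝒳.skeleton (p - 1)) :=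
        chainMap_mem_chainsIn (fun x hx => hx) ha
      refine ⟨chainMap A (𝒳.skeletonIncl p) a, 𝒳.mem_chainFiltration_Z.2
        ⟨ha2, chainMap_mem_chainsDeg _ ha', ?_⟩, chainMap A (𝒳.skeletonIncl p) b,
        𝒳.mem_chainFiltration_Z.2 ⟨?_, chainMap_mem_chainsDeg _ hb, ?_⟩, ?_⟩
      · rw [sub_self, sub_zero]
        exact boundary_mem_chainsIn ha2
      · rw [add_sub_cancel_right]
        exact 𝒳.chainMap_skeletonIncl_mem b
      · rw [add_sub_cancel_right, sub_self, sub_zero]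
        exact boundary_mem_chainsIn (𝒳.chainMap_skeletonIncl_mem b)
      · refine (congr_arg (chainMap A (𝒳.skeletonIncl p)) h).trans ((map_add _ _ _).trans ?_)
        rw [← boundary_chainMap]
        rfl
    · rintro ⟨y, hy, b, hb, h⟩
      obtain ⟨hy1, hy2, -⟩ := 𝒳.mem_chainFiltration_Z.1 hy
      obtain ⟨hb1, hb2, -⟩ := 𝒳.mem_chainFiltration_Z.1 hb
      rw [add_sub_cancel_right] at hb1
      obtain ⟨b, hb', rfl⟩ := 𝒳.exists_skeletonIncl_eq hb1 hb2
      obtain ⟨y, hy', hyn, rfl⟩ := exists_chainMap_eq (𝒳.isEmbedding_skeletonIncl p)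
        ((𝒳.skeleton_mono (by lia)).trans (𝒳.range_skeletonIncl p).ge) hy1 hy2
      refine ⟨y, hy', hyn, b, hb', hinj (Eq.trans h ?_)⟩
      rw [map_add, ← boundary_chainMap]
      rfl

theorem nonempty_term_zero_equiv (q : ℤ) :
    Nonempty ((𝒳.chainFiltration A).term 1 (0, q) ≃+ H A q (𝒳.skeleton 0)) := by
  obtain ⟨e⟩ := 𝒳.nonempty_relHomology_equiv_term (A := A) (zero_add q)
  rw [𝒳.skeleton_of_neg (by lia : (0 : ℤ) - 1 < 0), Set.preimage_empty] at e
  obtain ⟨e'⟩ := nonempty_relHomology_empty_equiv (A := A) (.of (𝒳.skeleton 0)) q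
  exact ⟨e.symm.trans e'⟩

theorem nonempty_term_equiv_directSum {p : ℕ} (hp : 1 ≤ p) (q : ℤ) :
    Nonempty ((𝒳.chainFiltration A).term 1 ((p : ℤ), q) ≃+
      ⨁ i : 𝒳.cell p,
        reducedH A ((p : ℤ) + q - 1) (ULift.{u} (SphereQuotient (𝒳.group i)))) := by
  obtain ⟨e₁⟩ := 𝒳.nonempty_relHomology_equiv_term (A := A) (p := p) (q := q) rfl
  let e₂ := AddEquiv.ofBijective _ ((𝒳.isRelHomeo_cellsMap p).relMap_bijective (A := A)
    (Collar.sigma fun i => ballCollar (𝒳.group i)) (p + q))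
  obtain ⟨e₃⟩ := nonempty_relHomology_sigma_equiv (A := A)
    (fun i : 𝒳.cell p => ballBoundary (𝒳.group i)) (p + q)
  have e₄ (i : 𝒳.cell p) :=
    (nonempty_relHomology_ballQuotient_equiv A hp (𝒳.group i) (p + q)).some
  exact ⟨e₁.symm.trans (e₂.symm.trans (e₃.trans (DFinsupp.mapRange.addEquiv e₄)))⟩

theorem subsingleton_term_of_neg {r p q : ℤ} (hp : p < 0) :
    Subsingleton ((𝒳.chainFiltration A).term r (p, q)) := by
  refine subsingleton_of_forall_eq 0 fun x => ?_
  obtain ⟨z, rfl⟩ := Subquotient.mk_surjective _ _ x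
  have hz := (𝒳.mem_chainFiltration_Z.1 z.2).1
  rw [𝒳.skeleton_of_neg hp, chainsIn_empty, AddSubgroup.mem_bot] at hz
  rw [Subquotient.mk_eq_zero_iff, hz]
  exact zero_mem _

/-! ### Convergence -/

theorem homologyClass_mem_homologyFiltration_iff {p n : ℤ} (z : relCycles A X ∅ n) :
    homologyClass A (.of X) n z ∈ 𝒳.homologyFiltration A p n ↔
      ∃ y ∈ chainsIn A (𝒳.skeleton p), y ∈ relCycles A X ∅ n ∧
        ∃ b ∈ chainsDeg A X (n + 1), (z : Chain A X) = y + boundary A X b := by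
  have hinc (w : relCycles A (𝒳.skeleton p) ∅ n) :
      chainMap A (𝒳.skeletonIncl p) w ∈ relCycles A X ∅ n :=
    chainMap_mem_relCycles (Set.mapsTo_empty _ _) w.2
  have hmap (w : relCycles A (𝒳.skeleton p) ∅ n) :
      ((homologyFunctor A n).map (incl (𝒳.skeleton p))).hom
        (homologyClass A (.of (𝒳.skeleton p)) n w) = homologyClass A (.of X) n ⟨_, hinc w⟩ :=
    map_homologyClass (incl (𝒳.skeleton p)) w _ rfl
  have heq (y : relCycles A X ∅ n) :
      homologyClass A (.of X) n y = homologyClass A (.of X) n z ↔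
        ∃ b ∈ chainsDeg A X (n + 1), (z : Chain A X) = y + boundary A X b := by
    rw [eq_comm, ← sub_eq_zero, ← map_sub, homologyClass_eq_zero_iff]
    exact exists_congr fun b => and_congr_right fun _ => sub_eq_iff_eq_add'
  constructor
  · rintro ⟨x, hx⟩
    obtain ⟨w, rfl⟩ := homologyClass_surjective _ _ x
    exact ⟨_, 𝒳.chainMap_skeletonIncl_mem _, hinc w, (heq ⟨_, hinc w⟩).1 ((hmap w).symm.trans hx)⟩
  · rintro ⟨y, hy, hy', h⟩
    obtain ⟨hyn, hyb⟩ := mem_relCycles_empty.1 hy'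
    obtain ⟨w, hw, rfl⟩ := 𝒳.exists_skeletonIncl_eq hy hyn
    have hw' : w ∈ relCycles A (𝒳.skeleton p) ∅ n := mem_relCycles_empty.2 ⟨hw,
      chainMap_injective (𝒳.isEmbedding_skeletonIncl p).injective (by
        rw [← boundary_chainMap, hyb, map_zero])⟩
    exact ⟨_, (hmap ⟨w, hw'⟩).trans ((heq _).2 h)⟩

variable {N : ℕ}

theorem mem_chainFiltration_B_of_lt (hN : ∀ p, N < p → IsEmpty (𝒳.cell p)) {r p m : ℤ}
    (hp : N < p) {z : Chain A X} (hz : z ∈ (𝒳.chainFiltration A).Z r p m) :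
    z ∈ (𝒳.chainFiltration A).B r p m := by
  obtain ⟨h1, h2, h3⟩ := 𝒳.mem_chainFiltration_Z.1 hz
  refine (𝒳.chainFiltration A).mem_B.2 ⟨z, 𝒳.mem_chainFiltration_Z.2 ⟨?_, h2, ?_⟩, 0, zero_mem _,
    by simp⟩
  · rw [𝒳.skeleton_eq_univ hN (by lia), chainsIn_univ]
    trivial
  · rwa [sub_sub_sub_cancel_right]

theorem boundary_eq_zero_of_le {r p m : ℤ} (hr : N + 2 ≤ r)
    (hp : p ≤ N) {z : Chain A X} (hz : z ∈ (𝒳.chainFiltration A).Z r p m) :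
    boundary A X z = 0 := by
  have := (𝒳.mem_chainFiltration_Z.1 hz).2.2
  rwa [𝒳.skeleton_of_neg (by lia), chainsIn_empty, AddSubgroup.mem_bot] at this

theorem page_d_eq_zero (hN : ∀ p, N < p → IsEmpty (𝒳.cell p)) {r : ℤ} (hr : N + 2 ≤ r)
    (a b : ℤ × ℤ) : ((𝒳.chainFiltration A).page r).d a b = 0 := by
  by_cases h : a + (-r, r - 1) = b
  · rw [(𝒳.chainFiltration A).page_d h]
    ext x
    obtain ⟨z, rfl⟩ := Subquotient.mk_surjective _ _ x
    change (𝒳.chainFiltration A).termD r a b h _ = 0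
    rcases le_or_gt a.1 N with ha | ha
    · exact (Subquotient.mk_eq_zero_iff _).2
        (Set.mem_of_eq_of_mem (𝒳.boundary_eq_zero_of_le hr ha z.2) (zero_mem _))
    · rw [(Subquotient.mk_eq_zero_iff z).2 (𝒳.mem_chainFiltration_B_of_lt hN ha z.2), map_zero]
  · exact HomologicalComplex.shape _ _ _ h

theorem nonempty_term_equiv_gradedHomology (hN : ∀ p, N < p → IsEmpty (𝒳.cell p)) {r : ℤ}
    (hr : N + 2 ≤ r) (p q : ℤ) :
    Nonempty ((𝒳.chainFiltration A).term r (p, q) ≃+ 𝒳.gradedHomology A p (p + q)) := by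
  -- both groups are quotients of the group of the cycles in the skeleton
  let C : AddSubgroup (Chain A X) := chainsIn A (𝒳.skeleton p) ⊓ relCycles A X ∅ (p + q)
  have hCZ (c : C) : (c : Chain A X) ∈ (𝒳.chainFiltration A).Z r p (p + q) :=
    𝒳.mem_chainFiltration_Z.2 ⟨c.2.1, c.2.2.1, by
      rw [(mem_relCycles_empty.1 c.2.2).2]
      exact zero_mem _⟩
  let α : C →+ (𝒳.chainFiltration A).term r (p, q) :=
    (Subquotient.mk _ _).comp ((AddSubgroup.subtype C).codRestrict _ hCZ)
  have hCH (c : C) :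
      homologyClass A (.of X) (p + q) ⟨c, c.2.2⟩ ∈ 𝒳.homologyFiltration A p (p + q) :=
    (𝒳.homologyClass_mem_homologyFiltration_iff _).2
      ⟨c, c.2.1, c.2.2, 0, zero_mem _, by simp⟩
  let β : C →+ 𝒳.gradedHomology A p (p + q) :=
    (QuotientAddGroup.mk' _).comp
      (((homologyClass A (.of X) (p + q)).comp
        (AddSubgroup.inclusion (inf_le_right : C ≤ _))).codRestrict _ hCH)
  have hα : Function.Surjective α := fun x => by
    obtain ⟨z, rfl⟩ := Subquotient.mk_surjective _ _ x
    obtain ⟨h1, h2, -⟩ := 𝒳.mem_chainFiltration_Z.1 z.2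
    rcases le_or_gt p N with hp | hp
    · exact ⟨⟨z, h1, mem_relCycles_empty.2 ⟨h2, 𝒳.boundary_eq_zero_of_le hr hp z.2⟩⟩, rfl⟩
    · exact ⟨0, (map_zero α).trans ((Subquotient.mk_eq_zero_iff z).2
        (𝒳.mem_chainFiltration_B_of_lt hN hp z.2)).symm⟩
  have hβ : Function.Surjective β := fun x => by
    obtain ⟨⟨x, hx⟩, rfl⟩ := QuotientAddGroup.mk'_surjective _ x
    obtain ⟨z, rfl⟩ := homologyClass_surjective _ _ x
    obtain ⟨y, hy, hy', b, hb, h⟩ := (𝒳.homologyClass_mem_homologyFiltration_iff z).1 hx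
    refine ⟨⟨y, hy, hy'⟩, congr_arg (QuotientAddGroup.mk' _) (Subtype.ext ?_)⟩
    change homologyClass A (.of X) (p + q) ⟨y, hy'⟩ = _
    rw [eq_comm, ← sub_eq_zero, ← map_sub, homologyClass_eq_zero_iff]
    exact ⟨b, hb, sub_eq_iff_eq_add'.2 h⟩
  have hα0 (c : C) : α c = 0 ↔ ∃ y ∈ chainsIn A (𝒳.skeleton (p - 1)),
      y ∈ relCycles A X ∅ (p + q) ∧
        ∃ b ∈ chainsDeg A X (p + q + 1), (c : Chain A X) = y + boundary A X b := by
    refine (Subquotient.mk_eq_zero_iff _).trans ((𝒳.chainFiltration A).mem_B.trans ⟨?_, ?_⟩)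
    · rintro ⟨y, hy, b, hb, h⟩
      obtain ⟨hy1, hy2, -⟩ := 𝒳.mem_chainFiltration_Z.1 hy
      replace h : (c : Chain A X) = y + boundary A X b := h
      refine ⟨y, hy1, mem_relCycles_empty.2 ⟨hy2, ?_⟩, b, (𝒳.mem_chainFiltration_Z.1 hb).2.1, h⟩
      have := congr_arg (boundary A X) h
      rwa [map_add, boundary_boundary, add_zero, (mem_relCycles_empty.1 c.2.2).2, eq_comm] at this
    · rintro ⟨y, hy, hy', b, hb, h⟩
      -- for `0 ≤ p`, the filtration is exhausted in index `p + r - 1`, so that `b` is admissible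
      rcases lt_or_ge p 0 with hp | hp
      · have hc : (c : Chain A X) ∈ chainsIn A (𝒳.skeleton p) := c.2.1
        rw [𝒳.skeleton_of_neg hp, chainsIn_empty, AddSubgroup.mem_bot] at hc
        exact ⟨0, zero_mem _, 0, zero_mem _, by rw [map_zero, add_zero]; exact hc⟩
      · refine ⟨y, 𝒳.mem_chainFiltration_Z.2 ⟨hy, hy'.1, ?_⟩, b,
          𝒳.mem_chainFiltration_Z.2 ⟨?_, hb, ?_⟩, h⟩
        · rw [(mem_relCycles_empty.1 hy').2]
          exact zero_mem _
        · rw [𝒳.skeleton_eq_univ hN (by lia), chainsIn_univ]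
          trivial
        · rw [show p + r - 1 - (r - 1) = p by ring, ← sub_eq_iff_eq_add'.2 h]
          exact sub_mem c.2.1 (chainsIn_mono (𝒳.skeleton_mono (by lia)) hy)
  obtain ⟨e, -⟩ := exists_addEquiv_of_ker_eq α β hα hβ fun c => by
    refine (hα0 c).trans ((𝒳.homologyClass_mem_homologyFiltration_iff (p := p - 1)
      (⟨c, c.2.2⟩ : relCycles A X ∅ (p + q))).symm.trans ?_)
    refine (Iff.trans (QuotientAddGroup.eq_zero_iff (N := (𝒳.homologyFiltration A (p - 1)
      (p + q)).addSubgroupOf (𝒳.homologyFiltration A p (p + q))) ⟨_, hCH c⟩) ?_).symm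
    rw [AddSubgroup.mem_addSubgroupOf]
  exact ⟨e⟩

end SymmetricCWComplex

end SymmCW

end

theorem theorem4p1 {X : Type u} [TopologicalSpace X] (𝒳 : SymmetricCWComplex X)
    (hfin : 𝒳.FiniteDimensional) (A : Type u) [AddCommGroup A] :
    ∃ E : HomologicalSpectralSequence.{u},
      -- `E` is the spectral sequence of the skeletal filtration of the singular chains
      Nonempty (IsSpectralSequenceOf (𝒳.skeletalFiltration A) E) ∧
      -- the first page
      (∀ q : ℤ, Nonempty ((E.page 1).X (0, q) ≃+ H A q (𝒳.skeleton 0))) ∧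
      (∀ (p : ℕ) (q : ℤ), 1 ≤ p →
        Nonempty ((E.page 1).X ((p : ℤ), q) ≃+
          ⨁ i : 𝒳.cell p, reducedH A ((p : ℤ) + q - 1) (ULift.{u} (SphereQuotient (𝒳.group i))))) ∧
      (∀ p q : ℤ, p < 0 → Limits.IsZero ((E.page 1).X (p, q))) ∧
      -- convergence
      (∃ (R : ℤ) (hR : 1 ≤ R), ∀ (r : ℤ) (hr : R ≤ r),
        (∀ a b : ℤ × ℤ, (E.page r (hR.trans hr)).d a b = 0) ∧
        ∀ p q : ℤ, Nonempty ((E.page r (hR.trans hr)).X (p, q) ≃+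
          𝒳.gradedHomology A p (p + q))) := by
  obtain ⟨N, hN⟩ := hfin
  refine ⟨(𝒳.chainFiltration A).spectralSequence, 𝒳.isSpectralSequenceOf_spectralSequence,
    𝒳.nonempty_term_zero_equiv, fun p q hp => 𝒳.nonempty_term_equiv_directSum hp q,
    fun p q hp => ?_, N + 2, by lia, fun r hr => ⟨𝒳.page_d_eq_zero hN hr,
      𝒳.nonempty_term_equiv_gradedHomology hN hr⟩⟩
  have := 𝒳.subsingleton_term_of_neg (A := A) (r := 1) (q := q) hp
  exact AddCommGrpCat.isZero_of_subsingleton (.of ((𝒳.chainFiltration A).term 1 (p, q)))
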